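/- Let $0<\gamma<1$, $0<\gamma'<1/3$, $\beta>0$ and $\lambda,\lambda'>0$. Let $\mathcal P,\mathcal P'$ be independent Poisson point processes on $\mathbb S=\mathbb R\times[0,1]$ with intensity measures $\lambda|\cdot|$ and $\lambda'|\cdot|$, where $|\cdot|$ is Lebesgue measure. Consider the bipartite graph on the vertex sets $\mathcal P$ and $\mathcal P'$ in which $(x,u)\in\mathcal P$ and $(z,w)\in\mathcal P'$ are joined by an edge if and only if $$|x-z|\,u^{\gamma}\,w^{\gamma'}\le\beta .$$ For $n\in\mathbb N$ let $S_n=\sum_{p\in\mathcal P\cap([0,n]\times[0,1])}\deg(p)$ be the number of edges whose $\mathcal P$-endpoint lies in $[0,n]\times[0,1]$, where $\deg(p)$ counts all neighbors of $p$ in $\mathcal P'$. Then every $S_n$ is almost surely finite and integrable, and the following limits hold in distribution as $n\to\infty$. (a) If $\gamma<1/2$, then $n^{-1/2}(S_n-\mathbb E[S_n])\to\mathcal N(0,\sigma^2)$ for some $\sigma\ge0$. (b) If $\gamma\in(1/2,1)$, then $n^{-\gamma}(S_n-\mathbb E[S_n])$ converges to a (non-degenerate) $1/\gamma$-stable random variable.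 Here a real random variable $X$ that is not almost surely constant is called $\alpha$-stable if, for independent copies $X_1,X_2$ of $X$ and all $a,b>0$, there is $d\in\mathbb R$ such that $aX_1+bX_2$ has the same distribution as $(a^\alpha+b^\alpha)^{1/\alpha}X+d$. -/

import Mathlib

open MeasureTheory ProbabilityTheory Filter Topology
open scoped ENNReal NNReal

noncomputable section

/-- A Poisson process with intensity measure `ν`, as a random locally finite set of points:
the number of points in each measurable set `A` is a random variable, it is Poisson distributed
with parameter `ν A` if `ν A < ∞`, and the numbers of points in finitely many pairwise disjoint
sets are independent. -/
structure IsPoissonProcess {Ω E : Type*} [MeasurableSpace Ω] [TopologicalSpace E]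
    [MeasurableSpace E] (P : Ω → Set E) (ν : Measure E) (μ : Measure Ω) : Prop where
  locallyFinite : ∀ ω, ∀ K : Set E, IsCompact K → (P ω ∩ K).Finite
  measurable_count : ∀ A : Set E, MeasurableSet A → Measurable fun ω ↦ (P ω ∩ A).encard
  law_count : ∀ A : Set E, MeasurableSet A → ν A ≠ ∞ →
    μ.map (fun ω ↦ (P ω ∩ A).encard) =
      (poissonMeasure (ν A).toNNReal).map (fun k : ℕ ↦ (k : ℕ∞))
  indep_count : ∀ (k : ℕ) (A : Fin k → Set E), (∀ i, MeasurableSet (A i)) →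
    Pairwise (fun i j ↦ Disjoint (A i) (A j)) →
    iIndepFun (fun i ω ↦ (P ω ∩ A i).encard) μ

/-- The σ-algebra generated by a point process, i.e. by all its counts in measurable sets. -/
@[reducible]
def processSigmaAlgebra {Ω E : Type*} [MeasurableSpace E] (P : Ω → Set E) : MeasurableSpace Ω :=
  ⨆ A : {A : Set E // MeasurableSet A},
    MeasurableSpace.comap (fun ω ↦ (P ω ∩ (A : Set E)).encard) inferInstance

/-- The space `ℝ × [0,1]` of locations and marks; `volume` on it is Lebesgue measure. -/
abbrev Strip : Type := ℝ × unitInterval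

/-- `F((x,u),(z,w)) = |x - z| u^γ w^γ'`. -/
def connF (γ γ' : ℝ) (p p' : Strip) : ℝ :=
  |p.1 - p'.1| * (p.2 : ℝ) ^ γ * (p'.2 : ℝ) ^ γ'

/-- The neighborhood of `p`: all `p'` with `F(p,p') ≤ β`. -/
def nbhd (γ γ' β : ℝ) (p : Strip) : Set Strip := {p' | connF γ γ' p p' ≤ β}

/-- The degree of the vertex `p` in the bipartite graph: the number of points of `Q` that are
connected to `p`. -/
def bipDegree (γ γ' β : ℝ) (Q : Set Strip) (p : Strip) : ℕ∞ := (Q ∩ nbhd γ γ' β p).encard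

/-- The window `[0,n] × [0,1]`. -/
def window (n : ℕ) : Set Strip := {p | p.1 ∈ Set.Icc (0 : ℝ) n}

/-- The number of edges with first endpoint in the window: the sum of the degrees of the points
of `P` in the window, where the neighbors range over all points of `P'`. -/
def edgeCount {Ω : Type*} (γ γ' β : ℝ) (P P' : Ω → Set Strip) (n : ℕ) (ω : Ω) : ℝ≥0∞ :=
  ∑' p : ↥(P ω ∩ window n), (bipDegree γ γ' β (P' ω) p : ℝ≥0∞)

/-- `ν` is the law of a (non-degenerate) `α`-stable random variable: for independent `X₁, X₂`
with law `ν` and `a, b > 0`, the variable `a X₁ + b X₂` has the law of `c X₁ + d` for some real `d`,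
where `c = (a^α + b^α)^(1/α)`. -/
def IsStableLaw (α : ℝ) (ν : Measure ℝ) : Prop :=
  IsProbabilityMeasure ν ∧ (∀ x : ℝ, ν ≠ Measure.dirac x) ∧
    ∀ a b : ℝ, 0 < a → 0 < b → ∃ d : ℝ,
      (ν.map (fun x ↦ a * x)).conv (ν.map (fun x ↦ b * x)) =
        ν.map (fun x ↦ (a ^ α + b ^ α) ^ (1 / α) * x + d)

end

/-! ### Moments of the Poisson distribution -/

/-! `S_n` counts the pairs of points of two independent Poisson processes with intensities `ν`, `ν'`
that lie in a set `G` (`windowEdges`). Expanding in centered counts gives the orthogonal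
decomposition `S_n - E S_n = A + B + C`. Here `A` is linear in `P` with variance `∫ ν'(G_p)² dν`,
`B` is linear in `P'` with variance `∫ ν(G^{p'})² dν'`, and `C` is bilinear with variance `(ν ×
ν')(G)`. The mean degree of a vertex with mark `u` in `P` is a multiple of `u^(-γ)`, which is square
integrable only for `γ < 1/2`. From the side of `P'` it is a multiple of `w^(-γ')`, which is square
integrable, so `B` and `C` always have variance `O(n)`. The quantity `varBound` adds up the three
variances, with that of `A` weighted by `θ²`; `θ = 1` bounds the variance of the count, `θ = 0` its
squared `L²` distance to `A`.

For `γ > 1/2` the scale `n^γ` exceeds `√n`, so only `A` survives (`norm_charFun_pairCount_sub_le`).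
It is a compensated Poisson integral, and the substitution `v = n u` shows that its normalized
characteristic function is the exponential of `λ ∫_0^n (e^{iy} - 1 - iy) dv` with `y = c t v^(-γ)`
(`integral_compExp_section_windowEdges`). The integral converges to the one over `(0, ∞)`, whose
scaling property `stableExponent_mul` is stability.

For `γ < 1/2` the window is cut into blocks of length `L`. The numbers of edges inside the blocks
are independent and identically distributed with finite variance (`integral_cexp_sum_pairCount`), so
they satisfy the central limit theorem. An edge that is not inside a block starts within distance
`R` of a block boundary, or in the remainder after the last block, or has length at least `R`. Long
edges are handled by a Markov inequality: the indicator of length at least `R` is at most `R^(-δ) (β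
u^(-γ) w^(-γ'))^δ`, which is integrable enough for small `δ`. Hence these edges contribute variance
at most `ε n` (`exists_varBound_crossEdges_le`). The Gaussian approximations have variances in a
fixed compact interval, and a cluster point as `ε → 0` is the limit variance
(`exists_tendsto_gaussian`).

The moment and characteristic function formulas come from the defining properties of the counts
alone. They are exact for finite unions of products of dyadic cells, where counts are independent
Poisson variables (`lintegral_sq_cellSum_le`, `IsPoissonProcess.integral_cexp_linearPart`). The
inner unions of cells exhaust the interior of `G`. All sets used have null boundary, and a `ν ×
ν'`-null set almost surely contains no pair, so the formulas pass to the limit. -/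

lemma hasSum_mul_poisson (r : ℝ≥0) :
    HasSum (fun n : ℕ ↦ Real.exp (-r) * r ^ n / (n.factorial : ℝ) * n) r := by
  have h := (hasSum_one_poissonMeasure r).mul_left (r : ℝ)
  -- The term at `0` vanishes; in the others one factor `n` cancels against the factorial, which
  -- leaves `r` times the exponential series.
  rw [← hasSum_nat_add_iff' 1]
  simp only [Finset.range_one, Finset.sum_singleton, Nat.cast_zero, mul_zero, sub_zero]
  rw [mul_one] at h
  refine h.congr_fun fun n ↦ ?_
  rw [Nat.factorial_succ]
  push_cast
  have : (n.factorial : ℝ) ≠ 0 := by positivity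
  field_simp
  ring

lemma hasSum_sq_mul_poisson (r : ℝ≥0) :
    HasSum (fun n : ℕ ↦ Real.exp (-r) * r ^ n / (n.factorial : ℝ) * (n : ℝ) ^ 2) (r ^ 2 + r) := by
  have h := ((hasSum_mul_poisson r).mul_left (r : ℝ)).add
    ((hasSum_one_poissonMeasure r).mul_left (r : ℝ))
  rw [← hasSum_nat_add_iff' 1]
  simp only [Finset.range_one, Finset.sum_singleton, Nat.cast_zero, ne_eq, OfNat.ofNat_ne_zero,
    not_false_eq_true, zero_pow, mul_zero, sub_zero]
  rw [mul_one, ← sq] at h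
  refine h.congr_fun fun n ↦ ?_
  rw [Nat.factorial_succ]
  push_cast
  have : (n.factorial : ℝ) ≠ 0 := by positivity
  field_simp
  ring

lemma integrable_sq_poissonMeasure (r : ℝ≥0) :
    Integrable (fun n : ℕ ↦ (n : ℝ) ^ 2) (poissonMeasure r) := by
  rw [integrable_poissonMeasure_iff]
  simpa using (hasSum_sq_mul_poisson r).summable

lemma memLp_two_poissonMeasure (r : ℝ≥0) :
    MemLp (fun n : ℕ ↦ (n : ℝ)) 2 (poissonMeasure r) :=
  (memLp_two_iff_integrable_sq (by fun_prop)).2 (integrable_sq_poissonMeasure r)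

lemma integral_poissonMeasure_id (r : ℝ≥0) : ∫ n : ℕ, (n : ℝ) ∂(poissonMeasure r) = r := by
  rw [integral_poissonMeasure]
  simpa using (hasSum_mul_poisson r).tsum_eq

lemma integral_poissonMeasure_sq (r : ℝ≥0) :
    ∫ n : ℕ, (n : ℝ) ^ 2 ∂(poissonMeasure r) = r ^ 2 + r := by
  rw [integral_poissonMeasure]
  simpa using (hasSum_sq_mul_poisson r).tsum_eq

/-! ### Counts of a Poisson process -/

/-- The number of points of the set `s` in `A`, as a real number. -/
noncomputable def pointCount {E : Type*} (s A : Set E) : ℝ := ((s ∩ A).encard.toNat : ℝ)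

section Counts

variable {Ω E : Type*} [MeasurableSpace Ω] [TopologicalSpace E] [MeasurableSpace E]
  {P : Ω → Set E} {ν : Measure E} {μ : Measure Ω}

lemma IsPoissonProcess.measurable_pointCount (hP : IsPoissonProcess P ν μ) {A : Set E}
    (hA : MeasurableSet A) : Measurable fun ω ↦ pointCount (P ω) A :=
  (measurable_of_countable (fun k : ℕ∞ ↦ (k.toNat : ℝ))).comp (hP.measurable_count A hA)

lemma IsPoissonProcess.map_pointCount (hP : IsPoissonProcess P ν μ) {A : Set E}
    (hA : MeasurableSet A) (hA' : ν A ≠ ∞) :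
    μ.map (fun ω ↦ pointCount (P ω) A) =
      (poissonMeasure (ν A).toNNReal).map (fun k : ℕ ↦ (k : ℝ)) := by
  have h := congrArg (Measure.map (fun k : ℕ∞ ↦ (k.toNat : ℝ))) (hP.law_count A hA hA')
  rw [Measure.map_map (measurable_of_countable _) (hP.measurable_count A hA),
    Measure.map_map (measurable_of_countable _) (measurable_of_countable _)] at h
  exact h

lemma IsPoissonProcess.integral_comp_pointCount (hP : IsPoissonProcess P ν μ) {A : Set E}
    (hA : MeasurableSet A) (hA' : ν A ≠ ∞) {F : Type*} [NormedAddCommGroup F] [NormedSpace ℝ F]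
    {f : ℝ → F} (hf : StronglyMeasurable f) :
    ∫ ω, f (pointCount (P ω) A) ∂μ = ∫ k : ℕ, f k ∂(poissonMeasure (ν A).toNNReal) := by
  rw [← integral_map (hP.measurable_pointCount hA).aemeasurable hf.aestronglyMeasurable,
    hP.map_pointCount hA hA', integral_map (by fun_prop) hf.aestronglyMeasurable]

lemma IsPoissonProcess.memLp_pointCount (hP : IsPoissonProcess P ν μ) {A : Set E}
    (hA : MeasurableSet A) (hA' : ν A ≠ ∞) : MemLp (fun ω ↦ pointCount (P ω) A) 2 μ := by
  have h : MemLp (id : ℝ → ℝ) 2 (μ.map (fun ω ↦ pointCount (P ω) A)) := by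
    rw [hP.map_pointCount hA hA', memLp_map_measure_iff (by fun_prop) (by fun_prop)]
    exact memLp_two_poissonMeasure _
  rwa [memLp_map_measure_iff (by fun_prop) (hP.measurable_pointCount hA).aemeasurable] at h

lemma IsPoissonProcess.integral_pointCount (hP : IsPoissonProcess P ν μ) {A : Set E}
    (hA : MeasurableSet A) (hA' : ν A ≠ ∞) : ∫ ω, pointCount (P ω) A ∂μ = ν.real A := by
  rw [hP.integral_comp_pointCount hA hA' (f := fun x ↦ x) stronglyMeasurable_id]
  exact integral_poissonMeasure_id _

lemma IsPoissonProcess.integral_pointCount_sq (hP : IsPoissonProcess P ν μ) {A : Set E}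
    (hA : MeasurableSet A) (hA' : ν A ≠ ∞) :
    ∫ ω, pointCount (P ω) A ^ 2 ∂μ = ν.real A ^ 2 + ν.real A := by
  rw [hP.integral_comp_pointCount hA hA' (f := fun x ↦ x ^ 2)
    (by fun_prop : Measurable _).stronglyMeasurable]
  exact integral_poissonMeasure_sq _

lemma IsPoissonProcess.charFun_pointCount (hP : IsPoissonProcess P ν μ) {A : Set E}
    (hA : MeasurableSet A) (hA' : ν A ≠ ∞) (t : ℝ) :
    charFun (μ.map (fun ω ↦ pointCount (P ω) A)) t =
      Complex.exp (ν.real A * (Complex.exp (t * Complex.I) - 1)) := by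
  rw [hP.map_pointCount hA hA', charFun_map_cast_poissonMeasure]
  rfl

/-- Independence only concerns finite subfamilies, and these can be indexed by `Fin s.card`, where
`indep_count` applies. -/
lemma IsPoissonProcess.iIndepFun_pointCount (hP : IsPoissonProcess P ν μ) {ι : Type*}
    {A : ι → Set E} (hA : ∀ i, MeasurableSet (A i))
    (hd : Pairwise (fun i j ↦ Disjoint (A i) (A j))) :
    iIndepFun (fun i ω ↦ pointCount (P ω) (A i)) μ := by
  rw [iIndepFun_iff_finset]
  intro s
  have h := hP.indep_count s.card (fun k ↦ A (s.equivFin.symm k)) (fun k ↦ hA _)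
    (fun i j hij ↦ hd fun h ↦ hij (s.equivFin.symm.injective (Subtype.ext h)))
  have h2 := h.comp (fun _ k ↦ (k.toNat : ℝ)) (fun _ ↦ measurable_of_countable _)
  have h3 := h2.precomp s.equivFin.injective
  convert h3 using 2 with i
  ext ω
  simp [pointCount]

end Counts

lemma measurable_processSigmaAlgebra_pointCount {Ω E : Type*} [MeasurableSpace E]
    (P : Ω → Set E) {A : Set E}
    (hA : MeasurableSet A) :
    Measurable[processSigmaAlgebra P] fun ω ↦ pointCount (P ω) A := by
  have h : Measurable[processSigmaAlgebra P] fun ω ↦ (P ω ∩ A).encard :=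
    (comap_measurable _).mono
      (le_iSup (fun A : {A : Set E // MeasurableSet A} ↦
        MeasurableSpace.comap (fun ω ↦ (P ω ∩ (A : Set E)).encard) inferInstance) ⟨A, hA⟩) le_rfl
  exact (measurable_of_countable (fun k : ℕ∞ ↦ (k.toNat : ℝ))).comp h

/-- Two families of independent variables that generate independent σ-algebras form together
one family of independent variables. -/
lemma iIndepFun_sumElim {Ω ι κ : Type*} {m₁ m₂ mΩ : MeasurableSpace Ω} {μ : Measure Ω}
    (hm : Indep m₁ m₂ μ) {X : ι → Ω → ℝ} {Y : κ → Ω → ℝ} (hX : ∀ i, Measurable[m₁] (X i))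
    (hY : ∀ i, Measurable[m₂] (Y i)) (hXi : iIndepFun X μ) (hYi : iIndepFun Y μ) :
    iIndepFun (Sum.elim X Y) μ := by
  rw [iIndepFun_iff_measure_inter_preimage_eq_mul] at hXi hYi ⊢
  intro S sets hsets
  have h1 : ⋂ i ∈ S, Sum.elim X Y i ⁻¹' sets i =
      (⋂ i ∈ S.toLeft, X i ⁻¹' sets (Sum.inl i)) ∩ ⋂ i ∈ S.toRight, Y i ⁻¹' sets (Sum.inr i) := by
    ext ω
    simp
  rw [h1, Indep_iff _ _ μ |>.1 hm, hXi S.toLeft (fun i hi ↦ hsets _ (by simpa using hi)),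
    hYi S.toRight (fun i hi ↦ hsets _ (by simpa using hi))]
  · rw [← Finset.toLeft_disjSum_toRight (u := S), Finset.prod_disjSum]
    simp
  · exact @Finset.measurableSet_biInter _ _ m₁ _ _ fun i hi ↦ hX i (hsets _ (by simpa using hi))
  · exact @Finset.measurableSet_biInter _ _ m₂ _ _ fun i hi ↦ hY i (hsets _ (by simpa using hi))

/-! ### Counting measures of point sets -/

/-- The counting measure of a set of points. -/
noncomputable def pointMeasure {E : Type*} [MeasurableSpace E] (s : Set E) : Measure E :=
  Measure.sum fun p : s ↦ Measure.dirac (p : E)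

lemma pointMeasure_apply {E : Type*} [MeasurableSpace E] (s : Set E) {A : Set E}
    (hA : MeasurableSet A) : pointMeasure s A = ((s ∩ A).encard : ℝ≥0∞) := by
  rw [pointMeasure, Measure.sum_apply _ hA]
  simp_rw [Measure.dirac_apply' _ hA]
  rw [tsum_subtype s (A.indicator (1 : E → ℝ≥0∞)), ← ENNReal.tsum_set_one,
    tsum_subtype (s ∩ A) (fun _ ↦ (1 : ℝ≥0∞))]
  congr 1 with p
  by_cases h1 : p ∈ s <;> by_cases h2 : p ∈ A <;> simp [h1, h2]

lemma lintegral_pointMeasure {E : Type*} [MeasurableSpace E] [MeasurableSingletonClass E]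
    (s : Set E) (f : E → ℝ≥0∞) : ∫⁻ p, f p ∂(pointMeasure s) = ∑' p : s, f p := by
  rw [pointMeasure, lintegral_sum_measure]
  simp

instance sFinite_pointMeasure {E : Type*} [MeasurableSpace E] (s : Set E) [Countable s] :
    SFinite (pointMeasure s) := by
  unfold pointMeasure
  infer_instance

/-- The part of the strip with location in `[-R, R)`. -/
def stripBox (R : ℕ) : Set Strip := {p | p.1 ∈ Set.Ico (-(R : ℝ)) R}

lemma measurableSet_stripBox (R : ℕ) : MeasurableSet (stripBox R) :=
  measurable_fst measurableSet_Ico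

lemma monotone_stripBox : Monotone stripBox := by
  intro R R' h p hp
  have : (R : ℝ) ≤ R' := by exact_mod_cast h
  exact ⟨by linarith [hp.1], by linarith [hp.2]⟩

lemma iUnion_stripBox : ⋃ R, stripBox R = Set.univ := by
  refine Set.eq_univ_of_forall fun p ↦ ?_
  obtain ⟨R, hR⟩ := exists_nat_gt |p.1|
  exact Set.mem_iUnion.2 ⟨R, (abs_lt.1 hR).1.le, (abs_lt.1 hR).2⟩

/-- A compact set that contains the box. -/
lemma stripBox_subset_isCompact (R : ℕ) : ∃ K : Set Strip, IsCompact K ∧ stripBox R ⊆ K :=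
  ⟨Set.Icc (-(R : ℝ)) R ×ˢ Set.univ, isCompact_Icc.prod isCompact_univ,
    fun _ hp ↦ ⟨⟨hp.1, hp.2.le⟩, trivial⟩⟩

lemma measure_stripBox_ne_top (ν : Measure Strip) [IsLocallyFiniteMeasure ν] (R : ℕ) :
    ν (stripBox R) ≠ ∞ := by
  obtain ⟨K, hK, h⟩ := stripBox_subset_isCompact R
  exact ((measure_mono h).trans_lt hK.measure_lt_top).ne

lemma measurable_processSigmaAlgebra_pointMeasure {Ω : Type*} (P : Ω → Set Strip) {A : Set Strip}
    (hA : MeasurableSet A) :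
    Measurable[processSigmaAlgebra P] fun ω ↦ pointMeasure (P ω) A := by
  have h : Measurable[processSigmaAlgebra P] fun ω ↦ (P ω ∩ A).encard :=
    (comap_measurable _).mono
      (le_iSup (fun A : {A : Set Strip // MeasurableSet A} ↦
        MeasurableSpace.comap (fun ω ↦ (P ω ∩ (A : Set Strip)).encard) inferInstance) ⟨A, hA⟩)
      le_rfl
  simp_rw [pointMeasure_apply _ hA]
  exact (measurable_of_countable (fun k : ℕ∞ ↦ (k : ℝ≥0∞))).comp h

section PairCounts

variable {Ω : Type*} [MeasurableSpace Ω] {μ : Measure Ω} {P P' : Ω → Set Strip}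
  {ν ν' : Measure Strip}

lemma IsPoissonProcess.finite_inter_stripBox (hP : IsPoissonProcess P ν μ) (ω : Ω) (R : ℕ) :
    (P ω ∩ stripBox R).Finite := by
  obtain ⟨K, hK, h⟩ := stripBox_subset_isCompact R
  exact (hP.locallyFinite ω K hK).subset (Set.inter_subset_inter_right _ h)

lemma IsPoissonProcess.countable (hP : IsPoissonProcess P ν μ) (ω : Ω) : Countable (P ω) := by
  rw [Set.countable_coe_iff, ← Set.inter_univ (P ω), ← iUnion_stripBox, Set.inter_iUnion]
  exact Set.countable_iUnion fun R ↦ (hP.finite_inter_stripBox ω R).countable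

/-- Local finiteness makes the count in a bounded set finite, so the default value of `toNat` at `⊤`
does not occur. -/
lemma IsPoissonProcess.pointMeasure_eq_pointCount (hP : IsPoissonProcess P ν μ) (ω : Ω) {R : ℕ}
    {A : Set Strip} (hA : MeasurableSet A) (hAR : A ⊆ stripBox R) :
    pointMeasure (P ω) A = ENNReal.ofReal (pointCount (P ω) A) := by
  have hfin : (P ω ∩ A).Finite :=
    (hP.finite_inter_stripBox ω R).subset (Set.inter_subset_inter_right _ hAR)
  rw [pointMeasure_apply _ hA, pointCount, ENNReal.ofReal_natCast,
    ← ENat.toENNReal_coe, ENat.natCast_toNat (Set.encard_ne_top_iff.2 hfin)]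

lemma IsPoissonProcess.measurable_pointMeasure (hP : IsPoissonProcess P ν μ) :
    Measurable fun ω ↦ pointMeasure (P ω) := by
  refine Measure.measurable_of_measurable_coe _ fun A hA ↦ ?_
  simp_rw [pointMeasure_apply _ hA]
  exact (measurable_of_countable (fun k : ℕ∞ ↦ (k : ℝ≥0∞))).comp (hP.measurable_count A hA)

lemma IsPoissonProcess.lintegral_pointMeasure_of_subset [IsProbabilityMeasure μ]
    [IsLocallyFiniteMeasure ν]
    (hP : IsPoissonProcess P ν μ)
    {R : ℕ} {A : Set Strip} (hA : MeasurableSet A) (hAR : A ⊆ stripBox R) :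
    ∫⁻ ω, pointMeasure (P ω) A ∂μ = ν A := by
  have hA' : ν A ≠ ∞ := ((measure_mono hAR).trans_lt (measure_stripBox_ne_top ν R).lt_top).ne
  simp_rw [fun ω ↦ hP.pointMeasure_eq_pointCount ω hA hAR]
  rw [← ofReal_integral_eq_lintegral_ofReal, hP.integral_pointCount hA hA',
    ofReal_measureReal hA']
  · exact (hP.memLp_pointCount hA hA').integrable (by norm_num)
  · exact ae_of_all _ fun ω ↦ by simp [pointCount]

/-! ### Pairs of points of two processes -/

/-- The number of pairs of points of `s` and `s'` that lie in `G`. -/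
noncomputable def pairCount (s s' : Set Strip) (G : Set (Strip × Strip)) : ℝ≥0∞ :=
  ((pointMeasure s).prod (pointMeasure s')) G

/-- Restriction of the counting measure of pairs to a box. -/
noncomputable def boxedPairs (R : ℕ) (s s' : Set Strip) : Measure (Strip × Strip) :=
  ((pointMeasure s).restrict (stripBox R)).prod ((pointMeasure s').restrict (stripBox R))

lemma IsPoissonProcess.isFiniteMeasure_restrict (hP : IsPoissonProcess P ν μ) (R : ℕ) (ω : Ω) :
    IsFiniteMeasure ((pointMeasure (P ω)).restrict (stripBox R)) := by
  refine ⟨?_⟩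
  rw [Measure.restrict_apply_univ, hP.pointMeasure_eq_pointCount ω (measurableSet_stripBox R)
    subset_rfl]
  exact ENNReal.ofReal_lt_top

lemma boxedPairs_apply (hP : IsPoissonProcess P ν μ) (hP' : IsPoissonProcess P' ν' μ) (R : ℕ)
    (ω : Ω) {G : Set (Strip × Strip)} (hG : MeasurableSet G) :
    boxedPairs R (P ω) (P' ω) G = pairCount (P ω) (P' ω) (G ∩ stripBox R ×ˢ stripBox R) := by
  have := hP.countable ω
  have := hP'.countable ω
  rw [boxedPairs, Measure.prod_restrict, Measure.restrict_apply hG, pairCount]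

/-- On rectangles the measure is a product of two counts. The restriction to a box makes it finite,
as needed to extend measurability from the π-system of rectangles. -/
lemma measurable_boxedPairs (hP : IsPoissonProcess P ν μ) (hP' : IsPoissonProcess P' ν' μ)
    (R : ℕ) : Measurable fun ω ↦ boxedPairs R (P ω) (P' ω) := by
  have h1 := hP.isFiniteMeasure_restrict R
  have h2 := hP'.isFiniteMeasure_restrict R
  have key : ∀ A B : Set Strip, MeasurableSet A → MeasurableSet B →
      Measurable fun ω ↦ boxedPairs R (P ω) (P' ω) (A ×ˢ B) := by
    intro A B hA hB
    simp_rw [boxedPairs, Measure.prod_prod, Measure.restrict_apply hA, Measure.restrict_apply hB]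
    exact ((Measure.measurable_coe (hA.inter (measurableSet_stripBox R))).comp
      hP.measurable_pointMeasure).mul
      ((Measure.measurable_coe (hB.inter (measurableSet_stripBox R))).comp
        hP'.measurable_pointMeasure)
  have : ∀ ω, IsFiniteMeasure (boxedPairs R (P ω) (P' ω)) := fun ω ↦ by
    unfold boxedPairs; infer_instance
  refine Measurable.measure_of_isPiSystem generateFrom_prod.symm isPiSystem_prod ?_ ?_
  · rintro _ ⟨A, hA, B, hB, rfl⟩
    exact key A B hA hB
  · rw [← Set.univ_prod_univ]
    exact key _ _ .univ .univ

/-- The mean measure of the pairs is determined on rectangles, where independence of the two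
processes factors the expectation. -/
lemma bind_boxedPairs [IsProbabilityMeasure μ] [IsLocallyFiniteMeasure ν]
    [IsLocallyFiniteMeasure ν']
    (hP : IsPoissonProcess P ν μ) (hP' : IsPoissonProcess P' ν' μ)
    (hind : Indep (processSigmaAlgebra P) (processSigmaAlgebra P') μ) (R : ℕ) :
    μ.bind (fun ω ↦ boxedPairs R (P ω) (P' ω)) =
      (ν.restrict (stripBox R)).prod (ν'.restrict (stripBox R)) := by
  refine (Measure.prod_eq fun A B hA hB ↦ ?_).symm
  have h1 := hP.isFiniteMeasure_restrict R
  have h2 := hP'.isFiniteMeasure_restrict R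
  rw [Measure.bind_apply (hA.prod hB) (measurable_boxedPairs hP hP' R).aemeasurable]
  simp_rw [boxedPairs, Measure.prod_prod]
  have hA' := hA.inter (measurableSet_stripBox R)
  have hB' := hB.inter (measurableSet_stripBox R)
  simp_rw [Measure.restrict_apply hA, Measure.restrict_apply hB]
  rw [← hP.lintegral_pointMeasure_of_subset hA' Set.inter_subset_right,
    ← hP'.lintegral_pointMeasure_of_subset hB' Set.inter_subset_right]
  refine lintegral_mul_eq_lintegral_mul_lintegral_of_independent_measurableSpace ?_ ?_ hind
    (measurable_processSigmaAlgebra_pointMeasure P hA')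
    (measurable_processSigmaAlgebra_pointMeasure P' hB')
  · exact iSup_le fun A ↦ (hP.measurable_count A.1 A.2).comap_le
  · exact iSup_le fun A ↦ (hP'.measurable_count A.1 A.2).comap_le

lemma pairCount_eq_iSup (hP : IsPoissonProcess P ν μ) (hP' : IsPoissonProcess P' ν' μ)
    (ω : Ω) {G : Set (Strip × Strip)} (hG : MeasurableSet G) :
    pairCount (P ω) (P' ω) G = ⨆ R, boxedPairs R (P ω) (P' ω) G := by
  simp_rw [fun R ↦ boxedPairs_apply hP hP' R ω hG]
  have hmono : Monotone fun R ↦ G ∩ stripBox R ×ˢ stripBox R := fun R R' h ↦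
    Set.inter_subset_inter_right _ (Set.prod_mono (monotone_stripBox h) (monotone_stripBox h))
  simp_rw [pairCount]
  rw [← hmono.measure_iUnion, ← Set.inter_iUnion, Set.iUnion_prod_of_monotone monotone_stripBox
    monotone_stripBox, iUnion_stripBox, Set.univ_prod_univ, Set.inter_univ]

lemma measurable_pairCount (hP : IsPoissonProcess P ν μ) (hP' : IsPoissonProcess P' ν' μ)
    {G : Set (Strip × Strip)} (hG : MeasurableSet G) :
    Measurable fun ω ↦ pairCount (P ω) (P' ω) G := by
  simp_rw [fun ω ↦ pairCount_eq_iSup hP hP' ω hG]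
  exact Measurable.iSup fun R ↦
    (Measure.measurable_coe hG).comp (measurable_boxedPairs hP hP' R)

/-- The expected number of pairs of points in `G`. -/
lemma lintegral_pairCount [IsProbabilityMeasure μ] [IsLocallyFiniteMeasure ν]
    [IsLocallyFiniteMeasure ν']
    (hP : IsPoissonProcess P ν μ) (hP' : IsPoissonProcess P' ν' μ)
    (hind : Indep (processSigmaAlgebra P) (processSigmaAlgebra P') μ)
    {G : Set (Strip × Strip)} (hG : MeasurableSet G) :
    ∫⁻ ω, pairCount (P ω) (P' ω) G ∂μ = (ν.prod ν') G := by
  have hmono : Monotone fun R ↦ G ∩ stripBox R ×ˢ stripBox R := fun R R' h ↦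
    Set.inter_subset_inter_right _ (Set.prod_mono (monotone_stripBox h) (monotone_stripBox h))
  simp_rw [fun ω ↦ pairCount_eq_iSup hP hP' ω hG]
  rw [lintegral_iSup]
  · have h : ∀ R, ∫⁻ ω, boxedPairs R (P ω) (P' ω) G ∂μ =
        (ν.prod ν') (G ∩ stripBox R ×ˢ stripBox R) := fun R ↦ by
      rw [← Measure.bind_apply hG (measurable_boxedPairs hP hP' R).aemeasurable,
        bind_boxedPairs hP hP' hind, Measure.prod_restrict, Measure.restrict_apply hG]
    simp_rw [h]
    rw [← hmono.measure_iUnion, ← Set.inter_iUnion, Set.iUnion_prod_of_monotone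
      monotone_stripBox monotone_stripBox, iUnion_stripBox, Set.univ_prod_univ, Set.inter_univ]
  · exact fun R ↦ (Measure.measurable_coe hG).comp (measurable_boxedPairs hP hP' R)
  · intro R R' h ω
    simp only [boxedPairs_apply hP hP' _ ω hG]
    exact measure_mono (hmono h)

end PairCounts

/-! ### Dyadic cells of the strip -/

/-- The index of the dyadic cell of side length `2⁻ᵐ` that contains a point of the strip. -/
noncomputable def stripCell (m : ℕ) (p : Strip) : ℤ × ℤ :=
  (⌊(2 : ℝ) ^ m * p.1⌋, ⌊(2 : ℝ) ^ m * (p.2 : ℝ)⌋)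

/-- The dyadic cell with a given index. -/
def cellSet (m : ℕ) (i : ℤ × ℤ) : Set Strip := stripCell m ⁻¹' {i}

/-- The indices of the cells that make up `stripBox m`. -/
noncomputable def cellBox (m : ℕ) : Finset (ℤ × ℤ) :=
  Finset.Ico (-(m * 2 ^ m : ℤ)) (m * 2 ^ m) ×ˢ Finset.Icc 0 (2 ^ m)

lemma measurable_stripCell (m : ℕ) : Measurable (stripCell m) := by
  unfold stripCell
  fun_prop

lemma measurableSet_cellSet (m : ℕ) (i : ℤ × ℤ) : MeasurableSet (cellSet m i) :=
  measurable_stripCell m (measurableSet_singleton i)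

lemma pairwise_disjoint_cellSet (m : ℕ) :
    Pairwise fun i j ↦ Disjoint (cellSet m i) (cellSet m j) :=
  fun _ _ hij ↦ Disjoint.preimage _ (Set.disjoint_singleton.2 hij)

/-- Only the location matters: marks in `[0,1]` always have an index between `0` and `2 ^ m`. The
top index, attained at mark `1`, is the reason for `Icc` in `cellBox`. -/
lemma stripCell_mem_cellBox {m : ℕ} {p : Strip} : stripCell m p ∈ cellBox m ↔ p ∈ stripBox m := by
  have h2 : (0 : ℝ) < 2 ^ m := by positivity
  have h0 := p.2.2.1
  have h1 := p.2.2.2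
  have ha : (0 : ℤ) ≤ ⌊(2 : ℝ) ^ m * (p.2 : ℝ)⌋ := Int.floor_nonneg.2 (by positivity)
  have hb : ⌊(2 : ℝ) ^ m * (p.2 : ℝ)⌋ ≤ 2 ^ m := by
    have : ((⌊(2 : ℝ) ^ m * (p.2 : ℝ)⌋ : ℤ) : ℝ) ≤ 2 ^ m :=
      (Int.floor_le _).trans (by nlinarith)
    exact_mod_cast this
  simp only [stripCell, cellBox, Finset.mem_product, Finset.mem_Ico, Finset.mem_Icc, ha, hb,
    and_self, and_true, stripBox, Set.mem_ofPred_eq, Set.mem_Ico, Int.le_floor, Int.floor_lt]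
  push_cast
  constructor
  · rintro ⟨h3, h4⟩
    constructor
    · nlinarith
    · nlinarith
  · rintro ⟨h3, h4⟩
    constructor <;> nlinarith

lemma cellSet_subset_stripBox {m : ℕ} {i : ℤ × ℤ} (hi : i ∈ cellBox m) :
    cellSet m i ⊆ stripBox m := by
  rintro p rfl
  exact stripCell_mem_cellBox.1 hi

/-- A half-unit interval of the refined grid lies in a single unit interval; this makes the dyadic
cells nested and `innerSet` increasing in the level. -/
lemma floor_eq_floor_of_floor_two_mul {x y : ℝ} (h : ⌊2 * x⌋ = ⌊2 * y⌋) : ⌊x⌋ = ⌊y⌋ := by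
  have key : ∀ z : ℝ, 2 * ⌊z⌋ ≤ ⌊2 * z⌋ ∧ ⌊2 * z⌋ < 2 * ⌊z⌋ + 2 := fun z ↦ by
    rw [Int.le_floor, Int.floor_lt]
    push_cast
    exact ⟨by linarith [Int.floor_le z], by linarith [Int.lt_floor_add_one z]⟩
  have h1 := key x
  have h2 := key y
  omega

lemma stripCell_eq_of_succ {m : ℕ} {p q : Strip} (h : stripCell (m + 1) p = stripCell (m + 1) q) :
    stripCell m p = stripCell m q := by
  simp only [stripCell, Prod.mk.injEq, pow_succ', mul_assoc] at h ⊢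
  exact ⟨floor_eq_floor_of_floor_two_mul h.1, floor_eq_floor_of_floor_two_mul h.2⟩

lemma dist_lt_of_stripCell_eq {m : ℕ} {p q : Strip} (h : stripCell m p = stripCell m q) :
    dist p q < (2⁻¹ : ℝ) ^ m := by
  simp only [stripCell, Prod.mk.injEq] at h
  have h2 : (0 : ℝ) < 2 ^ m := by positivity
  have key : ∀ x y : ℝ, ⌊(2 : ℝ) ^ m * x⌋ = ⌊(2 : ℝ) ^ m * y⌋ → |x - y| < (2⁻¹ : ℝ) ^ m := by
    intro x y hxy
    have := Int.abs_sub_lt_one_of_floor_eq_floor hxy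
    rw [← mul_sub, abs_mul, abs_of_pos h2] at this
    rw [inv_pow, ← one_div, lt_div_iff₀ h2]
    linarith
  rw [Prod.dist_eq, max_lt_iff]
  exact ⟨key _ _ h.1, key _ _ h.2⟩

/-- The pairs of cells in `stripBox m` whose product is contained in `G`. -/
noncomputable def innerPairs (m : ℕ) (G : Set (Strip × Strip)) :
    Finset ((ℤ × ℤ) × (ℤ × ℤ)) := by
  classical
  exact (cellBox m ×ˢ cellBox m).filter fun ij ↦ cellSet m ij.1 ×ˢ cellSet m ij.2 ⊆ G

lemma mem_innerPairs {m : ℕ} {G : Set (Strip × Strip)} {ij : (ℤ × ℤ) × (ℤ × ℤ)} :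
    ij ∈ innerPairs m G ↔ (ij.1 ∈ cellBox m ∧ ij.2 ∈ cellBox m) ∧
      cellSet m ij.1 ×ˢ cellSet m ij.2 ⊆ G := by
  simp [innerPairs]

/-- The union of the products of cells that are contained in `G`. -/
def innerSet (m : ℕ) (G : Set (Strip × Strip)) : Set (Strip × Strip) :=
  {q | (stripCell m q.1, stripCell m q.2) ∈ innerPairs m G}

lemma measurableSet_innerSet (m : ℕ) (G : Set (Strip × Strip)) :
    MeasurableSet (innerSet m G) :=
  ((measurable_stripCell m).prodMap (measurable_stripCell m)) (Finset.measurableSet _)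

lemma innerSet_subset (m : ℕ) (G : Set (Strip × Strip)) : innerSet m G ⊆ G :=
  fun _ hq ↦ (mem_innerPairs.1 hq).2 ⟨rfl, rfl⟩

lemma monotone_innerSet (G : Set (Strip × Strip)) : Monotone fun m ↦ innerSet m G := by
  refine monotone_nat_of_le_succ fun m q hq ↦ ?_
  obtain ⟨⟨h1, h2⟩, h3⟩ := mem_innerPairs.1 hq
  refine mem_innerPairs.2 ⟨⟨?_, ?_⟩, ?_⟩
  · exact stripCell_mem_cellBox.2 (monotone_stripBox m.le_succ (stripCell_mem_cellBox.1 h1))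
  · exact stripCell_mem_cellBox.2 (monotone_stripBox m.le_succ (stripCell_mem_cellBox.1 h2))
  · rintro r ⟨hr1, hr2⟩
    exact h3 ⟨stripCell_eq_of_succ hr1, stripCell_eq_of_succ hr2⟩

/-- Cells of level `m` have diameter at most `2⁻ᵐ`, so the product of the cells around an interior
point eventually lies in a ball contained in `G`. -/
lemma interior_subset_iUnion_innerSet (G : Set (Strip × Strip)) :
    interior G ⊆ ⋃ m, innerSet m G := by
  intro q hq
  obtain ⟨ε, hε, hball⟩ := Metric.isOpen_iff.1 isOpen_interior q hq
  have h1 : ∀ᶠ m : ℕ in atTop, (2⁻¹ : ℝ) ^ m < ε :=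
    (tendsto_pow_atTop_nhds_zero_of_lt_one (by norm_num) (by norm_num)).eventually_lt_const hε
  have hbox : ∀ p : Strip, ∀ᶠ m in atTop, p ∈ stripBox m := fun p ↦ by
    obtain ⟨R, hR⟩ := Set.mem_iUnion.1 (iUnion_stripBox.symm ▸ Set.mem_univ p)
    filter_upwards [eventually_ge_atTop R] with m hm using monotone_stripBox hm hR
  obtain ⟨m, hm, h2, h3⟩ := (h1.and ((hbox q.1).and (hbox q.2))).exists
  refine Set.mem_iUnion.2 ⟨m, mem_innerPairs.2
    ⟨⟨stripCell_mem_cellBox.2 h2, stripCell_mem_cellBox.2 h3⟩, ?_⟩⟩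
  rintro r ⟨hr1, hr2⟩
  refine interior_subset (hball ?_)
  rw [Metric.mem_ball, Prod.dist_eq, max_lt_iff]
  exact ⟨(dist_lt_of_stripCell_eq hr1).trans hm, (dist_lt_of_stripCell_eq hr2).trans hm⟩

lemma innerSet_eq_biUnion (m : ℕ) (G : Set (Strip × Strip)) :
    innerSet m G = ⋃ ij ∈ innerPairs m G, cellSet m ij.1 ×ˢ cellSet m ij.2 := by
  ext q
  simp only [innerSet, Set.mem_ofPred_eq, Set.mem_iUnion, Set.mem_prod, cellSet, Set.mem_preimage,
    Set.mem_singleton_iff, exists_prop]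
  constructor
  · exact fun h ↦ ⟨_, h, rfl, rfl⟩
  · rintro ⟨⟨i, j⟩, h, rfl, rfl⟩
    exact h

lemma prod_innerSet (ν ν' : Measure Strip) [SFinite ν] [SFinite ν'] (m : ℕ)
    (G : Set (Strip × Strip)) :
    (ν.prod ν') (innerSet m G) =
      ∑ ij ∈ innerPairs m G, ν (cellSet m ij.1) * ν' (cellSet m ij.2) := by
  rw [innerSet_eq_biUnion, measure_biUnion_finset]
  · simp_rw [Measure.prod_prod]
  · rintro ⟨i, j⟩ - ⟨i', j'⟩ - hij
    refine Set.disjoint_left.2 ?_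
    rintro q ⟨h1, h2⟩ ⟨h3, h4⟩
    exact hij (Prod.ext (h1.symm.trans h3) (h2.symm.trans h4))
  · exact fun ij _ ↦ (measurableSet_cellSet m _).prod (measurableSet_cellSet m _)

lemma lintegral_comp_stripCell (ν : Measure Strip) (m : ℕ) {g : ℤ × ℤ → ℝ≥0∞}
    (hg : ∀ i ∉ cellBox m, g i = 0) :
    ∫⁻ p, g (stripCell m p) ∂ν = ∑ i ∈ cellBox m, ν (cellSet m i) * g i := by
  have h : ∀ p, g (stripCell m p) =
      ∑ i ∈ cellBox m, (cellSet m i).indicator (fun _ ↦ g i) p := by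
    intro p
    by_cases hp : stripCell m p ∈ cellBox m
    · rw [Finset.sum_eq_single_of_mem _ hp]
      · rw [Set.indicator_of_mem (show p ∈ cellSet m (stripCell m p) from rfl)]
      · exact fun j _ hj ↦ Set.indicator_of_notMem (fun h ↦ hj h.symm) _
    · rw [hg _ hp, Finset.sum_eq_zero]
      exact fun i hi ↦ Set.indicator_of_notMem (fun h : stripCell m p = i ↦ hp (h ▸ hi)) _
  simp_rw [h]
  rw [lintegral_finsetSum _ fun i _ ↦ measurable_const.indicator (measurableSet_cellSet m i)]
  refine Finset.sum_congr rfl fun i _ ↦ ?_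
  rw [lintegral_indicator_const (measurableSet_cellSet m i), mul_comm]

lemma integral_comp_stripCell (ν : Measure Strip) [IsLocallyFiniteMeasure ν] (m : ℕ)
    {g : ℤ × ℤ → ℂ} (hg : ∀ i ∉ cellBox m, g i = 0) :
    ∫ p, g (stripCell m p) ∂ν = ∑ i ∈ cellBox m, ν.real (cellSet m i) * g i := by
  have h : ∀ p, g (stripCell m p) =
      ∑ i ∈ cellBox m, (cellSet m i).indicator (fun _ ↦ g i) p := by
    intro p
    by_cases hp : stripCell m p ∈ cellBox m
    · rw [Finset.sum_eq_single_of_mem _ hp]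
      · rw [Set.indicator_of_mem (show p ∈ cellSet m (stripCell m p) from rfl)]
      · exact fun j _ hj ↦ Set.indicator_of_notMem (fun h ↦ hj h.symm) _
    · rw [hg _ hp, Finset.sum_eq_zero]
      exact fun i hi ↦ Set.indicator_of_notMem (fun h : stripCell m p = i ↦ hp (h ▸ hi)) _
  simp_rw [h]
  rw [integral_finsetSum]
  · refine Finset.sum_congr rfl fun i _ ↦ ?_
    rw [integral_indicator_const _ (measurableSet_cellSet m i)]
    simp
  · intro i hi
    refine (integrable_indicator_iff (measurableSet_cellSet m i)).2 (integrableOn_const ?_)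
    exact ((measure_mono (cellSet_subset_stripBox hi)).trans_lt
      (measure_stripBox_ne_top ν m).lt_top).ne

section Sections

open Classical in
lemma measure_section_innerSet (ν' : Measure Strip) (m : ℕ) (G : Set (Strip × Strip))
    (p : Strip) :
    ν' (Prod.mk p ⁻¹' innerSet m G) = ∑ j ∈ cellBox m,
      if (stripCell m p, j) ∈ innerPairs m G then ν' (cellSet m j) else 0 := by
  rw [← lintegral_indicator_one ((measurableSet_innerSet m G).preimage measurable_prodMk_left)]
  have := lintegral_comp_stripCell ν' m
    (g := fun j ↦ if (stripCell m p, j) ∈ innerPairs m G then 1 else 0) (fun j hj ↦ by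
      rw [if_neg fun h ↦ hj (mem_innerPairs.1 h).1.2])
  simp only [mul_ite, mul_one, mul_zero] at this
  rw [← this]
  refine lintegral_congr fun q ↦ ?_
  simp [Set.indicator_apply, innerSet]

open Classical in
lemma measure_section_innerSet' (ν : Measure Strip) (m : ℕ) (G : Set (Strip × Strip))
    (p' : Strip) :
    ν ((fun p ↦ (p, p')) ⁻¹' innerSet m G) = ∑ i ∈ cellBox m,
      if (i, stripCell m p') ∈ innerPairs m G then ν (cellSet m i) else 0 := by
  rw [← lintegral_indicator_one ((measurableSet_innerSet m G).preimage measurable_prodMk_right)]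
  have := lintegral_comp_stripCell ν m
    (g := fun i ↦ if (i, stripCell m p') ∈ innerPairs m G then 1 else 0) (fun j hj ↦ by
      rw [if_neg fun h ↦ hj (mem_innerPairs.1 h).1.1])
  simp only [mul_ite, mul_one, mul_zero] at this
  rw [← this]
  refine lintegral_congr fun q ↦ ?_
  simp [Set.indicator_apply, innerSet]

end Sections

/-! ### Second moments of bilinear sums -/

/-- The squares of the factors are independent and integrable, so no fourth moments are needed. -/
lemma memLp_two_mul_of_indep {Ω : Type*} {m₁ m₂ mΩ : MeasurableSpace Ω} {μ : Measure Ω}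
    (h₁ : m₁ ≤ mΩ) (h₂ : m₂ ≤ mΩ) (hm : Indep m₁ m₂ μ) {X Y : Ω → ℝ} (hX : Measurable[m₁] X)
    (hY : Measurable[m₂] Y) (hX2 : MemLp X 2 μ) (hY2 : MemLp Y 2 μ) :
    MemLp (fun ω ↦ X ω * Y ω) 2 μ := by
  have hXm : Measurable X := hX.mono h₁ le_rfl
  have hYm : Measurable Y := hY.mono h₂ le_rfl
  refine (memLp_two_iff_integrable_sq (f := fun ω ↦ X ω * Y ω)
    (hXm.mul hYm).aestronglyMeasurable).2 ?_
  simp_rw [mul_pow]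
  have hi : IndepFun (fun ω ↦ X ω ^ 2) (fun ω ↦ Y ω ^ 2) μ :=
    indep_of_indep_of_le_left (indep_of_indep_of_le_right hm (hY.pow_const 2).comap_le)
      (hX.pow_const 2).comap_le
  exact hi.integrable_mul ((memLp_two_iff_integrable_sq hXm.aestronglyMeasurable).1 hX2)
    ((memLp_two_iff_integrable_sq hYm.aestronglyMeasurable).1 hY2)

/-- The second moment of a bilinear form in two orthogonal systems of variables that generate
independent σ-algebras. -/
lemma integral_sq_bilinear_sum {Ω I J : Type*} [DecidableEq I] [DecidableEq J]
    {m₁ m₂ mΩ : MeasurableSpace Ω} {μ : Measure Ω}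
    (h₁ : m₁ ≤ mΩ) (h₂ : m₂ ≤ mΩ) (hm : Indep m₁ m₂ μ) {s : Finset I} {t : Finset J}
    {V : I → Ω → ℝ} {W : J → Ω → ℝ} {v : I → ℝ} {w : J → ℝ} (c : I × J → ℝ)
    (hV : ∀ i ∈ s, Measurable[m₁] (V i)) (hW : ∀ j ∈ t, Measurable[m₂] (W j))
    (hV2 : ∀ i ∈ s, MemLp (V i) 2 μ) (hW2 : ∀ j ∈ t, MemLp (W j) 2 μ)
    (hVo : ∀ i ∈ s, ∀ k ∈ s, ∫ ω, V i ω * V k ω ∂μ = if i = k then v i else 0)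
    (hWo : ∀ i ∈ t, ∀ k ∈ t, ∫ ω, W i ω * W k ω ∂μ = if i = k then w i else 0) :
    MemLp (fun ω ↦ ∑ x ∈ s ×ˢ t, c x * (V x.1 ω * W x.2 ω)) 2 μ ∧
    ∫ ω, (∑ x ∈ s ×ˢ t, c x * (V x.1 ω * W x.2 ω)) ^ 2 ∂μ =
      ∑ x ∈ s ×ˢ t, c x ^ 2 * (v x.1 * w x.2) := by
  have hL : ∀ x ∈ s ×ˢ t, MemLp (fun ω ↦ c x * (V x.1 ω * W x.2 ω)) 2 μ := fun x hx ↦ by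
    obtain ⟨h3, h4⟩ := Finset.mem_product.1 hx
    exact (memLp_two_mul_of_indep h₁ h₂ hm (hV _ h3) (hW _ h4) (hV2 _ h3) (hW2 _ h4)).const_mul _
  refine ⟨memLp_finsetSum _ hL, ?_⟩
  simp_rw [sq, Finset.sum_mul_sum]
  have hint : ∀ x ∈ s ×ˢ t, ∀ y ∈ s ×ˢ t, Integrable
      (fun ω ↦ c x * (V x.1 ω * W x.2 ω) * (c y * (V y.1 ω * W y.2 ω))) μ :=
    fun x hx y hy ↦ (hL x hx).integrable_mul (hL y hy)
  rw [integral_finsetSum _ fun x hx ↦ integrable_finsetSum _ fun y hy ↦ hint x hx y hy]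
  refine Finset.sum_congr rfl fun x hx ↦ ?_
  rw [integral_finsetSum _ fun y hy ↦ hint x hx y hy]
  obtain ⟨hx1, hx2⟩ := Finset.mem_product.1 hx
  -- Independence factors the mixed moment into one for `V` and one for `W`; by orthogonality it
  -- vanishes unless both indices agree.
  have key : ∀ y ∈ s ×ˢ t,
      ∫ ω, c x * (V x.1 ω * W x.2 ω) * (c y * (V y.1 ω * W y.2 ω)) ∂μ =
        if x = y then c x * c x * (v x.1 * w x.2) else 0 := by
    intro y hy
    obtain ⟨hy1, hy2⟩ := Finset.mem_product.1 hy
    have h3 : ∀ ω, c x * (V x.1 ω * W x.2 ω) * (c y * (V y.1 ω * W y.2 ω)) =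
        c x * c y * ((V x.1 ω * V y.1 ω) * (W x.2 ω * W y.2 ω)) := fun ω ↦ by ring
    have hi : IndepFun (fun ω ↦ V x.1 ω * V y.1 ω) (fun ω ↦ W x.2 ω * W y.2 ω) μ :=
      indep_of_indep_of_le_left (indep_of_indep_of_le_right hm
        ((hW _ hx2).mul (hW _ hy2)).comap_le) ((hV _ hx1).mul (hV _ hy1)).comap_le
    simp_rw [h3]
    rw [integral_const_mul, hi.integral_fun_mul_eq_mul_integral
      (((hV _ hx1).mul (hV _ hy1)).mono h₁ le_rfl).aestronglyMeasurable
      (((hW _ hx2).mul (hW _ hy2)).mono h₂ le_rfl).aestronglyMeasurable,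
      hVo _ hx1 _ hy1, hWo _ hx2 _ hy2]
    by_cases hxy : x = y
    · subst hxy; simp
    · rw [if_neg hxy]
      by_cases h5 : x.1 = y.1
      · rw [if_neg fun h6 ↦ hxy (Prod.ext h5 h6)]; simp
      · rw [if_neg h5]; simp
  rw [Finset.sum_congr rfl key, Finset.sum_ite_eq, if_pos hx]

/-! ### Centered counts in cells -/

/-- The centered number of points in a cell, complemented by the constant `1`. -/
noncomputable def centeredCount (ν : Measure Strip) (m : ℕ) (s : Set Strip) :
    Option (ℤ × ℤ) → ℝ
  | none => 1
  | some i => pointCount s (cellSet m i) - ν.real (cellSet m i)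

/-- The second moments of the variables in `centeredCount`. -/
noncomputable def centeredVar (ν : Measure Strip) (m : ℕ) : Option (ℤ × ℤ) → ℝ
  | none => 1
  | some i => ν.real (cellSet m i)

lemma measure_cellSet_ne_top (ν : Measure Strip) [IsLocallyFiniteMeasure ν] {m : ℕ} {i : ℤ × ℤ}
    (hi : i ∈ cellBox m) : ν (cellSet m i) ≠ ∞ :=
  ((measure_mono (cellSet_subset_stripBox hi)).trans_lt (measure_stripBox_ne_top ν m).lt_top).ne

lemma IsPoissonProcess.processSigmaAlgebra_le {Ω E : Type*} [MeasurableSpace Ω] {μ : Measure Ω}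
    [TopologicalSpace E] [MeasurableSpace E]
    {P : Ω → Set E} {ν : Measure E}
    (hP : IsPoissonProcess P ν μ) : processSigmaAlgebra P ≤ ‹MeasurableSpace Ω› :=
  iSup_le fun A ↦ (hP.measurable_count A.1 A.2).comap_le

section Centered

variable {Ω : Type*} [MeasurableSpace Ω] {μ : Measure Ω} [IsProbabilityMeasure μ]
  {P P' : Ω → Set Strip} {ν ν' : Measure Strip} [IsLocallyFiniteMeasure ν]
  [IsLocallyFiniteMeasure ν']

lemma measurable_processSigmaAlgebra_centeredCount {Ω : Type*} (P : Ω → Set Strip)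
    (ν : Measure Strip) (m : ℕ) (o : Option (ℤ × ℤ)) :
    Measurable[processSigmaAlgebra P] fun ω ↦ centeredCount ν m (P ω) o := by
  cases o with
  | none => exact measurable_const
  | some i =>
    exact (measurable_processSigmaAlgebra_pointCount P (measurableSet_cellSet m i)).sub_const _

lemma IsPoissonProcess.memLp_centeredCount (hP : IsPoissonProcess P ν μ) {m : ℕ}
    {o : Option (ℤ × ℤ)} (ho : o ∈ Finset.insertNone (cellBox m)) :
    MemLp (fun ω ↦ centeredCount ν m (P ω) o) 2 μ := by
  cases o with
  | none => exact memLp_const 1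
  | some i =>
    have hi : i ∈ cellBox m := by simpa using ho
    exact (hP.memLp_pointCount (measurableSet_cellSet m i) (measure_cellSet_ne_top ν hi)).sub
      (memLp_const _)

lemma IsPoissonProcess.integral_centeredCount_some (hP : IsPoissonProcess P ν μ) {m : ℕ}
    {i : ℤ × ℤ} (hi : i ∈ cellBox m) :
    ∫ ω, centeredCount ν m (P ω) (some i) ∂μ = 0 := by
  have h1 := measurableSet_cellSet m i
  have h2 := measure_cellSet_ne_top ν hi
  simp only [centeredCount]
  rw [integral_sub ((hP.memLp_pointCount h1 h2).integrable (by norm_num)) (integrable_const _),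
    hP.integral_pointCount h1 h2]
  simp

/-- With the constant `1` placed at `none`, the centered counts form an orthogonal system. A single
bilinear formula then covers the linear parts, where one index is `none`, together with the
genuinely bilinear part. -/
lemma IsPoissonProcess.integral_centeredCount_mul (hP : IsPoissonProcess P ν μ) {m : ℕ}
    {o o' : Option (ℤ × ℤ)} (ho : o ∈ Finset.insertNone (cellBox m))
    (ho' : o' ∈ Finset.insertNone (cellBox m)) :
    ∫ ω, centeredCount ν m (P ω) o * centeredCount ν m (P ω) o' ∂μ =
      if o = o' then centeredVar ν m o else 0 := by
  cases o with
  | none =>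
    cases o' with
    | none => simp [centeredCount, centeredVar]
    | some i =>
      have hi : i ∈ cellBox m := by simpa using ho'
      simpa [centeredCount] using hP.integral_centeredCount_some hi
  | some i =>
    have hi : i ∈ cellBox m := by simpa using ho
    have h1 := measurableSet_cellSet m i
    have h2 := measure_cellSet_ne_top ν hi
    cases o' with
    | none => simpa [centeredCount] using hP.integral_centeredCount_some hi
    | some j =>
      have hj : j ∈ cellBox m := by simpa using ho'
      by_cases hij : i = j
      · subst hij
        have hL := hP.memLp_pointCount h1 h2
        rw [if_pos rfl]
        simp only [centeredCount, centeredVar]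
        have h3 : ∀ ω, (pointCount (P ω) (cellSet m i) - ν.real (cellSet m i)) *
            (pointCount (P ω) (cellSet m i) - ν.real (cellSet m i)) =
            pointCount (P ω) (cellSet m i) ^ 2 -
              (2 * ν.real (cellSet m i) * pointCount (P ω) (cellSet m i) -
                ν.real (cellSet m i) ^ 2) := fun ω ↦ by ring
        simp_rw [h3]
        have hint := hL.integrable (by norm_num : (1 : ℝ≥0∞) ≤ 2)
        have hint' : Integrable (fun ω ↦ 2 * ν.real (cellSet m i) *
            pointCount (P ω) (cellSet m i) - ν.real (cellSet m i) ^ 2) μ :=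
          (hint.const_mul _).sub (integrable_const _)
        rw [integral_sub hL.integrable_sq hint',
          integral_sub (hint.const_mul _) (integrable_const _), integral_const_mul,
          hP.integral_pointCount h1 h2, hP.integral_pointCount_sq h1 h2]
        simp
        ring
      · have hi' : IndepFun (fun ω ↦ centeredCount ν m (P ω) (some i))
            (fun ω ↦ centeredCount ν m (P ω) (some j)) μ :=
          ((hP.iIndepFun_pointCount (measurableSet_cellSet m)
            (pairwise_disjoint_cellSet m)).indepFun hij).comp
            (φ := fun x ↦ x - ν.real (cellSet m i)) (ψ := fun x ↦ x - ν.real (cellSet m j))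
            (by fun_prop) (by fun_prop)
        rw [hi'.integral_fun_mul_eq_mul_integral (hP.memLp_centeredCount ho).1
          (hP.memLp_centeredCount ho').1, hP.integral_centeredCount_some hi]
        simp [hij]

/-- Second moment of a bilinear form in the centered counts of two independent processes. -/
lemma integral_sq_centeredCount_sum (hP : IsPoissonProcess P ν μ) (hP' : IsPoissonProcess P' ν' μ)
    (hind : Indep (processSigmaAlgebra P) (processSigmaAlgebra P') μ) (m : ℕ)
    (c : Option (ℤ × ℤ) × Option (ℤ × ℤ) → ℝ) :
    MemLp (fun ω ↦ ∑ x ∈ Finset.insertNone (cellBox m) ×ˢ Finset.insertNone (cellBox m),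
      c x * (centeredCount ν m (P ω) x.1 * centeredCount ν' m (P' ω) x.2)) 2 μ ∧
    ∫ ω, (∑ x ∈ Finset.insertNone (cellBox m) ×ˢ Finset.insertNone (cellBox m),
      c x * (centeredCount ν m (P ω) x.1 * centeredCount ν' m (P' ω) x.2)) ^ 2 ∂μ =
      ∑ x ∈ Finset.insertNone (cellBox m) ×ˢ Finset.insertNone (cellBox m),
        c x ^ 2 * (centeredVar ν m x.1 * centeredVar ν' m x.2) :=
  integral_sq_bilinear_sum hP.processSigmaAlgebra_le hP'.processSigmaAlgebra_le hind
    (V := fun o ω ↦ centeredCount ν m (P ω) o) (W := fun o ω ↦ centeredCount ν' m (P' ω) o)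
    (v := centeredVar ν m) (w := centeredVar ν' m) c
    (fun o _ ↦ measurable_processSigmaAlgebra_centeredCount P ν m o)
    (fun o _ ↦ measurable_processSigmaAlgebra_centeredCount P' ν' m o)
    (fun _ ho ↦ hP.memLp_centeredCount ho) (fun _ ho ↦ hP'.memLp_centeredCount ho)
    (fun _ ho _ ho' ↦ hP.integral_centeredCount_mul ho ho')
    (fun _ ho _ ho' ↦ hP'.integral_centeredCount_mul ho ho')

end Centered

/-! ### Pairs in products of cells -/

/-- The number of pairs of points in `innerSet m G`, as a sum over pairs of cells. -/
noncomputable def cellSum (m : ℕ) (G : Set (Strip × Strip)) (s s' : Set Strip) : ℝ :=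
  ∑ ij ∈ innerPairs m G, pointCount s (cellSet m ij.1) * pointCount s' (cellSet m ij.2)

open Classical in
/-- The measure of the section of `innerSet m G` at a point of the cell `i`. -/
noncomputable def fstWeight (ν' : Measure Strip) (m : ℕ) (G : Set (Strip × Strip))
    (i : ℤ × ℤ) : ℝ :=
  ∑ j ∈ cellBox m, if (i, j) ∈ innerPairs m G then ν'.real (cellSet m j) else 0

open Classical in
/-- The measure of the section of `innerSet m G` at a second coordinate in the cell `j`. -/
noncomputable def sndWeight (ν : Measure Strip) (m : ℕ) (G : Set (Strip × Strip))
    (j : ℤ × ℤ) : ℝ :=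
  ∑ i ∈ cellBox m, if (i, j) ∈ innerPairs m G then ν.real (cellSet m i) else 0

/-- The centered sum of the weights `fstWeight` over the points of `s`. -/
noncomputable def linearPart (ν ν' : Measure Strip) (m : ℕ) (G : Set (Strip × Strip))
    (s : Set Strip) : ℝ :=
  ∑ i ∈ cellBox m, fstWeight ν' m G i * (pointCount s (cellSet m i) - ν.real (cellSet m i))

open Classical in
lemma sum_innerPairs {M : Type*} [AddCommMonoid M] (m : ℕ) (G : Set (Strip × Strip))
    (f : ℤ × ℤ → ℤ × ℤ → M) :
    ∑ ij ∈ innerPairs m G, f ij.1 ij.2 = ∑ i ∈ cellBox m, ∑ j ∈ cellBox m,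
      if (i, j) ∈ innerPairs m G then f i j else 0 := by
  rw [← Finset.sum_product' _ _ fun i j ↦ if (i, j) ∈ innerPairs m G then f i j else 0,
    ← Finset.sum_filter]
  refine Finset.sum_congr (Finset.ext fun ij ↦ ?_) fun _ _ ↦ rfl
  simp only [Finset.mem_filter, Finset.mem_product, Prod.mk.eta, iff_and_self]
  exact fun h ↦ (mem_innerPairs.1 h).1

lemma fstWeight_nonneg (ν' : Measure Strip) (m : ℕ) (G : Set (Strip × Strip)) (i : ℤ × ℤ) :
    0 ≤ fstWeight ν' m G i :=
  Finset.sum_nonneg fun j _ ↦ by split_ifs <;> positivity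

lemma sndWeight_nonneg (ν : Measure Strip) (m : ℕ) (G : Set (Strip × Strip)) (j : ℤ × ℤ) :
    0 ≤ sndWeight ν m G j :=
  Finset.sum_nonneg fun j _ ↦ by split_ifs <;> positivity

lemma fstWeight_eq_zero (ν' : Measure Strip) {m : ℕ} (G : Set (Strip × Strip)) {i : ℤ × ℤ}
    (hi : i ∉ cellBox m) : fstWeight ν' m G i = 0 :=
  Finset.sum_eq_zero fun _ _ ↦ if_neg fun h ↦ hi (mem_innerPairs.1 h).1.1

lemma sndWeight_eq_zero (ν : Measure Strip) {m : ℕ} (G : Set (Strip × Strip)) {j : ℤ × ℤ}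
    (hj : j ∉ cellBox m) : sndWeight ν m G j = 0 :=
  Finset.sum_eq_zero fun _ _ ↦ if_neg fun h ↦ hj (mem_innerPairs.1 h).1.2

lemma ofReal_fstWeight (ν' : Measure Strip) [IsLocallyFiniteMeasure ν'] (m : ℕ)
    (G : Set (Strip × Strip)) (p : Strip) :
    ENNReal.ofReal (fstWeight ν' m G (stripCell m p)) = ν' (Prod.mk p ⁻¹' innerSet m G) := by
  rw [measure_section_innerSet, fstWeight, ENNReal.ofReal_sum_of_nonneg]
  · refine Finset.sum_congr rfl fun j hj ↦ ?_
    split_ifs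
    · exact ofReal_measureReal (measure_cellSet_ne_top ν' hj)
    · simp
  · intro j _
    split_ifs <;> positivity

lemma ofReal_sndWeight (ν : Measure Strip) [IsLocallyFiniteMeasure ν] (m : ℕ)
    (G : Set (Strip × Strip)) (p' : Strip) :
    ENNReal.ofReal (sndWeight ν m G (stripCell m p')) =
      ν ((fun p ↦ (p, p')) ⁻¹' innerSet m G) := by
  rw [measure_section_innerSet', sndWeight, ENNReal.ofReal_sum_of_nonneg]
  · refine Finset.sum_congr rfl fun j hj ↦ ?_
    split_ifs
    · exact ofReal_measureReal (measure_cellSet_ne_top ν hj)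
    · simp
  · intro j _
    split_ifs <;> positivity

/-- The section measure of `innerSet m G` is constant on cells, so the variance of `linearPart` is
an integral of a step function. -/
lemma ofReal_sum_fstWeight_sq (ν ν' : Measure Strip) [IsLocallyFiniteMeasure ν]
    [IsLocallyFiniteMeasure ν'] (m : ℕ) (G : Set (Strip × Strip)) :
    ENNReal.ofReal (∑ i ∈ cellBox m, fstWeight ν' m G i ^ 2 * ν.real (cellSet m i)) =
      ∫⁻ p, ν' (Prod.mk p ⁻¹' innerSet m G) ^ 2 ∂ν := by
  simp_rw [← ofReal_fstWeight]
  rw [lintegral_comp_stripCell ν m (g := fun i ↦ ENNReal.ofReal (fstWeight ν' m G i) ^ 2)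
    fun i hi ↦ by simp [fstWeight_eq_zero ν' G hi], ENNReal.ofReal_sum_of_nonneg]
  · refine Finset.sum_congr rfl fun i hi ↦ ?_
    rw [ENNReal.ofReal_mul (by positivity), ofReal_measureReal (measure_cellSet_ne_top ν hi),
      ENNReal.ofReal_pow (fstWeight_nonneg ν' m G i), mul_comm]
  · intro j _
    positivity

lemma ofReal_sum_sndWeight_sq (ν ν' : Measure Strip) [IsLocallyFiniteMeasure ν]
    [IsLocallyFiniteMeasure ν'] (m : ℕ) (G : Set (Strip × Strip)) :
    ENNReal.ofReal (∑ j ∈ cellBox m, sndWeight ν m G j ^ 2 * ν'.real (cellSet m j)) =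
      ∫⁻ p', ν ((fun p ↦ (p, p')) ⁻¹' innerSet m G) ^ 2 ∂ν' := by
  simp_rw [← ofReal_sndWeight]
  rw [lintegral_comp_stripCell ν' m (g := fun i ↦ ENNReal.ofReal (sndWeight ν m G i) ^ 2)
    fun i hi ↦ by simp [sndWeight_eq_zero ν G hi], ENNReal.ofReal_sum_of_nonneg]
  · refine Finset.sum_congr rfl fun i hi ↦ ?_
    rw [ENNReal.ofReal_mul (by positivity), ofReal_measureReal (measure_cellSet_ne_top ν' hi),
      ENNReal.ofReal_pow (sndWeight_nonneg ν m G i), mul_comm]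
  · intro j _
    positivity

lemma prod_innerSet_eq_ofReal (ν ν' : Measure Strip) [IsLocallyFiniteMeasure ν]
    [IsLocallyFiniteMeasure ν'] (m : ℕ) (G : Set (Strip × Strip)) :
    (ν.prod ν') (innerSet m G) = ENNReal.ofReal
      (∑ ij ∈ innerPairs m G, ν.real (cellSet m ij.1) * ν'.real (cellSet m ij.2)) := by
  rw [prod_innerSet, ENNReal.ofReal_sum_of_nonneg fun _ _ ↦ by positivity]
  refine Finset.sum_congr rfl fun ij hij ↦ ?_
  obtain ⟨h1, h2⟩ := (mem_innerPairs.1 hij).1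
  rw [ENNReal.ofReal_mul (by positivity), ofReal_measureReal (measure_cellSet_ne_top ν h1),
    ofReal_measureReal (measure_cellSet_ne_top ν' h2)]

lemma real_prod_innerSet (ν ν' : Measure Strip) [IsLocallyFiniteMeasure ν]
    [IsLocallyFiniteMeasure ν'] (m : ℕ) (G : Set (Strip × Strip)) :
    (ν.prod ν').real (innerSet m G) =
      ∑ ij ∈ innerPairs m G, ν.real (cellSet m ij.1) * ν'.real (cellSet m ij.2) := by
  rw [measureReal_def, prod_innerSet_eq_ofReal, ENNReal.toReal_ofReal]
  exact Finset.sum_nonneg fun _ _ ↦ by positivity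

open Classical in
/-- The coefficients of the expansion of `cellSum` in the centered counts, with the linear part
in the first process multiplied by `θ`. -/
noncomputable def chaosCoeff (ν ν' : Measure Strip) (m : ℕ) (G : Set (Strip × Strip)) (θ : ℝ) :
    Option (ℤ × ℤ) × Option (ℤ × ℤ) → ℝ
  | (none, none) => 0
  | (some i, none) => θ * fstWeight ν' m G i
  | (none, some j) => sndWeight ν m G j
  | (some i, some j) => if (i, j) ∈ innerPairs m G then 1 else 0

/-- For each pair of cells, `XY = ab + b(X - a) + a(Y - b) + (X - a)(Y - b)`, where `a` and `b` are
the means. The part linear in `X` is kept with factor `θ`: `θ = 1` gives the centered sum, `θ = 0`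
removes that part. -/
lemma sum_chaosCoeff (ν ν' : Measure Strip) (m : ℕ) (G : Set (Strip × Strip)) (θ : ℝ)
    (s s' : Set Strip) :
    ∑ x ∈ Finset.insertNone (cellBox m) ×ˢ Finset.insertNone (cellBox m),
      chaosCoeff ν ν' m G θ x * (centeredCount ν m s x.1 * centeredCount ν' m s' x.2) =
    cellSum m G s s' -
      ∑ ij ∈ innerPairs m G, ν.real (cellSet m ij.1) * ν'.real (cellSet m ij.2) -
      (1 - θ) * linearPart ν ν' m G s := by
  classical
  have h1 : ∑ j ∈ cellBox m, sndWeight ν m G j *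
      (pointCount s' (cellSet m j) - ν'.real (cellSet m j)) =
      ∑ i ∈ cellBox m, ∑ j ∈ cellBox m, if (i, j) ∈ innerPairs m G then
        ν.real (cellSet m i) * (pointCount s' (cellSet m j) - ν'.real (cellSet m j)) else 0 := by
    rw [Finset.sum_comm]
    refine Finset.sum_congr rfl fun j _ ↦ ?_
    rw [sndWeight, Finset.sum_mul]
    exact Finset.sum_congr rfl fun i _ ↦ by split_ifs <;> simp
  have h2 : linearPart ν ν' m G s =
      ∑ i ∈ cellBox m, ∑ j ∈ cellBox m, if (i, j) ∈ innerPairs m G then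
        ν'.real (cellSet m j) * (pointCount s (cellSet m i) - ν.real (cellSet m i)) else 0 := by
    refine Finset.sum_congr rfl fun j _ ↦ ?_
    rw [fstWeight, Finset.sum_mul]
    exact Finset.sum_congr rfl fun i _ ↦ by split_ifs <;> simp
  have h3 : ∑ i ∈ cellBox m, θ * fstWeight ν' m G i *
      (pointCount s (cellSet m i) - ν.real (cellSet m i)) = θ * linearPart ν ν' m G s := by
    rw [linearPart, Finset.mul_sum]
    exact Finset.sum_congr rfl fun i _ ↦ by ring
  have h4 := sum_innerPairs m G fun i j ↦ pointCount s (cellSet m i) * pointCount s' (cellSet m j)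
  have h5 := sum_innerPairs m G fun i j ↦ ν.real (cellSet m i) * ν'.real (cellSet m j)
  rw [Finset.sum_product]
  simp only [Finset.sum_insertNone, chaosCoeff, centeredCount, mul_one, one_mul,
    zero_add, Finset.sum_add_distrib]
  rw [h1, h3, cellSum, h4, h5]
  have h6 : ∑ i ∈ cellBox m, ∑ j ∈ cellBox m, (if (i, j) ∈ innerPairs m G then (1 : ℝ) else 0) *
      ((pointCount s (cellSet m i) - ν.real (cellSet m i)) *
        (pointCount s' (cellSet m j) - ν'.real (cellSet m j))) =
      (∑ i ∈ cellBox m, ∑ j ∈ cellBox m, if (i, j) ∈ innerPairs m G then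
        pointCount s (cellSet m i) * pointCount s' (cellSet m j) else 0) -
      (∑ i ∈ cellBox m, ∑ j ∈ cellBox m, if (i, j) ∈ innerPairs m G then
        ν.real (cellSet m i) * ν'.real (cellSet m j) else 0) - linearPart ν ν' m G s -
      ∑ i ∈ cellBox m, ∑ j ∈ cellBox m, if (i, j) ∈ innerPairs m G then
        ν.real (cellSet m i) * (pointCount s' (cellSet m j) - ν'.real (cellSet m j)) else 0 := by
    rw [h2]
    simp only [← Finset.sum_sub_distrib]
    refine Finset.sum_congr rfl fun i _ ↦ Finset.sum_congr rfl fun j _ ↦ ?_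
    split_ifs
    · ring
    · simp
  rw [h6]
  ring

lemma sum_chaosCoeff_sq (ν ν' : Measure Strip) (m : ℕ) (G : Set (Strip × Strip)) (θ : ℝ) :
    ∑ x ∈ Finset.insertNone (cellBox m) ×ˢ Finset.insertNone (cellBox m),
      chaosCoeff ν ν' m G θ x ^ 2 * (centeredVar ν m x.1 * centeredVar ν' m x.2) =
    θ ^ 2 * ∑ i ∈ cellBox m, fstWeight ν' m G i ^ 2 * ν.real (cellSet m i) +
      ∑ j ∈ cellBox m, sndWeight ν m G j ^ 2 * ν'.real (cellSet m j) +
      ∑ ij ∈ innerPairs m G, ν.real (cellSet m ij.1) * ν'.real (cellSet m ij.2) := by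
  classical
  have h5 := sum_innerPairs m G fun i j ↦ ν.real (cellSet m i) * ν'.real (cellSet m j)
  rw [Finset.sum_product, h5, Finset.mul_sum]
  simp only [Finset.sum_insertNone, chaosCoeff, centeredVar, mul_one, one_mul, ne_eq,
    OfNat.ofNat_ne_zero, not_false_eq_true, zero_pow, zero_mul, zero_add, Finset.sum_add_distrib,
    ite_pow, one_pow, ite_mul, mul_pow, mul_assoc]
  ring

section Moments

variable {Ω : Type*} [MeasurableSpace Ω] {μ : Measure Ω} [IsProbabilityMeasure μ]
  {P P' : Ω → Set Strip} {ν ν' : Measure Strip} [IsLocallyFiniteMeasure ν]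
  [IsLocallyFiniteMeasure ν']

/-- The variance functional: a bound for the variance of the number of pairs in `G`, with the
contribution of the linear part in the first process multiplied by `θ²`. -/
noncomputable def varBound (ν ν' : Measure Strip) (θ : ℝ) (G : Set (Strip × Strip)) : ℝ≥0∞ :=
  ENNReal.ofReal (θ ^ 2) * ∫⁻ p, ν' (Prod.mk p ⁻¹' G) ^ 2 ∂ν +
    ∫⁻ p', ν ((fun p ↦ (p, p')) ⁻¹' G) ^ 2 ∂ν' + (ν.prod ν') G

/-- By orthogonality the second moment equals the variance functional of `innerSet m G`. Enlarging
this set to `G` gives a bound that is uniform in the level `m`. -/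
lemma lintegral_sq_cellSum_le (hP : IsPoissonProcess P ν μ) (hP' : IsPoissonProcess P' ν' μ)
    (hind : Indep (processSigmaAlgebra P) (processSigmaAlgebra P') μ) (m : ℕ)
    (G : Set (Strip × Strip)) (θ : ℝ) :
    ∫⁻ ω, ENNReal.ofReal ((cellSum m G (P ω) (P' ω) - (ν.prod ν').real (innerSet m G) -
      (1 - θ) * linearPart ν ν' m G (P ω)) ^ 2) ∂μ ≤ varBound ν ν' θ G := by
  obtain ⟨h1, h2⟩ := integral_sq_centeredCount_sum hP hP' hind m (chaosCoeff ν ν' m G θ)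
  simp_rw [sum_chaosCoeff, ← real_prod_innerSet] at h1 h2
  rw [← ofReal_integral_eq_lintegral_ofReal h1.integrable_sq (ae_of_all _ fun ω ↦ sq_nonneg _),
    h2, sum_chaosCoeff_sq, ENNReal.ofReal_add, ENNReal.ofReal_add, ENNReal.ofReal_mul,
    ofReal_sum_fstWeight_sq, ofReal_sum_sndWeight_sq, ← prod_innerSet_eq_ofReal, varBound]
  · gcongr <;> exact innerSet_subset m G
  all_goals
    first
    | exact sq_nonneg _
    | exact Finset.sum_nonneg fun _ _ ↦ by positivity
    | exact mul_nonneg (sq_nonneg _) (Finset.sum_nonneg fun _ _ ↦ by positivity)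
    | exact add_nonneg (mul_nonneg (sq_nonneg _) (Finset.sum_nonneg fun _ _ ↦ by positivity))
        (Finset.sum_nonneg fun _ _ ↦ by positivity)

end Moments

lemma pairCount_innerSet {Ω : Type*} [MeasurableSpace Ω] {μ : Measure Ω} {P P' : Ω → Set Strip}
    {ν ν' : Measure Strip} (hP : IsPoissonProcess P ν μ)
    (hP' : IsPoissonProcess P' ν' μ) (ω : Ω) (m : ℕ) (G : Set (Strip × Strip)) :
    pairCount (P ω) (P' ω) (innerSet m G) = ENNReal.ofReal (cellSum m G (P ω) (P' ω)) := by
  have := hP.countable ω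
  have := hP'.countable ω
  have h0 : ∀ s A : Set Strip, 0 ≤ pointCount s A := fun s A ↦ Nat.cast_nonneg _
  rw [pairCount, prod_innerSet, cellSum,
    ENNReal.ofReal_sum_of_nonneg fun _ _ ↦ mul_nonneg (h0 _ _) (h0 _ _)]
  refine Finset.sum_congr rfl fun ij hij ↦ ?_
  obtain ⟨h1, h2⟩ := (mem_innerPairs.1 hij).1
  rw [ENNReal.ofReal_mul (h0 _ _), hP.pointMeasure_eq_pointCount ω (measurableSet_cellSet m _)
    (cellSet_subset_stripBox h1), hP'.pointMeasure_eq_pointCount ω (measurableSet_cellSet m _)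
    (cellSet_subset_stripBox h2)]

/-! ### Comparison of characteristic functions -/

lemma norm_cexp_sub_cexp_le (t x y : ℝ) :
    ‖Complex.exp (t * x * Complex.I) - Complex.exp (t * y * Complex.I)‖ ≤ |t| * |x - y| := by
  have h : Complex.exp (t * x * Complex.I) - Complex.exp (t * y * Complex.I) =
      Complex.exp ((t * y : ℝ) * Complex.I) *
        (Complex.exp (Complex.I * (t * (x - y) : ℝ)) - 1) := by
    rw [mul_sub, mul_one, ← Complex.exp_add]
    push_cast
    ring_nf
  rw [h, norm_mul, Complex.norm_exp_ofReal_mul_I, one_mul, ← abs_mul, ← Real.norm_eq_abs]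
  exact Real.norm_exp_I_mul_ofReal_sub_one_le

lemma norm_cexp_mul_I (t x : ℝ) : ‖Complex.exp (t * x * Complex.I)‖ = 1 := by
  rw [← Complex.ofReal_mul, Complex.norm_exp_ofReal_mul_I]

lemma integrable_cexp_mul_I {Ω : Type*} [MeasurableSpace Ω] {μ : Measure Ω}
    [IsProbabilityMeasure μ] {X : Ω → ℝ} (hX : AEMeasurable X μ) (t : ℝ) :
    Integrable (fun ω ↦ Complex.exp (t * X ω * Complex.I)) μ := by
  refine Integrable.of_bound (C := 1) ?_ (ae_of_all _ fun ω ↦ (norm_cexp_mul_I t _).le)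
  exact (AEMeasurable.cexp (by fun_prop)).aestronglyMeasurable

/-- Characteristic functions of variables that are close in `L²` are close. -/
lemma norm_integral_cexp_sub_le {Ω : Type*} [MeasurableSpace Ω] {μ : Measure Ω}
    [IsProbabilityMeasure μ] {X Y : Ω → ℝ} (hX : AEMeasurable X μ) (hY : AEMeasurable Y μ) (t : ℝ)
    {B : ℝ≥0∞} (hB : B ≠ ∞) (h : ∫⁻ ω, ENNReal.ofReal ((X ω - Y ω) ^ 2) ∂μ ≤ B) :
    ‖∫ ω, Complex.exp (t * X ω * Complex.I) ∂μ - ∫ ω, Complex.exp (t * Y ω * Complex.I) ∂μ‖ ≤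
      |t| * √B.toReal := by
  have hD : AEMeasurable (fun ω ↦ |X ω - Y ω|) μ := (hX.sub hY).norm
  have hsq : Integrable (fun ω ↦ |X ω - Y ω| ^ 2) μ := by
    simp_rw [sq_abs]
    refine ⟨((hX.sub hY).pow_const 2).aestronglyMeasurable, ?_⟩
    rw [hasFiniteIntegral_iff_ofReal (ae_of_all _ fun ω ↦ sq_nonneg _)]
    exact h.trans_lt hB.lt_top
  have hL : MemLp (fun ω ↦ |X ω - Y ω|) 2 μ :=
    (memLp_two_iff_integrable_sq hD.aestronglyMeasurable).2 hsq
  -- Cauchy–Schwarz, in the form that the variance of the absolute difference is nonnegative.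
  have h1 : (∫ ω, |X ω - Y ω| ∂μ) ^ 2 ≤ B.toReal := by
    have h2 := variance_nonneg (fun ω ↦ |X ω - Y ω|) μ
    rw [variance_eq_sub hL] at h2
    have h3 : ∫ ω, |X ω - Y ω| ^ 2 ∂μ ≤ B.toReal := by
      rw [integral_eq_lintegral_of_nonneg_ae (ae_of_all _ fun ω ↦ sq_nonneg _)
        hsq.aestronglyMeasurable]
      simp_rw [sq_abs]
      exact ENNReal.toReal_mono hB h
    simp only [Pi.pow_apply] at h2
    linarith
  rw [← integral_sub (integrable_cexp_mul_I hX t) (integrable_cexp_mul_I hY t)]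
  calc _ ≤ ∫ ω, |t| * |X ω - Y ω| ∂μ :=
        norm_integral_le_of_norm_le ((hL.integrable (by norm_num)).const_mul _)
          (ae_of_all _ fun ω ↦ norm_cexp_sub_cexp_le t _ _)
    _ = |t| * ∫ ω, |X ω - Y ω| ∂μ := integral_const_mul _ _
    _ ≤ |t| * √B.toReal := by
        gcongr
        exact Real.le_sqrt_of_sq_le h1

/-! ### The compensated exponential -/

/-- `exp (i x) - 1 - i x`. -/
noncomputable def compExp (x : ℝ) : ℂ := Complex.exp (x * Complex.I) - 1 - x * Complex.I

lemma continuous_compExp : Continuous compExp := by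
  unfold compExp
  fun_prop

@[simp] lemma compExp_zero : compExp 0 = 0 := by simp [compExp]

lemma norm_compExp_le (x : ℝ) : ‖compExp x‖ ≤ 2 * |x| := by
  have h1 : ‖Complex.exp (x * Complex.I) - 1‖ ≤ |x| := by
    have := Real.norm_exp_I_mul_ofReal_sub_one_le (x := x)
    rwa [mul_comm, Real.norm_eq_abs] at this
  have h2 : ‖(x : ℂ) * Complex.I‖ = |x| := by simp
  calc ‖compExp x‖ ≤ ‖Complex.exp (x * Complex.I) - 1‖ + ‖(x : ℂ) * Complex.I‖ := norm_sub_le _ _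
    _ ≤ 2 * |x| := by rw [h2]; linarith

/-! ### Passage from dyadic inner approximations to sets with null boundary. -/

lemma ae_section_null {ν ν' : Measure Strip} [SFinite ν'] {H : Set (Strip × Strip)}
    (hH : (ν.prod ν') H = 0) : ∀ᵐ p ∂ν, ν' (Prod.mk p ⁻¹' H) = 0 :=
  (Measure.ae_ae_of_ae_prod (measure_eq_zero_iff_ae_notMem.1 hH)).mono
    fun _ hp ↦ measure_eq_zero_iff_ae_notMem.2 hp

/-- A measurable set with null boundary is up to a null set the increasing union of its dyadic
inner approximations. -/
lemma tendsto_measure_innerSet {m₀ : Measure (Strip × Strip)} {G : Set (Strip × Strip)}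
    (h : m₀ (G \ ⋃ m, innerSet m G) = 0) :
    Tendsto (fun m ↦ m₀ (innerSet m G)) atTop (𝓝 (m₀ G)) := by
  have h1 : m₀ G = m₀ (⋃ m, innerSet m G) := by
    refine le_antisymm ?_ (measure_mono (Set.iUnion_subset fun m ↦ innerSet_subset m G))
    calc m₀ G ≤ m₀ ((G \ ⋃ m, innerSet m G) ∪ ⋃ m, innerSet m G) :=
          measure_mono fun q hq ↦ by
            by_cases hq' : q ∈ ⋃ m, innerSet m G
            · exact Or.inr hq'
            · exact Or.inl ⟨hq, hq'⟩
      _ ≤ _ := (measure_union_le _ _).trans (by rw [h, zero_add])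
  rw [h1]
  exact tendsto_measure_iUnion_atTop (monotone_innerSet G)

lemma prod_diff_iUnion_innerSet {ν ν' : Measure Strip} {G : Set (Strip × Strip)}
    (hGi : (ν.prod ν') (G \ interior G) = 0) : (ν.prod ν') (G \ ⋃ m, innerSet m G) = 0 :=
  measure_mono_null (Set.sdiff_subset_sdiff_right (interior_subset_iUnion_innerSet G)) hGi

lemma cellSum_nonneg (m : ℕ) (G : Set (Strip × Strip)) (s s' : Set Strip) :
    0 ≤ cellSum m G s s' :=
  Finset.sum_nonneg fun _ _ ↦ mul_nonneg (Nat.cast_nonneg _) (Nat.cast_nonneg _)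

lemma measurable_cellSum {Ω : Type*} [MeasurableSpace Ω] {μ : Measure Ω}
    {P P' : Ω → Set Strip} {ν ν' : Measure Strip} (hP : IsPoissonProcess P ν μ)
    (hP' : IsPoissonProcess P' ν' μ) (m : ℕ) (G : Set (Strip × Strip)) :
    Measurable fun ω ↦ cellSum m G (P ω) (P' ω) :=
  Finset.measurable_fun_sum _ fun _ _ ↦
    (hP.measurable_pointCount (measurableSet_cellSet m _)).mul
      (hP'.measurable_pointCount (measurableSet_cellSet m _))

lemma measurable_linearPart {Ω : Type*} [MeasurableSpace Ω] {μ : Measure Ω}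
    {P : Ω → Set Strip} {ν ν' : Measure Strip} (hP : IsPoissonProcess P ν μ)
    (m : ℕ) (G : Set (Strip × Strip)) :
    Measurable fun ω ↦ linearPart ν ν' m G (P ω) :=
  Finset.measurable_fun_sum _ fun _ _ ↦
    ((hP.measurable_pointCount (measurableSet_cellSet m _)).sub_const _).const_mul _

/-- The cells are independent, and a centered Poisson variable of mean `a` with weight `f` has
characteristic function `exp (a * compExp (t * f))`. The product over the cells is the exponential
of the integral of a step function. -/
lemma IsPoissonProcess.integral_cexp_linearPart {Ω : Type*} [MeasurableSpace Ω] {μ : Measure Ω}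
    {P : Ω → Set Strip} {ν ν' : Measure Strip} [IsLocallyFiniteMeasure ν]
    [IsLocallyFiniteMeasure ν'] (hP : IsPoissonProcess P ν μ) (m : ℕ)
    (G : Set (Strip × Strip)) (t : ℝ) :
    ∫ ω, Complex.exp (t * linearPart ν ν' m G (P ω) * Complex.I) ∂μ =
      Complex.exp (∫ p, compExp (t * ν'.real (Prod.mk p ⁻¹' innerSet m G)) ∂ν) := by
  have h1 : ∀ p, ν'.real (Prod.mk p ⁻¹' innerSet m G) = fstWeight ν' m G (stripCell m p) :=
    fun p ↦ by
      rw [measureReal_def, ← ofReal_fstWeight, ENNReal.toReal_ofReal (fstWeight_nonneg _ _ _ _)]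
  simp_rw [h1]
  rw [integral_comp_stripCell ν m (g := fun i ↦ compExp (t * fstWeight ν' m G i))
    fun i hi ↦ by simp [fstWeight_eq_zero ν' G hi], Complex.exp_sum]
  set Z : ℤ × ℤ → Ω → ℝ := fun i ω ↦ fstWeight ν' m G i *
    (pointCount (P ω) (cellSet m i) - ν.real (cellSet m i)) with hZ
  have hZm : ∀ i, Measurable (Z i) := fun i ↦
    ((hP.measurable_pointCount (measurableSet_cellSet m i)).sub_const _).const_mul _
  have hZi : iIndepFun Z μ :=
    (hP.iIndepFun_pointCount (measurableSet_cellSet m) (pairwise_disjoint_cellSet m)).comp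
      (fun i x ↦ fstWeight ν' m G i * (x - ν.real (cellSet m i))) (by fun_prop)
  have h2 := congrFun ((hZi.restrict (cellBox m)).charFun_map_fun_finsetSum_eq_prod
    (fun i _ ↦ (hZm i).aemeasurable)) t
  rw [charFun_apply_real, integral_map
    (Finset.measurable_fun_sum _ fun i _ ↦ hZm i).aemeasurable (by fun_prop)] at h2
  simp only [Finset.prod_apply] at h2
  refine h2.trans (Finset.prod_congr rfl fun i hi ↦ ?_)
  rw [charFun_apply_real, integral_map (hZm i).aemeasurable (by fun_prop)]
  have h3 := hP.charFun_pointCount (measurableSet_cellSet m i) (measure_cellSet_ne_top ν hi)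
    (t * fstWeight ν' m G i)
  rw [charFun_apply_real, integral_map
    (hP.measurable_pointCount (measurableSet_cellSet m i)).aemeasurable (by fun_prop)] at h3
  have h4 : ∀ ω, Complex.exp (t * Z i ω * Complex.I) =
      Complex.exp ((t * fstWeight ν' m G i : ℝ) * (pointCount (P ω) (cellSet m i)) * Complex.I) *
        Complex.exp (-((t * fstWeight ν' m G i : ℝ) * ν.real (cellSet m i) * Complex.I)) := by
    intro ω
    rw [← Complex.exp_add, hZ]
    push_cast
    ring_nf
  simp_rw [h4]
  rw [integral_mul_const, h3, ← Complex.exp_add, compExp]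
  congr 1
  push_cast
  ring

lemma tendsto_real_prod_innerSet {ν ν' : Measure Strip} {G : Set (Strip × Strip)}
    (hGi : (ν.prod ν') (G \ interior G) = 0) (hGf : (ν.prod ν') G ≠ ∞) :
    Tendsto (fun m ↦ (ν.prod ν').real (innerSet m G)) atTop (𝓝 ((ν.prod ν').real G)) :=
  (ENNReal.tendsto_toReal hGf).comp (tendsto_measure_innerSet (prod_diff_iUnion_innerSet hGi))

section Limits

variable {Ω : Type*} [MeasurableSpace Ω] {μ : Measure Ω} [IsProbabilityMeasure μ]
  {P P' : Ω → Set Strip} {ν ν' : Measure Strip} [IsLocallyFiniteMeasure ν]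
  [IsLocallyFiniteMeasure ν']

lemma ae_pairCount_lt_top (hP : IsPoissonProcess P ν μ) (hP' : IsPoissonProcess P' ν' μ)
    (hind : Indep (processSigmaAlgebra P) (processSigmaAlgebra P') μ) {G : Set (Strip × Strip)}
    (hG : MeasurableSet G) (hGf : (ν.prod ν') G ≠ ∞) :
    ∀ᵐ ω ∂μ, pairCount (P ω) (P' ω) G < ∞ := by
  refine ae_lt_top (measurable_pairCount hP hP' hG) ?_
  rwa [lintegral_pairCount hP hP' hind hG]

lemma integrable_pairCount (hP : IsPoissonProcess P ν μ) (hP' : IsPoissonProcess P' ν' μ)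
    (hind : Indep (processSigmaAlgebra P) (processSigmaAlgebra P') μ) {G : Set (Strip × Strip)}
    (hG : MeasurableSet G) (hGf : (ν.prod ν') G ≠ ∞) :
    Integrable (fun ω ↦ (pairCount (P ω) (P' ω) G).toReal) μ := by
  refine integrable_toReal_of_lintegral_ne_top (measurable_pairCount hP hP' hG).aemeasurable ?_
  rwa [lintegral_pairCount hP hP' hind hG]

lemma integral_pairCount (hP : IsPoissonProcess P ν μ) (hP' : IsPoissonProcess P' ν' μ)
    (hind : Indep (processSigmaAlgebra P) (processSigmaAlgebra P') μ) {G : Set (Strip × Strip)}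
    (hG : MeasurableSet G) (hGf : (ν.prod ν') G ≠ ∞) :
    ∫ ω, (pairCount (P ω) (P' ω) G).toReal ∂μ = (ν.prod ν').real G := by
  rw [integral_toReal (measurable_pairCount hP hP' hG).aemeasurable
    (ae_pairCount_lt_top hP hP' hind hG hGf), lintegral_pairCount hP hP' hind hG, measureReal_def]

/-- The inner sets increase to `G` up to a `ν × ν'`-null set. The expected number of pairs in that
set is its measure, so almost surely it contains none. -/
lemma ae_tendsto_cellSum (hP : IsPoissonProcess P ν μ) (hP' : IsPoissonProcess P' ν' μ)
    (hind : Indep (processSigmaAlgebra P) (processSigmaAlgebra P') μ) {G : Set (Strip × Strip)}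
    (hG : MeasurableSet G) (hGi : (ν.prod ν') (G \ interior G) = 0) (hGf : (ν.prod ν') G ≠ ∞) :
    ∀ᵐ ω ∂μ, Tendsto (fun m ↦ cellSum m G (P ω) (P' ω)) atTop
      (𝓝 (pairCount (P ω) (P' ω) G).toReal) := by
  have hH : MeasurableSet (G \ ⋃ m, innerSet m G) :=
    hG.diff (MeasurableSet.iUnion fun m ↦ measurableSet_innerSet m G)
  have h0 : ∀ᵐ ω ∂μ, pairCount (P ω) (P' ω) (G \ ⋃ m, innerSet m G) = 0 := by
    have h1 := lintegral_pairCount hP hP' hind hH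
    rw [prod_diff_iUnion_innerSet hGi] at h1
    exact (lintegral_eq_zero_iff (measurable_pairCount hP hP' hH)).1 h1
  filter_upwards [h0, ae_pairCount_lt_top hP hP' hind hG hGf] with ω h1 h2
  have h3 := (ENNReal.tendsto_toReal h2.ne).comp (tendsto_measure_innerSet h1)
  refine h3.congr fun m ↦ ?_
  change (pairCount (P ω) (P' ω) (innerSet m G)).toReal = _
  rw [pairCount_innerSet hP hP', ENNReal.toReal_ofReal (cellSum_nonneg _ _ _ _)]

/-- Variance bound for the number of pairs in `G`. -/
lemma lintegral_sq_pairCount_le (hP : IsPoissonProcess P ν μ) (hP' : IsPoissonProcess P' ν' μ)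
    (hind : Indep (processSigmaAlgebra P) (processSigmaAlgebra P') μ) {G : Set (Strip × Strip)}
    (hG : MeasurableSet G) (hGi : (ν.prod ν') (G \ interior G) = 0) (hGf : (ν.prod ν') G ≠ ∞) :
    ∫⁻ ω, ENNReal.ofReal (((pairCount (P ω) (P' ω) G).toReal - (ν.prod ν').real G) ^ 2) ∂μ ≤
      varBound ν ν' 1 G := by
  set f : ℕ → Ω → ℝ≥0∞ := fun m ω ↦ ENNReal.ofReal
    ((cellSum m G (P ω) (P' ω) - (ν.prod ν').real (innerSet m G)) ^ 2) with hf
  have h1 : ∀ᵐ ω ∂μ, liminf (fun m ↦ f m ω) atTop =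
      ENNReal.ofReal (((pairCount (P ω) (P' ω) G).toReal - (ν.prod ν').real G) ^ 2) := by
    filter_upwards [ae_tendsto_cellSum hP hP' hind hG hGi hGf] with ω hω
    exact (ENNReal.tendsto_ofReal
      ((hω.sub (tendsto_real_prod_innerSet hGi hGf)).pow 2)).liminf_eq
  rw [← lintegral_congr_ae h1]
  -- Fatou's lemma transfers the bound, which does not depend on `m`, to the limit.
  refine (lintegral_liminf_le fun m ↦ ?_).trans ?_
  · exact ((measurable_cellSum hP hP' m G).sub_const _ |>.pow_const 2).ennreal_ofReal
  · refine liminf_le_of_le (by isBoundedDefault) fun b hb ↦ ?_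
    obtain ⟨m, hm⟩ := hb.exists
    refine hm.trans ?_
    simpa using lintegral_sq_cellSum_le hP hP' hind m G 1

lemma tendsto_integral_cexp_cellSum (hP : IsPoissonProcess P ν μ) (hP' : IsPoissonProcess P' ν' μ)
    (hind : Indep (processSigmaAlgebra P) (processSigmaAlgebra P') μ) {G : Set (Strip × Strip)}
    (hG : MeasurableSet G) (hGi : (ν.prod ν') (G \ interior G) = 0) (hGf : (ν.prod ν') G ≠ ∞)
    (t : ℝ) :
    Tendsto (fun m ↦ ∫ ω, Complex.exp (t * (cellSum m G (P ω) (P' ω) -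
      (ν.prod ν').real (innerSet m G) : ℝ) * Complex.I) ∂μ) atTop
      (𝓝 (∫ ω, Complex.exp (t * ((pairCount (P ω) (P' ω) G).toReal -
        (ν.prod ν').real G : ℝ) * Complex.I) ∂μ)) := by
  refine tendsto_integral_of_dominated_convergence (fun _ ↦ 1) (fun m ↦ ?_) (integrable_const _)
    (fun m ↦ ae_of_all _ fun ω ↦ (norm_cexp_mul_I _ _).le) ?_
  · exact (integrable_cexp_mul_I ((measurable_cellSum hP hP' m G).sub_const _).aemeasurable
      t).aestronglyMeasurable
  · filter_upwards [ae_tendsto_cellSum hP hP' hind hG hGi hGf] with ω hω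
    have hc : Continuous fun x : ℝ ↦ Complex.exp (t * x * Complex.I) := by fun_prop
    exact (hc.tendsto _).comp (hω.sub (tendsto_real_prod_innerSet hGi hGf))

/-- The characteristic function of the number of pairs in `G` is close to that of the linear
functional of the first process. -/
lemma norm_charFun_pairCount_sub_le (hP : IsPoissonProcess P ν μ)
    (hP' : IsPoissonProcess P' ν' μ)
    (hind : Indep (processSigmaAlgebra P) (processSigmaAlgebra P') μ) {G : Set (Strip × Strip)}
    (hG : MeasurableSet G) (hGi : (ν.prod ν') (G \ interior G) = 0) (hGf : (ν.prod ν') G ≠ ∞)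
    (hV : varBound ν ν' 0 G ≠ ∞) (t : ℝ) :
    ‖∫ ω, Complex.exp (t * ((pairCount (P ω) (P' ω) G).toReal -
        (ν.prod ν').real G : ℝ) * Complex.I) ∂μ -
      Complex.exp (∫ p, compExp (t * ν'.real (Prod.mk p ⁻¹' G)) ∂ν)‖ ≤
      |t| * √(varBound ν ν' 0 G).toReal := by
  have hfin : ∫⁻ p, ν' (Prod.mk p ⁻¹' G) ∂ν ≠ ∞ := by rwa [← Measure.prod_apply hG]
  have hmeas : Measurable fun p ↦ ν' (Prod.mk p ⁻¹' G) := measurable_measure_prodMk_left hG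
  have h2 : Tendsto (fun m ↦ ∫ p, compExp (t * ν'.real (Prod.mk p ⁻¹' innerSet m G)) ∂ν) atTop
      (𝓝 (∫ p, compExp (t * ν'.real (Prod.mk p ⁻¹' G)) ∂ν)) := by
    -- The linear bound on `compExp` dominates by a multiple of the section measure of `G`, which is
    -- integrable because `G` has finite product measure.
    refine tendsto_integral_of_dominated_convergence
      (fun p ↦ 2 * (|t| * ν'.real (Prod.mk p ⁻¹' G))) (fun m ↦ ?_) ?_ (fun m ↦ ?_) ?_
    · refine (continuous_compExp.measurable.comp (Measurable.const_mul ?_ t)).aestronglyMeasurable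
      exact (measurable_measure_prodMk_left (measurableSet_innerSet m G)).ennreal_toReal
    · exact ((integrable_toReal_of_lintegral_ne_top hmeas.aemeasurable hfin).const_mul _).const_mul
        _
    · filter_upwards [ae_lt_top hmeas hfin] with p hp
      refine (norm_compExp_le _).trans ?_
      rw [abs_mul, abs_of_nonneg measureReal_nonneg]
      gcongr
      exacts [hp.ne, innerSet_subset m G]
    · filter_upwards [ae_lt_top hmeas hfin,
        ae_section_null (prod_diff_iUnion_innerSet hGi)] with p hp hp0
      refine (continuous_compExp.tendsto _).comp (Tendsto.const_mul t ?_)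
      refine (ENNReal.tendsto_toReal hp.ne).comp ?_
      have h5 : Prod.mk p ⁻¹' G =ᵐ[ν'] ⋃ m, Prod.mk p ⁻¹' innerSet m G := by
        refine (ae_eq_set).2 ⟨?_, ?_⟩
        · rw [← Set.preimage_iUnion, ← Set.preimage_sdiff]
          exact hp0
        · rw [Set.sdiff_eq_empty.2]
          · simp
          · exact Set.iUnion_subset fun m ↦ Set.preimage_mono (innerSet_subset m G)
      rw [measure_congr h5]
      exact tendsto_measure_iUnion_atTop fun m m' hm ↦ Set.preimage_mono (monotone_innerSet G hm)
  refine le_of_tendsto ((tendsto_integral_cexp_cellSum hP hP' hind hG hGi hGf t).sub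
    ((Complex.continuous_exp.tendsto _).comp h2)).norm (Eventually.of_forall fun m ↦ ?_)
  simp only [Function.comp]
  -- At level `m` the exponential is the characteristic function of `linearPart`, and `θ = 0` in the
  -- variance bound measures the `L²` distance to it.
  rw [← hP.integral_cexp_linearPart]
  refine norm_integral_cexp_sub_le ((measurable_cellSum hP hP' m G).sub_const _).aemeasurable
    (measurable_linearPart hP m G).aemeasurable t hV ?_
  simpa using lintegral_sq_cellSum_le hP hP' hind m G 0

end Limits

/-! ### Translations along the strip -/

/-- Translation of the location. -/
def stripShift (a : ℝ) (p : Strip) : Strip := (p.1 + a, p.2)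

/-- The measure is invariant under translations of the location. -/
def ShiftInvariant (ν : Measure Strip) : Prop := ∀ a, MeasurePreserving (stripShift a) ν ν

/-- Shift of a cell index. -/
def cellShift (k : ℤ) (i : ℤ × ℤ) : ℤ × ℤ := (i.1 + k, i.2)

lemma cellShift_injective (k : ℤ) : Function.Injective (cellShift k) := by
  rintro ⟨a, b⟩ ⟨c, d⟩ h
  simpa [cellShift] using h

lemma stripCell_stripShift (m : ℕ) (k : ℤ) (p : Strip) :
    stripCell m (stripShift (k / 2 ^ m) p) = cellShift k (stripCell m p) := by
  have h2 : (0 : ℝ) < 2 ^ m := by positivity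
  have : (2 : ℝ) ^ m * (p.1 + k / 2 ^ m) = 2 ^ m * p.1 + k := by field_simp
  simp only [stripCell, stripShift, cellShift, this, Int.floor_add_intCast]

lemma preimage_cellSet_cellShift (m : ℕ) (k : ℤ) (i : ℤ × ℤ) :
    stripShift (k / 2 ^ m) ⁻¹' cellSet m (cellShift k i) = cellSet m i := by
  ext p
  simp only [cellSet, Set.mem_preimage, Set.mem_singleton_iff, stripCell_stripShift,
    (cellShift_injective k).eq_iff]

lemma ShiftInvariant.measure_cellSet {ν : Measure Strip} (hν : ShiftInvariant ν) (m : ℕ) (k : ℤ)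
    (i : ℤ × ℤ) : ν (cellSet m (cellShift k i)) = ν (cellSet m i) := by
  rw [← preimage_cellSet_cellShift m k i,
    (hν _).measure_preimage (measurableSet_cellSet m _).nullMeasurableSet]

/-- Shift invariance concerns the whole family of cell counts, so finiteness is also needed outside
`cellBox`. -/
lemma measure_cellSet_lt_top (ν : Measure Strip) [IsLocallyFiniteMeasure ν] (m : ℕ) (i : ℤ × ℤ) :
    ν (cellSet m i) < ∞ := by
  have h2 : (0 : ℝ) < 2 ^ m := by positivity
  have hK : IsCompact (Set.Icc ((i.1 : ℝ) / 2 ^ m) ((i.1 + 1) / 2 ^ m) ×ˢ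
      (Set.univ : Set unitInterval)) := isCompact_Icc.prod isCompact_univ
  refine (measure_mono ?_).trans_lt hK.measure_lt_top
  rintro p rfl
  refine ⟨⟨?_, ?_⟩, trivial⟩
  · rw [div_le_iff₀ h2, mul_comm]
    exact Int.floor_le _
  · rw [le_div_iff₀ h2, mul_comm]
    exact (Int.lt_floor_add_one _).le

/-- The lower corner belongs to the cell. Nonemptiness lets an inclusion of a product of cells in a
block be turned into bounds for the indices. -/
lemma nonempty_cellSet {m : ℕ} {i : ℤ × ℤ} (hi : i ∈ cellBox m) : (cellSet m i).Nonempty := by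
  have h2 : (0 : ℝ) < 2 ^ m := by positivity
  simp only [cellBox, Finset.mem_product, Finset.mem_Icc] at hi
  have h3 : (0 : ℝ) ≤ i.2 := by exact_mod_cast hi.2.1
  have h4 : (i.2 : ℝ) ≤ 2 ^ m := by exact_mod_cast hi.2.2
  refine ⟨((i.1 : ℝ) / 2 ^ m, ⟨(i.2 : ℝ) / 2 ^ m, by positivity, (div_le_one h2).2 h4⟩), ?_⟩
  simp only [cellSet, stripCell, Set.mem_preimage, Set.mem_singleton_iff,
    mul_div_cancel₀ _ h2.ne', Int.floor_intCast]

/-! ### Pairs in blocks -/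

/-- The pairs in `E` with both locations in `[a, b)`. -/
def blockSet (E : Set (Strip × Strip)) (a b : ℝ) : Set (Strip × Strip) :=
  {q | q ∈ E ∧ q.1.1 ∈ Set.Ico a b ∧ q.2.1 ∈ Set.Ico a b}

lemma index_bounds_of_mem_innerPairs {E : Set (Strip × Strip)} {a b : ℤ} {m : ℕ}
    {ij : (ℤ × ℤ) × (ℤ × ℤ)} (h : ij ∈ innerPairs m (blockSet E a b)) :
    (a * 2 ^ m ≤ ij.1.1 ∧ ij.1.1 < b * 2 ^ m) ∧ (a * 2 ^ m ≤ ij.2.1 ∧ ij.2.1 < b * 2 ^ m) := by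
  have h2 : (0 : ℝ) < 2 ^ m := by positivity
  obtain ⟨⟨h3, h4⟩, h5⟩ := mem_innerPairs.1 h
  obtain ⟨p, hp⟩ := nonempty_cellSet h3
  obtain ⟨p', hp'⟩ := nonempty_cellSet h4
  obtain ⟨-, h6, h7⟩ := h5 (Set.mk_mem_prod hp hp')
  have key : ∀ (r : Strip) (i : ℤ × ℤ), r ∈ cellSet m i → r.1 ∈ Set.Ico (a : ℝ) b →
      a * 2 ^ m ≤ i.1 ∧ i.1 < b * 2 ^ m := by
    rintro r i rfl hr
    simp only [stripCell, Int.le_floor, Int.floor_lt]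
    push_cast
    exact ⟨by nlinarith [hr.1], by nlinarith [hr.2]⟩
  exact ⟨key p _ hp h6, key p' _ hp' h7⟩

/-- A shift by the integer `k` moves the grid of level `m` onto itself by `k * 2 ^ m` columns. Since
both blocks lie in `[-R, R)` and `R ≤ m`, the truncation to `cellBox m` loses nothing. -/
lemma mem_innerPairs_blockSet_shift {E : Set (Strip × Strip)}
    (hE : ∀ (a : ℝ) (p p' : Strip), (stripShift a p, stripShift a p') ∈ E ↔ (p, p') ∈ E)
    {a b k R : ℤ} {m : ℕ} (ha : -R ≤ a) (hb : b ≤ R) (ha' : -R ≤ a + k) (hb' : b + k ≤ R)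
    (hm : R ≤ m) (ij : (ℤ × ℤ) × (ℤ × ℤ)) :
    (cellShift (k * 2 ^ m) ij.1, cellShift (k * 2 ^ m) ij.2) ∈
        innerPairs m (blockSet E (a + k : ℤ) (b + k : ℤ)) ↔
      ij ∈ innerPairs m (blockSet E a b) := by
  have h2 : (0 : ℤ) < 2 ^ m := by positivity
  have h2' : (0 : ℝ) < 2 ^ m := by positivity
  have hk : (((k * 2 ^ m : ℤ) : ℝ) / 2 ^ m) = k := by push_cast; field_simp
  have hsub : cellSet m (cellShift (k * 2 ^ m) ij.1) ×ˢ cellSet m (cellShift (k * 2 ^ m) ij.2) ⊆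
      blockSet E (a + k : ℤ) (b + k : ℤ) ↔
      cellSet m ij.1 ×ˢ cellSet m ij.2 ⊆ blockSet E a b := by
    have hpre : ∀ p p' : Strip, (stripShift k p, stripShift k p') ∈
        blockSet E (a + k : ℤ) (b + k : ℤ) ↔ (p, p') ∈ blockSet E a b := by
      intro p p'
      change (_ ∧ (_ ∧ _) ∧ (_ ∧ _)) ↔ (_ ∧ (_ ∧ _) ∧ (_ ∧ _))
      rw [hE]
      simp [stripShift]
    have hcell : ∀ (p : Strip) (i : ℤ × ℤ),
        stripShift k p ∈ cellSet m (cellShift (k * 2 ^ m) i) ↔ p ∈ cellSet m i := by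
      intro p i
      rw [← preimage_cellSet_cellShift m (k * 2 ^ m) i, hk, Set.mem_preimage]
    constructor
    · rintro h ⟨p, p'⟩ ⟨hp, hp'⟩
      exact (hpre p p').1 (h ⟨(hcell p _).2 hp, (hcell p' _).2 hp'⟩)
    · rintro h ⟨p, p'⟩ ⟨hp, hp'⟩
      have e : ∀ r : Strip, stripShift k (stripShift (-k) r) = r := fun r ↦ by
        simp [stripShift]
      rw [← e p, ← e p', hpre]
      rw [← e p] at hp
      rw [← e p'] at hp'
      exact h ⟨(hcell _ _).1 hp, (hcell _ _).1 hp'⟩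
  have hbox : ∀ (c d x : ℤ), -R ≤ c → d ≤ R → c * 2 ^ m ≤ x → x < d * 2 ^ m →
      -(m * 2 ^ m : ℤ) ≤ x ∧ x < m * 2 ^ m := fun c d x h3 h4 h5 h6 ↦
    ⟨by nlinarith, by nlinarith⟩
  constructor
  · intro h
    have h3 := index_bounds_of_mem_innerPairs h
    obtain ⟨⟨h4, h5⟩, h6⟩ := mem_innerPairs.1 h
    simp only [cellShift] at h3
    have h7 := hbox a b ij.1.1 ha hb (by nlinarith [h3.1.1]) (by nlinarith [h3.1.2])
    have h8 := hbox a b ij.2.1 ha hb (by nlinarith [h3.2.1]) (by nlinarith [h3.2.2])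
    simp only [cellBox, cellShift, Finset.mem_product, Finset.mem_Ico] at h4 h5
    refine mem_innerPairs.2 ⟨⟨?_, ?_⟩, hsub.1 h6⟩
    · simp only [cellBox, Finset.mem_product, Finset.mem_Ico]
      exact ⟨h7, h4.2⟩
    · simp only [cellBox, Finset.mem_product, Finset.mem_Ico]
      exact ⟨h8, h5.2⟩
  · intro h
    have h3 := index_bounds_of_mem_innerPairs h
    obtain ⟨⟨h4, h5⟩, h6⟩ := mem_innerPairs.1 h
    have h7 := hbox (a + k) (b + k) (ij.1.1 + k * 2 ^ m) ha' hb' (by nlinarith [h3.1.1])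
      (by nlinarith [h3.1.2])
    have h8 := hbox (a + k) (b + k) (ij.2.1 + k * 2 ^ m) ha' hb' (by nlinarith [h3.2.1])
      (by nlinarith [h3.2.2])
    simp only [cellBox, Finset.mem_product, Finset.mem_Ico] at h4 h5
    refine mem_innerPairs.2 ⟨⟨?_, ?_⟩, hsub.2 h6⟩
    · simp only [cellBox, cellShift, Finset.mem_product, Finset.mem_Ico]
      exact ⟨h7, h4.2⟩
    · simp only [cellBox, cellShift, Finset.mem_product, Finset.mem_Ico]
      exact ⟨h8, h5.2⟩

lemma cellSum_blockSet_shift {E : Set (Strip × Strip)}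
    (hE : ∀ (a : ℝ) (p p' : Strip), (stripShift a p, stripShift a p') ∈ E ↔ (p, p') ∈ E)
    {a b k R : ℤ} {m : ℕ} (ha : -R ≤ a) (hb : b ≤ R) (ha' : -R ≤ a + k) (hb' : b + k ≤ R)
    (hm : R ≤ m) (s s' : Set Strip) :
    cellSum m (blockSet E (a + k : ℤ) (b + k : ℤ)) s s' =
      ∑ ij ∈ innerPairs m (blockSet E a b),
        pointCount s (cellSet m (cellShift (k * 2 ^ m) ij.1)) *
          pointCount s' (cellSet m (cellShift (k * 2 ^ m) ij.2)) := by
  have key := mem_innerPairs_blockSet_shift hE ha hb ha' hb' hm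
  rw [cellSum]
  symm
  refine Finset.sum_nbij (fun ij ↦ (cellShift (k * 2 ^ m) ij.1, cellShift (k * 2 ^ m) ij.2))
    (fun ij h ↦ (key ij).2 h) ?_ ?_ (fun _ _ ↦ rfl)
  · rintro ⟨i, j⟩ - ⟨i', j'⟩ - h
    simp only [Prod.mk.injEq, (cellShift_injective _).eq_iff] at h
    exact Prod.ext h.1 h.2
  · intro ij h
    have e : ∀ i : ℤ × ℤ, cellShift (k * 2 ^ m) (cellShift (-(k * 2 ^ m)) i) = i := fun i ↦ by
      simp [cellShift]
    refine ⟨(cellShift (-(k * 2 ^ m)) ij.1, cellShift (-(k * 2 ^ m)) ij.2), ?_, by simp [e]⟩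
    rw [Finset.mem_coe, ← key]
    simpa [e] using h

/-- All counts of the two processes in the cells of level `m`. -/
noncomputable def cellCounts {Ω : Type*} (m : ℕ) (P P' : Ω → Set Strip) :
    (ℤ × ℤ) ⊕ (ℤ × ℤ) → Ω → ℝ :=
  Sum.elim (fun i ω ↦ pointCount (P ω) (cellSet m i)) fun i ω ↦ pointCount (P' ω) (cellSet m i)

lemma measurable_cellCounts {Ω : Type*} [MeasurableSpace Ω] {μ : Measure Ω}
    {P P' : Ω → Set Strip} {ν ν' : Measure Strip} (hP : IsPoissonProcess P ν μ)
    (hP' : IsPoissonProcess P' ν' μ) (m : ℕ)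
    (i : (ℤ × ℤ) ⊕ (ℤ × ℤ)) : Measurable (cellCounts m P P' i) := by
  rcases i with i | i
  · exact hP.measurable_pointCount (measurableSet_cellSet m i)
  · exact hP'.measurable_pointCount (measurableSet_cellSet m i)

lemma iIndepFun_cellCounts {Ω : Type*} [MeasurableSpace Ω] {μ : Measure Ω}
    {P P' : Ω → Set Strip} {ν ν' : Measure Strip} (hP : IsPoissonProcess P ν μ)
    (hP' : IsPoissonProcess P' ν' μ)
    (hind : Indep (processSigmaAlgebra P) (processSigmaAlgebra P') μ) (m : ℕ) :
    iIndepFun (cellCounts m P P') μ :=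
  iIndepFun_sumElim hind
    (fun i ↦ measurable_processSigmaAlgebra_pointCount P (measurableSet_cellSet m i))
    (fun i ↦ measurable_processSigmaAlgebra_pointCount P' (measurableSet_cellSet m i))
    (hP.iIndepFun_pointCount (measurableSet_cellSet m) (pairwise_disjoint_cellSet m))
    (hP'.iIndepFun_pointCount (measurableSet_cellSet m) (pairwise_disjoint_cellSet m))

lemma measurable_cellSum_iSup {Ω : Type*} {m : ℕ} {G : Set (Strip × Strip)} {I : Set ℤ}
    (h : ∀ ij ∈ innerPairs m G, ij.1.1 ∈ I ∧ ij.2.1 ∈ I) (P P' : Ω → Set Strip) :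
    Measurable[⨆ i ∈ {i : (ℤ × ℤ) ⊕ (ℤ × ℤ) | (Sum.elim Prod.fst Prod.fst i : ℤ) ∈ I},
      MeasurableSpace.comap (cellCounts m P P' i) inferInstance]
      fun ω ↦ cellSum m G (P ω) (P' ω) := by
  refine Finset.measurable_fun_sum _ fun ij hij ↦ Measurable.mul ?_ ?_
  · exact (comap_measurable (cellCounts m P P' (Sum.inl ij.1))).mono
      (le_iSup₂_of_le (Sum.inl ij.1) (h ij hij).1 le_rfl) le_rfl
  · exact (comap_measurable (cellCounts m P P' (Sum.inr ij.2))).mono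
      (le_iSup₂_of_le (Sum.inr ij.2) (h ij hij).2 le_rfl) le_rfl

/-- Both laws are product measures with the same Poisson marginals, because shifted cells have equal
measure. -/
lemma map_cellCounts_shift {Ω : Type*} [MeasurableSpace Ω] {μ : Measure Ω}
    {P P' : Ω → Set Strip} {ν ν' : Measure Strip} [IsLocallyFiniteMeasure ν]
    [IsLocallyFiniteMeasure ν'] (hP : IsPoissonProcess P ν μ) (hP' : IsPoissonProcess P' ν' μ)
    (hind : Indep (processSigmaAlgebra P) (processSigmaAlgebra P') μ) (hν : ShiftInvariant ν)
    (hν' : ShiftInvariant ν') (m : ℕ) (k : ℤ) :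
    μ.map (fun ω i ↦ cellCounts m P P' (Sum.map (cellShift k) (cellShift k) i) ω) =
      μ.map (fun ω i ↦ cellCounts m P P' i ω) := by
  have h1 := iIndepFun_cellCounts hP hP' hind m
  have h2 := h1.precomp ((cellShift_injective k).sumMap (cellShift_injective k))
  rw [h1.map_fun_eq_infinitePi_map (measurable_cellCounts hP hP' m)]
  refine (h2.map_fun_eq_infinitePi_map fun i ↦ measurable_cellCounts hP hP' m _).trans ?_
  congr 1 with i : 1
  rcases i with i | i
  · refine (hP.map_pointCount (measurableSet_cellSet m (cellShift k i))
      (measure_cellSet_lt_top ν m _).ne).trans ?_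
    rw [hν.measure_cellSet]
    exact (hP.map_pointCount (measurableSet_cellSet m i) (measure_cellSet_lt_top ν m _).ne).symm
  · refine (hP'.map_pointCount (measurableSet_cellSet m (cellShift k i))
      (measure_cellSet_lt_top ν' m _).ne).trans ?_
    rw [hν'.measure_cellSet]
    exact (hP'.map_pointCount (measurableSet_cellSet m i) (measure_cellSet_lt_top ν' m _).ne).symm

lemma integral_cexp_cellSum_shift {Ω : Type*} [MeasurableSpace Ω] {μ : Measure Ω}
    {P P' : Ω → Set Strip} {ν ν' : Measure Strip} [IsLocallyFiniteMeasure ν]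
    [IsLocallyFiniteMeasure ν'] (hP : IsPoissonProcess P ν μ) (hP' : IsPoissonProcess P' ν' μ)
    (hind : Indep (processSigmaAlgebra P) (processSigmaAlgebra P') μ) (hν : ShiftInvariant ν)
    (hν' : ShiftInvariant ν') {E : Set (Strip × Strip)}
    (hE : ∀ (a : ℝ) (p p' : Strip), (stripShift a p, stripShift a p') ∈ E ↔ (p, p') ∈ E)
    {a b k R : ℤ} {m : ℕ} (ha : -R ≤ a) (hb : b ≤ R) (ha' : -R ≤ a + k) (hb' : b + k ≤ R)
    (hm : R ≤ m) (t : ℝ) :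
    ∫ ω, Complex.exp (t * cellSum m (blockSet E (a + k : ℤ) (b + k : ℤ)) (P ω) (P' ω) *
      Complex.I) ∂μ =
    ∫ ω, Complex.exp (t * cellSum m (blockSet E a b) (P ω) (P' ω) * Complex.I) ∂μ := by
  simp_rw [cellSum_blockSet_shift hE ha hb ha' hb' hm]
  set f : ((ℤ × ℤ) ⊕ (ℤ × ℤ) → ℝ) → ℂ := fun z ↦ Complex.exp (t *
    (∑ ij ∈ innerPairs m (blockSet E a b), z (Sum.inl ij.1) * z (Sum.inr ij.2) : ℝ) *
      Complex.I) with hf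
  have hfm : Measurable f := by fun_prop
  have hm1 : Measurable fun ω i ↦ cellCounts m P P' i ω :=
    measurable_pi_lambda _ fun i ↦ measurable_cellCounts hP hP' m i
  have hm2 : Measurable fun ω i ↦
      cellCounts m P P' (Sum.map (cellShift (k * 2 ^ m)) (cellShift (k * 2 ^ m)) i) ω :=
    measurable_pi_lambda _ fun i ↦ measurable_cellCounts hP hP' m _
  have h1 := integral_map (μ := μ) hm1.aemeasurable (f := f) hfm.aestronglyMeasurable
  have h2 := integral_map (μ := μ) hm2.aemeasurable (f := f) hfm.aestronglyMeasurable
  rw [map_cellCounts_shift hP hP' hind hν hν', h1] at h2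
  exact h2.symm

/-- Disjoint blocks read disjoint sets of columns of cells, and the counts in all cells of both
processes are independent; one block is split off at a time. -/
lemma integral_cexp_sum_cellSum {Ω : Type*} [MeasurableSpace Ω] {μ : Measure Ω}
    [IsProbabilityMeasure μ] {P P' : Ω → Set Strip} {ν ν' : Measure Strip}
    (hP : IsPoissonProcess P ν μ) (hP' : IsPoissonProcess P' ν' μ)
    (hind : Indep (processSigmaAlgebra P) (processSigmaAlgebra P') μ)
    (E : Set (Strip × Strip)) (L : ℕ) (m : ℕ) (t : ℝ) (N : ℕ) :
    ∫ ω, Complex.exp (t * (∑ j ∈ Finset.range N,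
      cellSum m (blockSet E ((j * L : ℕ) : ℤ) ((j * L + L : ℕ) : ℤ)) (P ω) (P' ω) : ℝ) *
        Complex.I) ∂μ =
    ∏ j ∈ Finset.range N, ∫ ω, Complex.exp (t *
      cellSum m (blockSet E ((j * L : ℕ) : ℤ) ((j * L + L : ℕ) : ℤ)) (P ω) (P' ω) *
        Complex.I) ∂μ := by
  induction N with
  | zero => simp
  | succ N ih =>
    rw [Finset.prod_range_succ, ← ih]
    simp_rw [Finset.sum_range_succ]
    have hpow : (0 : ℤ) < 2 ^ m := by positivity
    -- The columns left of location `N * L` carry the first `N` blocks, the others carry the next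
    -- one.
    set I : Set ℤ := Set.Iio ((N * L : ℕ) * 2 ^ m) with hI
    set J : Set ℤ := Set.Ici ((N * L : ℕ) * 2 ^ m) with hJ
    have hdisj : Disjoint {i : (ℤ × ℤ) ⊕ (ℤ × ℤ) | (Sum.elim Prod.fst Prod.fst i : ℤ) ∈ I}
        {i | (Sum.elim Prod.fst Prod.fst i : ℤ) ∈ J} :=
      Set.disjoint_left.2 fun i h1 h2 ↦ by
        have h3 : (Sum.elim Prod.fst Prod.fst i : ℤ) ∈ I := h1
        have h4 : (Sum.elim Prod.fst Prod.fst i : ℤ) ∈ J := h2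
        exact not_lt.2 (Set.mem_Ici.1 h4) (Set.mem_Iio.1 h3)
    have hindep := indep_iSup_of_disjoint
      (fun i ↦ (measurable_cellCounts hP hP' m i).comap_le)
      (iIndepFun_cellCounts hP hP' hind m) hdisj
    have hX : Measurable[⨆ i ∈ {i : (ℤ × ℤ) ⊕ (ℤ × ℤ) | (Sum.elim Prod.fst Prod.fst i : ℤ) ∈ I},
        MeasurableSpace.comap (cellCounts m P P' i) inferInstance] fun ω ↦ ∑ j ∈ Finset.range N,
        cellSum m (blockSet E ((j * L : ℕ) : ℤ) ((j * L + L : ℕ) : ℤ)) (P ω) (P' ω) := by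
      refine Finset.measurable_fun_sum _ fun j hj ↦ measurable_cellSum_iSup (fun ij hij ↦ ?_) P P'
      have hb := index_bounds_of_mem_innerPairs hij
      have hjN : ((j * L + L : ℕ) : ℤ) ≤ ((N * L : ℕ) : ℤ) := by
        have := Finset.mem_range.1 hj
        have : j * L + L ≤ N * L := by nlinarith
        exact_mod_cast this
      exact ⟨lt_of_lt_of_le hb.1.2 (by gcongr), lt_of_lt_of_le hb.2.2 (by gcongr)⟩
    have hY : Measurable[⨆ i ∈ {i : (ℤ × ℤ) ⊕ (ℤ × ℤ) | (Sum.elim Prod.fst Prod.fst i : ℤ) ∈ J},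
        MeasurableSpace.comap (cellCounts m P P' i) inferInstance] fun ω ↦
        cellSum m (blockSet E ((N * L : ℕ) : ℤ) ((N * L + L : ℕ) : ℤ)) (P ω) (P' ω) := by
      refine measurable_cellSum_iSup (fun ij hij ↦ ?_) P P'
      have hb := index_bounds_of_mem_innerPairs hij
      exact ⟨hb.1.1, hb.2.1⟩
    have hle : ∀ I : Set ℤ, (⨆ i ∈ {i : (ℤ × ℤ) ⊕ (ℤ × ℤ) | (Sum.elim Prod.fst Prod.fst i : ℤ) ∈ I},
        MeasurableSpace.comap (cellCounts m P P' i) inferInstance) ≤ ‹MeasurableSpace Ω› :=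
      fun I ↦ iSup₂_le fun i _ ↦ (measurable_cellCounts hP hP' m i).comap_le
    have hXY : IndepFun (fun ω ↦ ∑ j ∈ Finset.range N,
        cellSum m (blockSet E ((j * L : ℕ) : ℤ) ((j * L + L : ℕ) : ℤ)) (P ω) (P' ω))
        (fun ω ↦ cellSum m (blockSet E ((N * L : ℕ) : ℤ) ((N * L + L : ℕ) : ℤ)) (P ω) (P' ω)) μ :=
      indep_of_indep_of_le_left (indep_of_indep_of_le_right hindep hY.comap_le) hX.comap_le
    have hc : Measurable fun x : ℝ ↦ Complex.exp (t * x * Complex.I) := by fun_prop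
    have := (hXY.comp hc hc).integral_fun_mul_eq_mul_integral
      (hc.comp (hX.mono (hle I) le_rfl)).aestronglyMeasurable
      (hc.comp (hY.mono (hle J) le_rfl)).aestronglyMeasurable
    simp only [Function.comp] at this
    rw [← this]
    congr 1 with ω
    rw [← Complex.exp_add, Complex.ofReal_add]
    congr 1
    ring

section Blocks

variable {Ω : Type*} [MeasurableSpace Ω] {μ : Measure Ω} [IsProbabilityMeasure μ]
  {P P' : Ω → Set Strip} {ν ν' : Measure Strip} [IsLocallyFiniteMeasure ν]
  [IsLocallyFiniteMeasure ν']

/-- The numbers of pairs in disjoint blocks of equal length are independent and identically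
distributed, in terms of characteristic functions. -/
lemma integral_cexp_sum_pairCount (hP : IsPoissonProcess P ν μ) (hP' : IsPoissonProcess P' ν' μ)
    (hind : Indep (processSigmaAlgebra P) (processSigmaAlgebra P') μ) (hν : ShiftInvariant ν)
    (hν' : ShiftInvariant ν') {E : Set (Strip × Strip)}
    (hE : ∀ (a : ℝ) (p p' : Strip), (stripShift a p, stripShift a p') ∈ E ↔ (p, p') ∈ E)
    (L : ℕ) (hG : ∀ j : ℕ, MeasurableSet (blockSet E (j * L : ℕ) (j * L + L : ℕ)))
    (hGi : ∀ j : ℕ, (ν.prod ν') (blockSet E (j * L : ℕ) (j * L + L : ℕ) \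
      interior (blockSet E (j * L : ℕ) (j * L + L : ℕ))) = 0)
    (hGf : ∀ j : ℕ, (ν.prod ν') (blockSet E (j * L : ℕ) (j * L + L : ℕ)) ≠ ∞) (t : ℝ) (N : ℕ) :
    ∫ ω, Complex.exp (t * (∑ j ∈ Finset.range N,
      (pairCount (P ω) (P' ω) (blockSet E (j * L : ℕ) (j * L + L : ℕ))).toReal : ℝ) *
        Complex.I) ∂μ =
    (∫ ω, Complex.exp (t * (pairCount (P ω) (P' ω) (blockSet E (0 : ℕ) L)).toReal *
        Complex.I) ∂μ) ^ N := by
  have hc : Continuous fun x : ℝ ↦ Complex.exp (t * x * Complex.I) := by fun_prop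
  have h1 : Tendsto (fun m ↦ ∫ ω, Complex.exp (t * (∑ j ∈ Finset.range N,
      cellSum m (blockSet E (j * L : ℕ) (j * L + L : ℕ)) (P ω) (P' ω) : ℝ) *
        Complex.I) ∂μ) atTop (𝓝 (∫ ω, Complex.exp (t * (∑ j ∈ Finset.range N,
      (pairCount (P ω) (P' ω) (blockSet E (j * L : ℕ) (j * L + L : ℕ))).toReal : ℝ) *
        Complex.I) ∂μ)) := by
    refine tendsto_integral_of_dominated_convergence (fun _ ↦ 1) (fun m ↦ ?_) (integrable_const _)
      (fun m ↦ ae_of_all _ fun ω ↦ (norm_cexp_mul_I _ _).le) ?_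
    · exact (hc.measurable.comp (Finset.measurable_fun_sum _ fun j _ ↦
        measurable_cellSum hP hP' m _)).aestronglyMeasurable
    · filter_upwards [ae_all_iff.2 fun j ↦
        ae_tendsto_cellSum hP hP' hind (hG j) (hGi j) (hGf j)] with ω hω
      exact (hc.tendsto _).comp (tendsto_finsetSum _ fun j _ ↦ hω j)
  have h2 : Tendsto (fun m ↦ (∫ ω, Complex.exp (t *
      cellSum m (blockSet E (0 : ℕ) L) (P ω) (P' ω) * Complex.I) ∂μ) ^ N) atTop
      (𝓝 ((∫ ω, Complex.exp (t * (pairCount (P ω) (P' ω) (blockSet E (0 : ℕ) L)).toReal *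
        Complex.I) ∂μ) ^ N)) := by
    refine Tendsto.pow ?_ N
    refine tendsto_integral_of_dominated_convergence (fun _ ↦ 1) (fun m ↦ ?_) (integrable_const _)
      (fun m ↦ ae_of_all _ fun ω ↦ (norm_cexp_mul_I _ _).le) ?_
    · exact (hc.measurable.comp (measurable_cellSum hP hP' m _)).aestronglyMeasurable
    · have h0 := ae_tendsto_cellSum hP hP' hind (hG 0) (hGi 0) (hGf 0)
      simp only [zero_mul, zero_add] at h0
      filter_upwards [h0] with ω hω
      exact (hc.tendsto _).comp hω
  refine tendsto_nhds_unique h1 (h2.congr' ?_)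
  -- From this level on the box contains all `N` blocks, so every block is an exact shift of the
  -- first.
  filter_upwards [eventually_ge_atTop (N * L)] with m hm
  have h3 := integral_cexp_sum_cellSum hP hP' hind E L m t N
  simp only [Int.cast_natCast] at h3
  rw [h3]
  symm
  refine (Finset.prod_congr rfl fun j hj ↦ ?_).trans
    (by rw [Finset.prod_const, Finset.card_range])
  have hjN : j * L + L ≤ N * L := by
    have := Finset.mem_range.1 hj
    nlinarith
  have h4 := integral_cexp_cellSum_shift hP hP' hind hν hν' hE (a := 0) (b := L)
    (k := ((j * L : ℕ) : ℤ)) (R := ((N * L : ℕ) : ℤ)) (m := m) (by omega) (by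
      have : L ≤ N * L := by nlinarith
      exact_mod_cast this) (by omega) (by
      have : L + j * L ≤ N * L := by omega
      exact_mod_cast this) (by exact_mod_cast hm) t
  have e1 : (((0 : ℤ) + ((j * L : ℕ) : ℤ) : ℤ) : ℝ) = ((j * L : ℕ) : ℝ) := by push_cast; ring
  have e2 : (((L : ℤ) + ((j * L : ℕ) : ℤ) : ℤ) : ℝ) = ((j * L + L : ℕ) : ℝ) := by push_cast; ring
  rw [e1, e2] at h4
  simpa using h4

end Blocks

/-! ### Power functions of the mark -/

/-- `w ^ (-a)` as an extended nonnegative number. -/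
noncomputable def markPow (a : ℝ) (w : unitInterval) : ℝ≥0∞ := ENNReal.ofReal ((w : ℝ) ^ (-a))

/-- The integral of `markPow a`. -/
noncomputable def markInt (a : ℝ) : ℝ≥0∞ := ∫⁻ w, markPow a w

@[fun_prop]
lemma measurable_markPow (a : ℝ) : Measurable (markPow a) := by
  unfold markPow
  fun_prop

lemma ae_mark_pos : ∀ᵐ w : unitInterval, 0 < (w : ℝ) := by
  have h : ∀ᵐ w : unitInterval, w ≠ 0 := by
    simp [ae_iff]
  filter_upwards [h] with w hw
  exact unitInterval.pos_iff_ne_zero.2 hw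

lemma markPow_add {w : unitInterval} (hw : 0 < (w : ℝ)) (a b : ℝ) :
    markPow a w * markPow b w = markPow (a + b) w := by
  rw [markPow, markPow, markPow, ← ENNReal.ofReal_mul (by positivity), ← Real.rpow_add hw]
  ring_nf

lemma lintegral_unitInterval (f : ℝ → ℝ≥0∞) :
    ∫⁻ w : unitInterval, f w = ∫⁻ w in Set.Icc 0 1, f w := by
  rw [unitInterval.volume_def, lintegral_subtype_comap measurableSet_Icc]

lemma markInt_ne_top {a : ℝ} (ha : a < 1) : markInt a ≠ ∞ := by
  rw [markInt]
  simp only [markPow]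
  rw [lintegral_unitInterval fun w ↦ ENNReal.ofReal (w ^ (-a)),
    Measure.restrict_congr_set Ioc_ae_eq_Icc.symm]
  have h := (intervalIntegral.intervalIntegrable_rpow' (a := 0) (b := 1) (r := -a)
    (by linarith)).1
  have h2 := h.2
  rw [hasFiniteIntegral_iff_ofReal] at h2
  · exact h2.ne
  · filter_upwards [ae_restrict_mem measurableSet_Ioc] with x hx
    exact Real.rpow_nonneg hx.1.le _

lemma markInt_pos (a : ℝ) : 0 < markInt a := by
  rw [markInt, lintegral_pos_iff_support (measurable_markPow a)]
  have h : (volume : Measure unitInterval) (Function.support (markPow a)) =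
      volume (Set.univ : Set unitInterval) := by
    refine measure_congr (eventuallyEq_univ.2 ?_)
    filter_upwards [ae_mark_pos] with w hw
    simp only [Function.mem_support, markPow, ne_eq, ENNReal.ofReal_eq_zero, not_le]
    exact Real.rpow_pos_of_pos hw _
  rw [h]
  simp

/-! ### Neighborhoods -/

section Geometry

variable {γ γ' β : ℝ}

lemma continuous_connF (hγ : 0 < γ) (hγ' : 0 < γ') :
    Continuous fun q : Strip × Strip ↦ connF γ γ' q.1 q.2 := by
  unfold connF
  have h1 : Continuous fun q : Strip × Strip ↦ ((q.1.2 : ℝ)) ^ γ :=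
    (Continuous.rpow_const (by fun_prop) fun _ ↦ Or.inr hγ.le)
  have h2 : Continuous fun q : Strip × Strip ↦ ((q.2.2 : ℝ)) ^ γ' :=
    (Continuous.rpow_const (by fun_prop) fun _ ↦ Or.inr hγ'.le)
  fun_prop

lemma connF_symm (γ γ' : ℝ) (p p' : Strip) : connF γ γ' p p' = connF γ' γ p' p := by
  simp only [connF, abs_sub_comm p.1 p'.1]
  ring

lemma connF_stripShift (γ γ' a : ℝ) (p p' : Strip) :
    connF γ γ' (stripShift a p) (stripShift a p') = connF γ γ' p p' := by
  simp [connF, stripShift]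

/-- The set of connected pairs. -/
def edgeSet (γ γ' β : ℝ) : Set (Strip × Strip) := {q | connF γ γ' q.1 q.2 ≤ β}

lemma measurableSet_edgeSet (hγ : 0 < γ) (hγ' : 0 < γ') : MeasurableSet (edgeSet γ γ' β) :=
  (isClosed_le (continuous_connF hγ hγ') continuous_const).measurableSet

lemma connF_le_iff {p p' : Strip} (hp : 0 < (p.2 : ℝ)) (hp' : 0 < (p'.2 : ℝ)) :
    connF γ γ' p p' ≤ β ↔ |p.1 - p'.1| ≤ β * (p.2 : ℝ) ^ (-γ) * (p'.2 : ℝ) ^ (-γ') := by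
  have h1 := Real.rpow_pos_of_pos hp γ
  have h2 := Real.rpow_pos_of_pos hp' γ'
  rw [connF, Real.rpow_neg hp.le, Real.rpow_neg hp'.le, mul_assoc, mul_assoc, ← mul_inv,
    ← div_eq_mul_inv, le_div_iff₀ (by positivity)]

lemma measurableSet_nbhd (hγ : 0 < γ) (hγ' : 0 < γ') (p : Strip) :
    MeasurableSet (nbhd γ γ' β p) :=
  (measurableSet_edgeSet (β := β) hγ hγ').preimage (measurable_prodMk_left (x := p))

/-- Integrals of functions of the mark over a neighborhood. -/
lemma lintegral_nbhd (hγ : 0 < γ) (hγ' : 0 < γ') (hβ : 0 < β) {p : Strip} (hp : 0 < (p.2 : ℝ))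
    {h : unitInterval → ℝ≥0∞} (hh : Measurable h) :
    ∫⁻ p' in nbhd γ γ' β p, h p'.2 =
      ENNReal.ofReal (2 * β) * markPow γ p.2 * ∫⁻ w, h w * markPow γ' w := by
  have hN := measurableSet_nbhd (β := β) hγ hγ' p
  rw [← lintegral_indicator hN]
  change ∫⁻ q, _ ∂((volume : Measure ℝ).prod (volume : Measure unitInterval)) = _
  rw [lintegral_prod_symm _ (Measurable.aemeasurable (Measurable.indicator (by fun_prop) hN)),
    ← lintegral_const_mul _ (by fun_prop)]
  refine lintegral_congr_ae ?_
  filter_upwards [ae_mark_pos] with w hw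
  -- For a fixed second mark the admissible locations form an interval of length `2β u^(-γ)
  -- w^(-γ')`, which factors in the marks.
  have hset : {z : ℝ | (z, w) ∈ nbhd γ γ' β p} =
      Set.Icc (p.1 - β * (p.2 : ℝ) ^ (-γ) * (w : ℝ) ^ (-γ'))
        (p.1 + β * (p.2 : ℝ) ^ (-γ) * (w : ℝ) ^ (-γ')) := by
    ext z
    change connF γ γ' p (z, w) ≤ β ↔ _
    rw [connF_le_iff hp hw, abs_le, Set.mem_Icc]
    constructor <;> rintro ⟨h1, h2⟩ <;> constructor <;> linarith
  have hm : MeasurableSet {z : ℝ | (z, w) ∈ nbhd γ γ' β p} := by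
    rw [hset]; exact measurableSet_Icc
  have hind : ∀ z : ℝ, (nbhd γ γ' β p).indicator (fun p' ↦ h p'.2) (z, w) =
      {z : ℝ | (z, w) ∈ nbhd γ γ' β p}.indicator (fun _ ↦ h w) z := fun z ↦ rfl
  simp_rw [hind]
  rw [lintegral_indicator_const hm, hset, Real.volume_Icc, markPow, markPow]
  have h1 := Real.rpow_nonneg hp.le (-γ)
  have h2 := Real.rpow_nonneg hw.le (-γ')
  have e : p.1 + β * (p.2 : ℝ) ^ (-γ) * (w : ℝ) ^ (-γ') -
      (p.1 - β * (p.2 : ℝ) ^ (-γ) * (w : ℝ) ^ (-γ')) =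
      2 * β * (p.2 : ℝ) ^ (-γ) * (w : ℝ) ^ (-γ') := by ring
  rw [e, ENNReal.ofReal_mul (by positivity), ENNReal.ofReal_mul (by positivity)]
  ring

lemma volume_nbhd (hγ : 0 < γ) (hγ' : 0 < γ') (hβ : 0 < β) {p : Strip} (hp : 0 < (p.2 : ℝ)) :
    volume (nbhd γ γ' β p) = ENNReal.ofReal (2 * β) * markPow γ p.2 * markInt γ' := by
  have := lintegral_nbhd hγ hγ' hβ hp (h := fun _ ↦ 1) measurable_const
  simpa [markInt] using this

/-- The level set of the connection function has measure zero. -/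
lemma volume_connF_eq (hγ : 0 < γ) (hγ' : 0 < γ') (hβ : 0 < β) (p : Strip) :
    volume {p' | connF γ γ' p p' = β} = 0 := by
  have hm : MeasurableSet {p' | connF γ γ' p p' = β} :=
    (isClosed_eq ((continuous_connF hγ hγ').comp (Continuous.prodMk_right p))
      continuous_const).measurableSet
  change ((volume : Measure ℝ).prod (volume : Measure unitInterval)) _ = 0
  rw [Measure.prod_apply_symm hm, lintegral_eq_zero_iff (measurable_measure_prodMk_right hm)]
  refine ae_of_all _ fun w ↦ ?_
  -- For a fixed mark at most two locations lie on the level set.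
  refine (Set.Finite.subset (Set.toFinite
    {p.1 - β / ((p.2 : ℝ) ^ γ * (w : ℝ) ^ γ'), p.1 + β / ((p.2 : ℝ) ^ γ * (w : ℝ) ^ γ')})
    fun z hz ↦ ?_).measure_zero _
  have hz' : |p.1 - z| * (p.2 : ℝ) ^ γ * (w : ℝ) ^ γ' = β := hz
  have h0 : (p.2 : ℝ) ^ γ * (w : ℝ) ^ γ' ≠ 0 := by
    intro h
    rw [mul_assoc, h, mul_zero] at hz'
    exact hβ.ne hz'
  have h1 : |p.1 - z| = β / ((p.2 : ℝ) ^ γ * (w : ℝ) ^ γ') := by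
    rw [eq_div_iff h0, ← hz', mul_assoc]
  rcases abs_choice (p.1 - z) with h2 | h2
  · left; linarith
  · right; rw [Set.mem_singleton_iff]; linarith

end Geometry

/-! ### Multiples of Lebesgue measure on the strip -/

/-- A multiple of Lebesgue measure on the strip. -/
noncomputable abbrev stripMeasure (l : ℝ) : Measure Strip := ENNReal.ofReal l • volume

instance isLocallyFiniteMeasure_stripMeasure (l : ℝ) : IsLocallyFiniteMeasure (stripMeasure l) :=
  inferInstanceAs (IsLocallyFiniteMeasure (l.toNNReal • (volume : Measure Strip)))

lemma shiftInvariant_stripMeasure (l : ℝ) : ShiftInvariant (stripMeasure l) := by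
  intro a
  refine MeasurePreserving.smul_measure ?_ _
  exact (measurePreserving_add_right volume a).prod (MeasurePreserving.id volume)

lemma setLIntegral_stripMeasure (l : ℝ) (I : Set ℝ) {f : unitInterval → ℝ≥0∞}
    (hf : Measurable f) :
    ∫⁻ p in {p : Strip | p.1 ∈ I}, f p.2 ∂(stripMeasure l) =
      ENNReal.ofReal l * volume I * ∫⁻ u, f u := by
  rw [stripMeasure, Measure.restrict_smul, lintegral_smul_measure, smul_eq_mul, mul_assoc]
  congr 1
  have h1 : {p : Strip | p.1 ∈ I} = I ×ˢ Set.univ := by ext; simp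
  change ∫⁻ p in _, f p.2 ∂((volume : Measure ℝ).prod (volume : Measure unitInterval)) = _
  rw [h1, ← Measure.prod_restrict, Measure.restrict_univ]
  rw [lintegral_prod _ (by fun_prop)]
  simp [mul_comm]

lemma ae_stripMeasure_mark_pos (l : ℝ) : ∀ᵐ p ∂(stripMeasure l), 0 < (p.2 : ℝ) := by
  refine Measure.ae_smul_measure ?_ _
  change ∀ᵐ p ∂((volume : Measure ℝ).prod (volume : Measure unitInterval)), _
  exact Measure.quasiMeasurePreserving_snd.ae ae_mark_pos

lemma stripMeasure_fst_mem_countable (l : ℝ) {F : Set ℝ} (hF : F.Countable) :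
    stripMeasure l {p | p.1 ∈ F} = 0 := by
  have := setLIntegral_stripMeasure l F (f := fun _ ↦ 1) measurable_const
  simpa [hF.measure_zero] using this

/-! ### Bounds for the variance functional -/

section VarianceBounds

/-- A weight of the mark of the second vertex, which dominates the expected degree. -/
noncomputable def degreeWeight (γ γ' β lam : ℝ) (w : unitInterval) : ℝ≥0∞ :=
  1 + ENNReal.ofReal lam * (ENNReal.ofReal (2 * β) * markInt γ) * markPow γ' w

@[fun_prop]
lemma measurable_degreeWeight (γ γ' β lam : ℝ) : Measurable (degreeWeight γ γ' β lam) := by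
  unfold degreeWeight
  fun_prop

/-- The weighted measure of the section of `D`. -/
noncomputable def sectionWeight (γ γ' β lam lam' : ℝ) (D : Set (Strip × Strip)) (p : Strip) :
    ℝ≥0∞ :=
  ∫⁻ p' in Prod.mk p ⁻¹' D, degreeWeight γ γ' β lam p'.2 ∂(stripMeasure lam')

variable {γ γ' β lam lam' : ℝ}

lemma stripMeasure_section_le (hγ : 0 < γ) (hγ' : 0 < γ') (hβ : 0 < β) {D : Set (Strip × Strip)}
    (hD : D ⊆ edgeSet γ γ' β) {p' : Strip} (hp' : 0 < (p'.2 : ℝ)) :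
    stripMeasure lam ((fun p ↦ (p, p')) ⁻¹' D) ≤
      ENNReal.ofReal lam * (ENNReal.ofReal (2 * β) * markInt γ) * markPow γ' p'.2 := by
  have h1 : (fun p ↦ (p, p')) ⁻¹' D ⊆ nbhd γ' γ β p' := fun p hp ↦ by
    have : connF γ γ' p p' ≤ β := hD hp
    rwa [connF_symm] at this
  refine (measure_mono h1).trans (le_of_eq ?_)
  rw [Measure.smul_apply, volume_nbhd hγ' hγ hβ hp', smul_eq_mul]
  ring

/-- In `ν(D^{p'})²` one factor is bounded by the full mean degree of `p'`. The last two terms of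
`varBound` then combine into the integral over `D` of `degreeWeight`. The bound becomes an integral
over the first vertex, which can be split by location. -/
lemma varBound_le (hγ : 0 < γ) (hγ' : 0 < γ') (hβ : 0 < β) {D : Set (Strip × Strip)}
    (hDm : MeasurableSet D) (hD : D ⊆ edgeSet γ γ' β) (θ : ℝ) :
    varBound (stripMeasure lam) (stripMeasure lam') θ D ≤
      ∫⁻ p, (ENNReal.ofReal (θ ^ 2) * sectionWeight γ γ' β lam lam' D p ^ 2 +
        sectionWeight γ γ' β lam lam' D p) ∂(stripMeasure lam) := by
  have hmeasI : Measurable fun q : Strip × Strip ↦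
      D.indicator (fun q ↦ degreeWeight γ γ' β lam q.2.2) q :=
    Measurable.indicator (by fun_prop) hDm
  have hsec : ∀ p, sectionWeight γ γ' β lam lam' D p =
      ∫⁻ p', D.indicator (fun q ↦ degreeWeight γ γ' β lam q.2.2) (p, p') ∂(stripMeasure lam') := by
    intro p
    rw [sectionWeight, ← lintegral_indicator (hDm.preimage measurable_prodMk_left)]
    rfl
  have hsm : Measurable (sectionWeight γ γ' β lam lam' D) := by
    rw [funext hsec]
    exact hmeasI.lintegral_prod_right'
  rw [lintegral_add_right _ hsm, varBound, add_assoc,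
    lintegral_const_mul _ (hsm.pow_const 2)]
  refine add_le_add ?_ ?_
  · gcongr with p
    rw [sectionWeight]
    calc stripMeasure lam' (Prod.mk p ⁻¹' D)
        = ∫⁻ p' in Prod.mk p ⁻¹' D, 1 ∂(stripMeasure lam') := by
          simp
      _ ≤ _ := lintegral_mono fun p' ↦ le_self_add
  · simp_rw [hsec]
    rw [lintegral_lintegral_swap hmeasI.aemeasurable, Measure.prod_apply_symm hDm,
      ← lintegral_add_right _ (measurable_measure_prodMk_right hDm)]
    refine lintegral_mono_ae ?_
    filter_upwards [ae_stripMeasure_mark_pos lam'] with p' hp'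
    have h1 : ∀ p, D.indicator (fun q ↦ degreeWeight γ γ' β lam q.2.2) (p, p') =
        ((fun p ↦ (p, p')) ⁻¹' D).indicator (fun _ ↦ degreeWeight γ γ' β lam p'.2) p := fun p ↦ rfl
    simp_rw [h1]
    rw [lintegral_indicator_const (hDm.preimage measurable_prodMk_right), degreeWeight, add_mul,
      one_mul, add_comm, sq]
    gcongr
    exact stripMeasure_section_le hγ hγ' hβ hD hp'

/-- The constant in the bound for `sectionWeight`. -/
noncomputable def sectionConst (γ γ' β lam lam' δ : ℝ) : ℝ≥0∞ :=
  ENNReal.ofReal lam' * (ENNReal.ofReal (2 * β) * ENNReal.ofReal (β ^ δ) *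
    ∫⁻ w, degreeWeight γ γ' β lam w * markPow (γ' * (1 + δ)) w)

/-- The worst singularity of the integrand is `w^(-γ'(2+δ))`: one power `γ'` from the degree weight,
one from the length of the neighborhood and `δ` of them from the Markov factor. -/
lemma sectionConst_ne_top (hγ1 : γ < 1) (hγ' : 0 < γ') {δ : ℝ} (hδ : γ' * (2 + δ) < 1) :
    sectionConst γ γ' β lam lam' δ ≠ ∞ := by
  have h1 : ∫⁻ w, degreeWeight γ γ' β lam w * markPow (γ' * (1 + δ)) w =
      markInt (γ' * (1 + δ)) + ENNReal.ofReal lam * (ENNReal.ofReal (2 * β) * markInt γ) *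
        markInt (γ' * (2 + δ)) := by
    rw [markInt, markInt, markInt, ← lintegral_const_mul _ (by fun_prop),
      ← lintegral_add_left (by fun_prop)]
    refine lintegral_congr_ae ?_
    filter_upwards [ae_mark_pos] with w hw
    rw [degreeWeight, add_mul, one_mul, mul_assoc, markPow_add hw, markInt]
    ring_nf
  have h2 : markInt (γ' * (1 + δ)) ≠ ∞ := markInt_ne_top (by nlinarith)
  have h3 : markInt (γ' * (2 + δ)) ≠ ∞ := markInt_ne_top hδ
  have h4 : markInt γ ≠ ∞ := markInt_ne_top hγ1
  rw [sectionConst, h1]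
  finiteness

lemma sectionWeight_le (hγ : 0 < γ) (hγ' : 0 < γ') (hβ : 0 < β) {D : Set (Strip × Strip)}
    (hDm : MeasurableSet D)
    (hD : D ⊆ edgeSet γ γ' β) {κ δ : ℝ} (hκ : 0 ≤ κ) {p : Strip} (hp : 0 < (p.2 : ℝ))
    (h : ∀ p', (p, p') ∈ D → 0 < (p'.2 : ℝ) →
      1 ≤ κ * (β * (p.2 : ℝ) ^ (-γ) * (p'.2 : ℝ) ^ (-γ')) ^ δ) :
    sectionWeight γ γ' β lam lam' D p ≤
      ENNReal.ofReal κ * sectionConst γ γ' β lam lam' δ * markPow (γ * (1 + δ)) p.2 := by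
  have hsub : Prod.mk p ⁻¹' D ⊆ nbhd γ γ' β p := fun p' hp' ↦ hD hp'
  have hA : MeasurableSet (Prod.mk p ⁻¹' D) := hDm.preimage measurable_prodMk_left
  set g : unitInterval → ℝ≥0∞ := fun w ↦ degreeWeight γ γ' β lam w *
    (ENNReal.ofReal κ * ENNReal.ofReal (β ^ δ) * markPow (γ * δ) p.2 * markPow (γ' * δ) w) with hg
  have hgm : Measurable g := by fun_prop
  have h1 : sectionWeight γ γ' β lam lam' D p ≤
      ∫⁻ p' in nbhd γ γ' β p, g p'.2 ∂(stripMeasure lam') := by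
    refine le_trans ?_ (lintegral_mono_set hsub)
    refine lintegral_mono_ae ?_
    filter_upwards [ae_restrict_mem hA,
      ae_restrict_of_ae (ae_stripMeasure_mark_pos lam')] with p' hp' hw
    have h2 := h p' hp' hw
    have e : κ * (β * (p.2 : ℝ) ^ (-γ) * (p'.2 : ℝ) ^ (-γ')) ^ δ =
        κ * β ^ δ * (p.2 : ℝ) ^ (-(γ * δ)) * (p'.2 : ℝ) ^ (-(γ' * δ)) := by
      rw [Real.mul_rpow (by positivity) (by positivity), Real.mul_rpow hβ.le (by positivity),
        ← Real.rpow_mul hp.le, ← Real.rpow_mul hw.le]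
      ring_nf
    rw [e] at h2
    have h3 : (1 : ℝ≥0∞) ≤ ENNReal.ofReal κ * ENNReal.ofReal (β ^ δ) * markPow (γ * δ) p.2 *
        markPow (γ' * δ) p'.2 := by
      rw [markPow, markPow, ← ENNReal.ofReal_mul hκ, ← ENNReal.ofReal_mul (by positivity),
        ← ENNReal.ofReal_mul (by positivity), ← ENNReal.ofReal_one]
      exact ENNReal.ofReal_le_ofReal h2
    calc degreeWeight γ γ' β lam p'.2 = degreeWeight γ γ' β lam p'.2 * 1 := (mul_one _).symm
      _ ≤ _ := mul_le_mul' le_rfl h3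
  refine h1.trans (le_of_eq ?_)
  rw [stripMeasure, Measure.restrict_smul, lintegral_smul_measure, smul_eq_mul,
    lintegral_nbhd hγ hγ' hβ hp hgm, sectionConst]
  have h4 : ∫⁻ w, g w * markPow γ' w = ENNReal.ofReal κ * ENNReal.ofReal (β ^ δ) *
      markPow (γ * δ) p.2 * ∫⁻ w, degreeWeight γ γ' β lam w * markPow (γ' * (1 + δ)) w := by
    rw [← lintegral_const_mul _ (by fun_prop)]
    refine lintegral_congr_ae ?_
    filter_upwards [ae_mark_pos] with w hw
    rw [mul_add, mul_one, ← markPow_add hw, hg]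
    ring
  have h5 : markPow (γ * (1 + δ)) p.2 = markPow γ p.2 * markPow (γ * δ) p.2 := by
    rw [markPow_add hp]
    ring_nf
  rw [h4, h5]
  ring

/-- The bound for the variance per unit length. -/
noncomputable def varRate (γ γ' β lam lam' θ κ δ : ℝ) : ℝ≥0∞ :=
  ENNReal.ofReal (θ ^ 2) * ((ENNReal.ofReal κ * sectionConst γ γ' β lam lam' δ) ^ 2 *
    markInt (2 * (γ * (1 + δ)))) +
    ENNReal.ofReal κ * sectionConst γ γ' β lam lam' δ * markInt (γ * (1 + δ))

lemma setLIntegral_sectionWeight_le (hγ : 0 < γ) (hγ' : 0 < γ') (hβ : 0 < β)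
    {D : Set (Strip × Strip)} (hDm : MeasurableSet D)
    (hD : D ⊆ edgeSet γ γ' β) {κ δ : ℝ} (hκ : 0 ≤ κ) (θ : ℝ) {I : Set ℝ} (hI : MeasurableSet I)
    (h : ∀ q ∈ D, q.1.1 ∈ I → 0 < (q.1.2 : ℝ) → 0 < (q.2.2 : ℝ) →
      1 ≤ κ * (β * (q.1.2 : ℝ) ^ (-γ) * (q.2.2 : ℝ) ^ (-γ')) ^ δ) :
    ∫⁻ p in {p : Strip | p.1 ∈ I}, (ENNReal.ofReal (θ ^ 2) *
      sectionWeight γ γ' β lam lam' D p ^ 2 + sectionWeight γ γ' β lam lam' D p)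
        ∂(stripMeasure lam) ≤
      ENNReal.ofReal lam * volume I * varRate γ γ' β lam lam' θ κ δ := by
  set K := ENNReal.ofReal κ * sectionConst γ γ' β lam lam' δ with hK
  have h1 := setLIntegral_stripMeasure lam I (f := fun u ↦ ENNReal.ofReal (θ ^ 2) *
    (K ^ 2 * markPow (2 * (γ * (1 + δ))) u) + K * markPow (γ * (1 + δ)) u) (by fun_prop)
  have h2 : ∫⁻ u, (ENNReal.ofReal (θ ^ 2) *
      (K ^ 2 * markPow (2 * (γ * (1 + δ))) u) + K * markPow (γ * (1 + δ)) u) =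
      varRate γ γ' β lam lam' θ κ δ := by
    rw [lintegral_add_left (by fun_prop), lintegral_const_mul _ (by fun_prop),
      lintegral_const_mul _ (by fun_prop), lintegral_const_mul _ (by fun_prop)]
    rfl
  rw [h2] at h1
  rw [← h1]
  have hIm : MeasurableSet {p : Strip | p.1 ∈ I} := measurable_fst hI
  refine lintegral_mono_ae ?_
  filter_upwards [ae_restrict_mem hIm,
    ae_restrict_of_ae (ae_stripMeasure_mark_pos lam)] with p hpI hp
  have h3 := sectionWeight_le (lam := lam) (lam' := lam') hγ hγ' hβ hDm hD hκ (δ := δ) hp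
    fun p' hp' hw ↦ h (p, p') hp' hpI hp hw
  have h4 : markPow (2 * (γ * (1 + δ))) p.2 = markPow (γ * (1 + δ)) p.2 ^ 2 := by
    rw [sq, markPow_add hp]
    ring_nf
  rw [h4, ← mul_pow]
  gcongr

lemma sectionWeight_eq_zero {D : Set (Strip × Strip)} {p : Strip}
    (h : ∀ p', (p, p') ∉ D) : sectionWeight γ γ' β lam lam' D p = 0 := by
  have : Prod.mk p ⁻¹' D = ∅ := Set.eq_empty_of_forall_notMem h
  rw [sectionWeight, this]
  simp

/-- Variance bound for a set of pairs that is split according to the location of the first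
vertex. -/
lemma varBound_le_of_subset (hγ : 0 < γ) (hγ' : 0 < γ') (hβ : 0 < β)
    {D : Set (Strip × Strip)} (hDm : MeasurableSet D)
    (hD : D ⊆ edgeSet γ γ' β) {κ δ : ℝ} (hκ : 0 ≤ κ) (θ : ℝ) {I J : Set ℝ} (hI : MeasurableSet I)
    (hJ : MeasurableSet J) (hIJ : ∀ q ∈ D, q.1.1 ∈ I ∪ J)
    (h : ∀ q ∈ D, q.1.1 ∈ I → 0 < (q.1.2 : ℝ) → 0 < (q.2.2 : ℝ) →
      1 ≤ κ * (β * (q.1.2 : ℝ) ^ (-γ) * (q.2.2 : ℝ) ^ (-γ')) ^ δ) :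
    varBound (stripMeasure lam) (stripMeasure lam') θ D ≤
      ENNReal.ofReal lam * volume I * varRate γ γ' β lam lam' θ κ δ +
      ENNReal.ofReal lam * volume J * varRate γ γ' β lam lam' θ 1 0 := by
  refine (varBound_le hγ hγ' hβ hDm hD θ).trans ?_
  have hU : MeasurableSet {p : Strip | p.1 ∈ I ∪ J} := measurable_fst (hI.union hJ)
  rw [← setLIntegral_eq_of_support_subset (s := {p : Strip | p.1 ∈ I ∪ J})]
  · have e : {p : Strip | p.1 ∈ I ∪ J} = {p : Strip | p.1 ∈ I} ∪ {p : Strip | p.1 ∈ J} := rfl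
    rw [e]
    refine (lintegral_union_le _ _ _).trans (add_le_add ?_ ?_)
    · exact setLIntegral_sectionWeight_le hγ hγ' hβ hDm hD hκ θ hI h
    -- With `κ = 1` and `δ = 0` the Markov factor is `1`, so no information on `D` is needed over
    -- `J`.
    · exact setLIntegral_sectionWeight_le hγ hγ' hβ hDm hD zero_le_one θ hJ
        fun q _ _ _ _ ↦ by simp
  · intro p hp
    by_contra hpU
    refine hp ?_
    have := sectionWeight_eq_zero (γ := γ) (γ' := γ') (β := β) (lam := lam) (lam' := lam')
      (D := D) (p := p) fun p' hp' ↦ hpU (hIJ _ hp')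
    simp [this]

end VarianceBounds

/-! ### Sets of edges with prescribed locations -/

section EdgeSets

variable {γ γ' β lam lam' : ℝ}

/-- If membership in `T` is locally constant away from integer locations, the boundary of
`edgeSet ∩ T` is a null set. -/
lemma prod_edgeSet_inter_diff_interior (hγ : 0 < γ) (hγ' : 0 < γ') (hβ : 0 < β)
    {T : Set (Strip × Strip)} (hT : ∀ q ∈ T, q.1.1 ∉ Set.range ((↑) : ℤ → ℝ) →
      q.2.1 ∉ Set.range ((↑) : ℤ → ℝ) → T ∈ 𝓝 q) :
    ((stripMeasure lam).prod (stripMeasure lam'))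
      ((edgeSet γ γ' β ∩ T) \ interior (edgeSet γ γ' β ∩ T)) = 0 := by
  have hc := continuous_connF hγ hγ'
  have hZ : (Set.range ((↑) : ℤ → ℝ)).Countable := Set.countable_range _
  have h1 : ((stripMeasure lam).prod (stripMeasure lam')) {q | connF γ γ' q.1 q.2 = β} = 0 := by
    rw [Measure.measure_prod_null (isClosed_eq hc continuous_const).measurableSet]
    refine ae_of_all _ fun p ↦ ?_
    change stripMeasure lam' {p' | connF γ γ' p p' = β} = 0
    rw [Measure.smul_apply, volume_connF_eq hγ hγ' hβ p, smul_zero]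
  have h2 : ((stripMeasure lam).prod (stripMeasure lam'))
      {q | q.1.1 ∈ Set.range ((↑) : ℤ → ℝ)} = 0 :=
    Measure.quasiMeasurePreserving_fst.preimage_null
      (stripMeasure_fst_mem_countable lam hZ)
  have h3 : ((stripMeasure lam).prod (stripMeasure lam'))
      {q | q.2.1 ∈ Set.range ((↑) : ℤ → ℝ)} = 0 :=
    Measure.quasiMeasurePreserving_snd.preimage_null
      (stripMeasure_fst_mem_countable lam' hZ)
  refine measure_mono_null (t := {q | connF γ γ' q.1 q.2 = β} ∪
    ({q | q.1.1 ∈ Set.range ((↑) : ℤ → ℝ)} ∪ {q | q.2.1 ∈ Set.range ((↑) : ℤ → ℝ)})) ?_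
    (measure_union_null h1 (measure_union_null h2 h3))
  rintro q ⟨⟨hq1, hq2⟩, hq3⟩
  by_contra hq
  have hq4 : connF γ γ' q.1 q.2 ≠ β := fun h ↦ hq (Or.inl h)
  have hq5 : q.1.1 ∉ Set.range ((↑) : ℤ → ℝ) := fun h ↦ hq (Or.inr (Or.inl h))
  have hq6 : q.2.1 ∉ Set.range ((↑) : ℤ → ℝ) := fun h ↦ hq (Or.inr (Or.inr h))
  -- Off the level set the edge condition is a strict inequality, hence open; off the integer
  -- locations `T` is a neighborhood.
  refine hq3 (mem_interior_iff_mem_nhds.2 (inter_mem ?_ (hT q hq2 hq5 hq6)))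
  have hlt : connF γ γ' q.1 q.2 < β := lt_of_le_of_ne hq1 hq4
  filter_upwards [hc.continuousAt.eventually_lt_const hlt] with r hr using hr.le

/-- The edges whose first endpoint has location in `[0, n]`. -/
def windowEdges (γ γ' β : ℝ) (n : ℕ) : Set (Strip × Strip) :=
  edgeSet γ γ' β ∩ {q | q.1.1 ∈ Set.Icc (0 : ℝ) n}

lemma measurableSet_windowEdges (hγ : 0 < γ) (hγ' : 0 < γ') (n : ℕ) :
    MeasurableSet (windowEdges γ γ' β n) :=
  (measurableSet_edgeSet hγ hγ').inter
    ((measurable_fst.comp measurable_fst) measurableSet_Icc)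

lemma edgeCount_eq_pairCount {Ω : Type*} [MeasurableSpace Ω] {μ : Measure Ω}
    {P P' : Ω → Set Strip} {ν' : Measure Strip} (hP' : IsPoissonProcess P' ν' μ)
    (hγ : 0 < γ) (hγ' : 0 < γ') (n : ℕ) (ω : Ω) :
    edgeCount γ γ' β P P' n ω = pairCount (P ω) (P' ω) (windowEdges γ γ' β n) := by
  have := hP'.countable ω
  rw [pairCount, Measure.prod_apply (measurableSet_windowEdges hγ hγ' n), lintegral_pointMeasure,
    edgeCount]
  have h1 : ∀ p : Strip, pointMeasure (P' ω) (Prod.mk p ⁻¹' windowEdges γ γ' β n) =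
      (window n).indicator (fun p ↦ (bipDegree γ γ' β (P' ω) p : ℝ≥0∞)) p := by
    intro p
    by_cases hp : p ∈ window n
    · rw [Set.indicator_of_mem hp, bipDegree, ← pointMeasure_apply _ (measurableSet_nbhd hγ hγ' p)]
      congr 1
      ext p'
      exact ⟨fun h ↦ h.1, fun h ↦ ⟨h, hp⟩⟩
    · rw [Set.indicator_of_notMem hp]
      have : Prod.mk p ⁻¹' windowEdges γ γ' β n = ∅ :=
        Set.eq_empty_of_forall_notMem fun p' h ↦ hp h.2
      rw [this, measure_empty]
  simp_rw [h1]
  rw [tsum_subtype (P ω) ((window n).indicator fun p ↦ (bipDegree γ γ' β (P' ω) p : ℝ≥0∞)),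
    tsum_subtype (P ω ∩ window n) fun p ↦ (bipDegree γ γ' β (P' ω) p : ℝ≥0∞),
    Set.indicator_indicator]

lemma mem_nhds_preimage_fst {I : Set ℝ} {q : Strip × Strip} (h : I ∈ 𝓝 q.1.1) :
    {q : Strip × Strip | q.1.1 ∈ I} ∈ 𝓝 q :=
  (continuous_fst.comp continuous_fst).continuousAt.preimage_mem_nhds h

lemma mem_nhds_preimage_snd {I : Set ℝ} {q : Strip × Strip} (h : I ∈ 𝓝 q.2.1) :
    {q : Strip × Strip | q.2.1 ∈ I} ∈ 𝓝 q :=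
  (continuous_fst.comp continuous_snd).continuousAt.preimage_mem_nhds h

lemma natCast_ne_of_notMem_range {x : ℝ} (hx : x ∉ Set.range ((↑) : ℤ → ℝ)) (a : ℕ) :
    x ≠ a := fun h ↦ hx ⟨a, by simp [h]⟩

lemma Icc_mem_nhds_of_notMem_range {x : ℝ} (hx : x ∉ Set.range ((↑) : ℤ → ℝ)) {n : ℕ}
    (h : x ∈ Set.Icc (0 : ℝ) n) : Set.Icc (0 : ℝ) n ∈ 𝓝 x :=
  Icc_mem_nhds (lt_of_le_of_ne h.1 (by simpa using (natCast_ne_of_notMem_range hx 0).symm))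
    (lt_of_le_of_ne h.2 (natCast_ne_of_notMem_range hx n))

lemma Ico_mem_nhds_of_notMem_range {x : ℝ} (hx : x ∉ Set.range ((↑) : ℤ → ℝ)) {a b : ℕ}
    (h : x ∈ Set.Ico (a : ℝ) b) : Set.Ico (a : ℝ) b ∈ 𝓝 x :=
  Ico_mem_nhds (lt_of_le_of_ne h.1 (natCast_ne_of_notMem_range hx a).symm) h.2

lemma compl_Ico_mem_nhds_of_notMem_range {x : ℝ} (hx : x ∉ Set.range ((↑) : ℤ → ℝ)) {a b : ℕ}
    (h : x ∉ Set.Ico (a : ℝ) b) : (Set.Ico (a : ℝ) b)ᶜ ∈ 𝓝 x := by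
  rcases lt_or_ge x a with h1 | h1
  · exact mem_of_superset (Iio_mem_nhds h1) fun y hy hy' ↦ not_lt.2 hy'.1 hy
  · have h2 : (b : ℝ) ≤ x := by
      by_contra h3
      exact h ⟨h1, not_le.1 h3⟩
    have h3 : (b : ℝ) < x := lt_of_le_of_ne h2 (natCast_ne_of_notMem_range hx b).symm
    exact mem_of_superset (Ioi_mem_nhds h3) fun y hy hy' ↦ not_lt.2 (le_of_lt hy) hy'.2

lemma null_boundary_windowEdges (hγ : 0 < γ) (hγ' : 0 < γ') (hβ : 0 < β) (n : ℕ) :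
    ((stripMeasure lam).prod (stripMeasure lam'))
      (windowEdges γ γ' β n \ interior (windowEdges γ γ' β n)) = 0 :=
  prod_edgeSet_inter_diff_interior hγ hγ' hβ fun _ hq hx _ ↦
    mem_nhds_preimage_fst (Icc_mem_nhds_of_notMem_range hx hq)

lemma blockSet_eq_inter (E : Set (Strip × Strip)) (a b : ℝ) :
    blockSet E a b = E ∩ {q | q.1.1 ∈ Set.Ico a b ∧ q.2.1 ∈ Set.Ico a b} := rfl

lemma measurableSet_locations (a b : ℝ) :
    MeasurableSet {q : Strip × Strip | q.1.1 ∈ Set.Ico a b ∧ q.2.1 ∈ Set.Ico a b} :=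
  ((measurable_fst.comp measurable_fst) measurableSet_Ico).inter
    ((measurable_fst.comp measurable_snd) measurableSet_Ico)

lemma measurableSet_blockSet (hγ : 0 < γ) (hγ' : 0 < γ') (a b : ℝ) :
    MeasurableSet (blockSet (edgeSet γ γ' β) a b) :=
  (measurableSet_edgeSet hγ hγ').inter (measurableSet_locations a b)

lemma null_boundary_blockSet (hγ : 0 < γ) (hγ' : 0 < γ') (hβ : 0 < β) (a b : ℕ) :
    ((stripMeasure lam).prod (stripMeasure lam')) (blockSet (edgeSet γ γ' β) a b \
      interior (blockSet (edgeSet γ γ' β) a b)) = 0 :=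
  prod_edgeSet_inter_diff_interior hγ hγ' hβ fun _ hq hx hz ↦
    inter_mem (mem_nhds_preimage_fst (Ico_mem_nhds_of_notMem_range hx hq.1))
      (mem_nhds_preimage_snd (Ico_mem_nhds_of_notMem_range hz hq.2))

/-- The edges in the window that do not have both endpoints in one of the first `n / L` blocks of
length `L`. -/
def crossEdges (γ γ' β : ℝ) (L n : ℕ) : Set (Strip × Strip) :=
  windowEdges γ γ' β n \
    ⋃ j ∈ Finset.range (n / L), blockSet (edgeSet γ γ' β) (j * L : ℕ) (j * L + L : ℕ)

lemma measurableSet_crossEdges (hγ : 0 < γ) (hγ' : 0 < γ') (L n : ℕ) :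
    MeasurableSet (crossEdges γ γ' β L n) :=
  (measurableSet_windowEdges hγ hγ' n).diff
    (Finset.measurableSet_biUnion _ fun _ _ ↦ measurableSet_blockSet hγ hγ' _ _)

lemma null_boundary_crossEdges (hγ : 0 < γ) (hγ' : 0 < γ') (hβ : 0 < β) (L n : ℕ) :
    ((stripMeasure lam).prod (stripMeasure lam')) (crossEdges γ γ' β L n \
      interior (crossEdges γ γ' β L n)) = 0 := by
  -- Inside `edgeSet` the removal of the blocks is a condition on the two locations only, with
  -- thresholds at integers.
  have e : crossEdges γ γ' β L n = edgeSet γ γ' β ∩ ({q | q.1.1 ∈ Set.Icc (0 : ℝ) n} ∩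
      ⋂ j ∈ Finset.range (n / L), {q | q.1.1 ∈ (Set.Ico ((j * L : ℕ) : ℝ) (j * L + L : ℕ))ᶜ} ∪
        {q | q.2.1 ∈ (Set.Ico ((j * L : ℕ) : ℝ) (j * L + L : ℕ))ᶜ}) := by
    ext q
    simp only [crossEdges, windowEdges, blockSet_eq_inter, Set.mem_sdiff, Set.mem_inter_iff,
      Set.mem_iUnion, Set.mem_iInter, Set.mem_union, Set.mem_ofPred_eq, Set.mem_compl_iff,
      exists_prop, not_exists, not_and, and_assoc]
    constructor
    · rintro ⟨h1, h2, h3⟩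
      exact ⟨h1, h2, fun j hj ↦ or_iff_not_imp_left.2 fun h4 ↦ h3 j hj h1 (not_not.1 h4)⟩
    · rintro ⟨h1, h2, h3⟩
      exact ⟨h1, h2, fun j hj _ h4 h5 ↦ (h3 j hj).elim (fun h ↦ h h4) fun h ↦ h h5⟩
  rw [e]
  refine prod_edgeSet_inter_diff_interior hγ hγ' hβ fun q hq hx hz ↦ inter_mem
    (mem_nhds_preimage_fst (Icc_mem_nhds_of_notMem_range hx hq.1))
    ((biInter_finset_mem _).2 fun j hj ↦ ?_)
  rcases Set.mem_iInter₂.1 hq.2 j hj with h | h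
  · exact mem_of_superset (mem_nhds_preimage_fst (compl_Ico_mem_nhds_of_notMem_range hx h))
      Set.subset_union_left
  · exact mem_of_superset (mem_nhds_preimage_snd (compl_Ico_mem_nhds_of_notMem_range hz h))
      Set.subset_union_right

lemma blockSet_subset_windowEdges {L n j : ℕ} (hj : j ∈ Finset.range (n / L)) :
    blockSet (edgeSet γ γ' β) (j * L : ℕ) (j * L + L : ℕ) ⊆ windowEdges γ γ' β n := by
  rintro q ⟨h1, h2, -⟩
  refine ⟨h1, (Nat.cast_nonneg _).trans h2.1, h2.2.le.trans ?_⟩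
  have h3 : j * L + L ≤ n := by
    have h4 := Finset.mem_range.1 hj
    have h5 : (n / L) * L ≤ n := Nat.div_mul_le_self n L
    nlinarith
  exact_mod_cast h3

lemma pairwiseDisjoint_blockSet (E : Set (Strip × Strip)) (L : ℕ) (s : Set ℕ) :
    s.PairwiseDisjoint fun j ↦ blockSet E (j * L : ℕ) (j * L + L : ℕ) := by
  have key : ∀ i j : ℕ, i < j → Disjoint (blockSet E (i * L : ℕ) (i * L + L : ℕ))
      (blockSet E (j * L : ℕ) (j * L + L : ℕ)) := by
    intro i j hij
    refine Set.disjoint_left.2 ?_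
    rintro q ⟨-, h1, -⟩ ⟨-, h2, -⟩
    have h3 : i * L + L ≤ j * L := by nlinarith
    have h4 : ((i * L + L : ℕ) : ℝ) ≤ (j * L : ℕ) := by exact_mod_cast h3
    exact not_lt.2 (h4.trans h2.1) h1.2
  intro i _ j _ hij
  rcases lt_or_gt_of_ne hij with h | h
  · exact key i j h
  · exact (key j i h).symm

lemma pairCount_windowEdges (hγ : 0 < γ) (hγ' : 0 < γ') (s s' : Set Strip) (L n : ℕ) :
    pairCount s s' (windowEdges γ γ' β n) = pairCount s s' (crossEdges γ γ' β L n) +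
      ∑ j ∈ Finset.range (n / L),
        pairCount s s' (blockSet (edgeSet γ γ' β) (j * L : ℕ) (j * L + L : ℕ)) := by
  have hU : MeasurableSet (⋃ j ∈ Finset.range (n / L),
      blockSet (edgeSet γ γ' β) (j * L : ℕ) (j * L + L : ℕ)) :=
    Finset.measurableSet_biUnion _ fun _ _ ↦ measurableSet_blockSet hγ hγ' _ _
  simp only [pairCount]
  rw [← measure_biUnion_finset (pairwiseDisjoint_blockSet _ L _)
    fun _ _ ↦ measurableSet_blockSet hγ hγ' _ _, crossEdges,
    ← measure_sdiff_add_inter (windowEdges γ γ' β n) hU]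
  congr 2
  exact Set.inter_eq_right.2 (Set.iUnion₂_subset fun j hj ↦ blockSet_subset_windowEdges hj)

/-! ### Variance estimates for sets of edges -/

lemma varBound_windowEdges_le (hγ : 0 < γ) (hγ' : 0 < γ') (hβ : 0 < β) (θ : ℝ) (n : ℕ) :
    varBound (stripMeasure lam) (stripMeasure lam') θ (windowEdges γ γ' β n) ≤
      ENNReal.ofReal lam * n * varRate γ γ' β lam lam' θ 1 0 := by
  have := varBound_le_of_subset (lam := lam) (lam' := lam') hγ hγ' hβ
    (measurableSet_windowEdges hγ hγ' n) Set.inter_subset_left zero_le_one (κ := 1) (δ := 0) θ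
    (I := ∅) (J := Set.Icc (0 : ℝ) n) .empty measurableSet_Icc (fun q hq ↦ Or.inr hq.2) (by simp)
  simpa using this

lemma varBound_mono {ν ν' : Measure Strip} (θ : ℝ) {G G' : Set (Strip × Strip)} (h : G ⊆ G') :
    varBound ν ν' θ G ≤ varBound ν ν' θ G' := by
  unfold varBound
  gcongr

lemma varRate_ne_top (hγ1 : γ < 1) (hγ' : 0 < γ') {θ κ δ : ℝ} (hδ : γ' * (2 + δ) < 1)
    (h1 : γ * (1 + δ) < 1) (hθ : θ = 0 ∨ 2 * (γ * (1 + δ)) < 1) :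
    varRate γ γ' β lam lam' θ κ δ ≠ ∞ := by
  have h2 := sectionConst_ne_top (β := β) (lam := lam) (lam' := lam') hγ1 hγ' hδ
  have h3 := markInt_ne_top h1
  rw [varRate]
  rcases hθ with rfl | hθ
  · simp only [ne_eq, OfNat.ofNat_ne_zero, not_false_eq_true, zero_pow, ENNReal.ofReal_zero,
      zero_mul, zero_add]
    finiteness
  · have h4 := markInt_ne_top hθ
    finiteness

/-- The locations in the window that are close to the boundary of their block. -/
def badLocations (L n : ℕ) (R : ℝ) : Set ℝ :=
  (⋃ j ∈ Finset.range (n / L), Set.Ico ((j * L : ℕ) : ℝ) ((j * L : ℕ) + R) ∪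
    Set.Ico (((j * L + L : ℕ) : ℝ) - R) (j * L + L : ℕ)) ∪ Set.Icc ((n / L * L : ℕ) : ℝ) n

lemma measurableSet_badLocations (L n : ℕ) (R : ℝ) : MeasurableSet (badLocations L n R) :=
  (Finset.measurableSet_biUnion _ fun _ _ ↦ measurableSet_Ico.union measurableSet_Ico).union
    measurableSet_Icc

lemma volume_badLocations_le {L : ℕ} (hL : 0 < L) (n : ℕ) {R : ℝ} (hR : 0 ≤ R) :
    volume (badLocations L n R) ≤ ENNReal.ofReal (2 * R * (n / L) + L) := by
  have h1 : volume (⋃ j ∈ Finset.range (n / L), Set.Ico ((j * L : ℕ) : ℝ) ((j * L : ℕ) + R) ∪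
      Set.Ico (((j * L + L : ℕ) : ℝ) - R) (j * L + L : ℕ)) ≤
      ENNReal.ofReal (2 * R * (n / L)) := by
    refine (measure_biUnion_finset_le _ _).trans ?_
    calc _ ≤ ∑ _j ∈ Finset.range (n / L), ENNReal.ofReal (2 * R) := by
          refine Finset.sum_le_sum fun j _ ↦ (measure_union_le _ _).trans ?_
          rw [Real.volume_Ico, Real.volume_Ico, ← ENNReal.ofReal_add (by linarith) (by linarith)]
          exact ENNReal.ofReal_le_ofReal (by linarith)
      _ = ENNReal.ofReal (2 * R * ((n / L : ℕ) : ℝ)) := by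
          rw [Finset.sum_const, Finset.card_range, nsmul_eq_mul, ← ENNReal.ofReal_natCast,
            ← ENNReal.ofReal_mul (Nat.cast_nonneg _), mul_comm]
      _ ≤ _ := by
          refine ENNReal.ofReal_le_ofReal ?_
          gcongr
          exact Nat.cast_div_le
  refine (measure_union_le _ _).trans ((add_le_add h1 ?_).trans
    (ENNReal.ofReal_add (by positivity) (by positivity)).ge)
  rw [Real.volume_Icc]
  refine ENNReal.ofReal_le_ofReal ?_
  have h2 : n ≤ n / L * L + L := by
    have := Nat.div_add_mod n L
    have := Nat.mod_lt n hL
    nlinarith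
  have h3 : (n : ℝ) ≤ (n / L * L : ℕ) + L := by exact_mod_cast h2
  linarith

/-- An edge shorter than `R` that starts farther than `R` from the ends of its block stays in the
block. The block of the first endpoint `x` has index `⌊x / L⌋`, and it is a complete one because the
remainder of the window counts as bad. -/
lemma le_abs_sub_of_mem_crossEdges {L n : ℕ} (hL : 0 < L) {R : ℝ} {q : Strip × Strip}
    (hq : q ∈ crossEdges γ γ' β L n) (hx : q.1.1 ∉ badLocations L n R) :
    R ≤ |q.1.1 - q.2.1| := by
  obtain ⟨⟨h1, h2, h3⟩, h4⟩ := hq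
  have hL' : (0 : ℝ) < L := by exact_mod_cast hL
  by_contra hlt
  obtain ⟨h5, h6⟩ := abs_lt.1 (not_le.1 hlt)
  set j := ⌊q.1.1 / L⌋₊ with hj
  have h7 : ((j * L : ℕ) : ℝ) ≤ q.1.1 := by
    push_cast
    rw [← le_div_iff₀ hL']
    exact Nat.floor_le (by positivity)
  have h8 : q.1.1 < ((j * L + L : ℕ) : ℝ) := by
    push_cast
    have := Nat.lt_floor_add_one (q.1.1 / L)
    rw [div_lt_iff₀ hL'] at this
    linarith
  have hjN : j ∈ Finset.range (n / L) := by
    rw [Finset.mem_range]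
    by_contra h9
    refine hx (Or.inr ⟨?_, h3⟩)
    have : n / L * L ≤ j * L := Nat.mul_le_mul_right L (not_lt.1 h9)
    have : ((n / L * L : ℕ) : ℝ) ≤ (j * L : ℕ) := by exact_mod_cast this
    linarith
  have h9 : ((j * L : ℕ) : ℝ) + R ≤ q.1.1 := by
    by_contra h
    exact hx (Or.inl (Set.mem_iUnion₂.2 ⟨j, hjN, Or.inl ⟨h7, not_le.1 h⟩⟩))
  have h10 : q.1.1 < ((j * L + L : ℕ) : ℝ) - R := by
    by_contra h
    exact hx (Or.inl (Set.mem_iUnion₂.2 ⟨j, hjN, Or.inr ⟨not_lt.1 h, h8⟩⟩))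
  exact h4 (Set.mem_iUnion₂.2 ⟨j, hjN, h1, ⟨h7, h8⟩, by linarith, by linarith⟩)

/-- From good locations only edges with `R ≤ β u^(-γ) w^(-γ')` start, so the Markov factor gains `R
^ (-δ)`. At bad locations the trivial rate is used, and the gain is their small volume. -/
lemma varBound_crossEdges_le (hγ : 0 < γ) (hγ' : 0 < γ') (hβ : 0 < β) {L : ℕ} (hL : 0 < L)
    (n : ℕ) {R δ : ℝ} (hR : 0 < R) (hδ : 0 ≤ δ) (θ : ℝ) :
    varBound (stripMeasure lam) (stripMeasure lam') θ (crossEdges γ γ' β L n) ≤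
      ENNReal.ofReal lam * ENNReal.ofReal n * varRate γ γ' β lam lam' θ (R ^ (-δ)) δ +
      ENNReal.ofReal lam * ENNReal.ofReal (2 * R * (n / L) + L) *
        varRate γ γ' β lam lam' θ 1 0 := by
  have hsub : crossEdges γ γ' β L n ⊆ edgeSet γ γ' β := fun q hq ↦ hq.1.1
  refine (varBound_le_of_subset (lam := lam) (lam' := lam') hγ hγ' hβ
    (measurableSet_crossEdges hγ hγ' L n) hsub (κ := R ^ (-δ)) (δ := δ) (by positivity) θ
    (I := Set.Icc (0 : ℝ) n \ badLocations L n R) (J := badLocations L n R)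
    (measurableSet_Icc.diff (measurableSet_badLocations L n R)) (measurableSet_badLocations L n R)
    (fun q hq ↦ ?_) fun q hq hqI hu hw ↦ ?_).trans ?_
  · by_cases h : q.1.1 ∈ badLocations L n R
    · exact Or.inr h
    · exact Or.inl ⟨hq.1.2, h⟩
  · have h1 := le_abs_sub_of_mem_crossEdges hL hq hqI.2
    have h2 : |q.1.1 - q.2.1| ≤ _ := (connF_le_iff hu hw).1 (hsub hq)
    have h3 := Real.rpow_le_rpow hR.le (h1.trans h2) hδ
    rw [Real.rpow_neg hR.le, ← div_eq_inv_mul, one_le_div (by positivity)]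
    exact h3
  · gcongr
    · exact (measure_mono Set.sdiff_subset).trans (by simp)
    · exact volume_badLocations_le hL n hR.le

lemma tendsto_varRate (hγ1 : γ < 1) (hγ' : 0 < γ') {θ δ : ℝ} (hδ0 : 0 < δ)
    (hδ : γ' * (2 + δ) < 1) (h1 : 2 * (γ * (1 + δ)) < 1) (hγ : 0 < γ) :
    Tendsto (fun R : ℝ ↦ varRate γ γ' β lam lam' θ (R ^ (-δ)) δ) atTop (𝓝 0) := by
  have h2 := sectionConst_ne_top (β := β) (lam := lam) (lam' := lam') hγ1 hγ' hδ
  have h3 : markInt (γ * (1 + δ)) ≠ ∞ := markInt_ne_top (by nlinarith)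
  have h4 := markInt_ne_top h1
  have h5 : Tendsto (fun R : ℝ ↦ ENNReal.ofReal (R ^ (-δ))) atTop (𝓝 0) := by
    rw [← ENNReal.ofReal_zero]
    exact ENNReal.tendsto_ofReal (tendsto_rpow_neg_atTop hδ0)
  have h6 : Tendsto (fun R : ℝ ↦ ENNReal.ofReal (R ^ (-δ)) * sectionConst γ γ' β lam lam' δ)
      atTop (𝓝 0) := by
    simpa using ENNReal.Tendsto.mul_const h5 (Or.inr h2)
  have h7 := ENNReal.Tendsto.const_mul
    (ENNReal.Tendsto.mul_const (ENNReal.Tendsto.pow (n := 2) h6) (Or.inr h4))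
    (Or.inr (ENNReal.ofReal_ne_top (r := θ ^ 2)))
  have h8 := h7.add (ENNReal.Tendsto.mul_const h6 (Or.inr h3))
  simpa [varRate] using h8

/-- For long blocks the variance of the number of edges that are not inside a block is small
compared with the length of the window. -/
lemma exists_varBound_crossEdges_le (hγ : 0 < γ) (hγ2 : γ < 1 / 2) (hγ' : 0 < γ')
    (hγ'3 : γ' < 1 / 3) (hβ : 0 < β) {ε : ℝ} (hε : 0 < ε) :
    ∃ L : ℕ, 0 < L ∧ ∀ᶠ n : ℕ in atTop,
      varBound (stripMeasure lam) (stripMeasure lam') 1 (crossEdges γ γ' β L n) ≤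
        ENNReal.ofReal (ε * n) := by
  obtain ⟨δ, hδ0, hδ1, hδ2⟩ : ∃ δ : ℝ, 0 < δ ∧ γ' * (2 + δ) < 1 ∧ 2 * (γ * (1 + δ)) < 1 := by
    -- This `δ` is below `1/2`, hence `γ'(2 + δ) < 5/6`, and `1 - 2γ(1 + δ) = (1 - γ)(1 - 2γ) > 0`.
    refine ⟨(1 - 2 * γ) / 2, by linarith, by nlinarith, by nlinarith⟩
  have hA0 : varRate γ γ' β lam lam' 1 1 0 ≠ ∞ :=
    varRate_ne_top (by linarith) hγ' (by linarith) (by linarith) (Or.inr (by linarith))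
  set A := (ENNReal.ofReal lam * varRate γ γ' β lam lam' 1 1 0).toReal with hA
  have hA' : ENNReal.ofReal lam * varRate γ γ' β lam lam' 1 1 0 = ENNReal.ofReal A :=
    (ENNReal.ofReal_toReal (by finiteness)).symm
  have hA1 : 0 ≤ A := ENNReal.toReal_nonneg
  have h1 : Tendsto (fun R : ℝ ↦ ENNReal.ofReal lam *
      varRate γ γ' β lam lam' 1 (R ^ (-δ)) δ) atTop (𝓝 0) := by
    simpa using ENNReal.Tendsto.const_mul
      (tendsto_varRate (β := β) (lam := lam) (lam' := lam') (θ := 1) (by linarith) hγ' hδ0 hδ1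
        hδ2 hγ) (Or.inr (ENNReal.ofReal_ne_top (r := lam)))
  have h2 : (0 : ℝ≥0∞) < ENNReal.ofReal (ε / 3) := ENNReal.ofReal_pos.2 (by positivity)
  -- Three errors of size `ε n / 3`: first `R` makes long edges rare, then `L` makes the boundary
  -- strips of width `R` a small fraction, then large `n` absorbs the remainder of length at most
  -- `L`.
  obtain ⟨R, hR1, hR⟩ := ((h1.eventually_lt_const h2).and (eventually_gt_atTop 0)).exists
  obtain ⟨L, hL⟩ := exists_nat_gt (6 * R * A / ε)
  have hLpos : (0 : ℝ) < L := lt_of_le_of_lt (by positivity) hL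
  refine ⟨L, by exact_mod_cast hLpos, ?_⟩
  obtain ⟨n₀, hn₀⟩ := exists_nat_gt (3 * L * A / ε)
  filter_upwards [eventually_ge_atTop n₀] with n hn
  have hn' : (n₀ : ℝ) ≤ n := by exact_mod_cast hn
  refine (varBound_crossEdges_le hγ hγ' hβ (by exact_mod_cast hLpos) n hR hδ0.le 1).trans ?_
  calc _ = ENNReal.ofReal n * (ENNReal.ofReal lam * varRate γ γ' β lam lam' 1 (R ^ (-δ)) δ) +
        ENNReal.ofReal (2 * R * (n / L) + L) *
          (ENNReal.ofReal lam * varRate γ γ' β lam lam' 1 1 0) := by ring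
    _ ≤ ENNReal.ofReal n * ENNReal.ofReal (ε / 3) +
        ENNReal.ofReal (2 * R * (n / L) + L) * ENNReal.ofReal A := by
        rw [hA']
        gcongr
    _ = ENNReal.ofReal (n * (ε / 3) + (2 * R * (n / L) + L) * A) := by
        rw [← ENNReal.ofReal_mul (by positivity), ← ENNReal.ofReal_mul (by positivity),
          ← ENNReal.ofReal_add (by positivity) (by positivity)]
    _ ≤ _ := by
        refine ENNReal.ofReal_le_ofReal ?_
        rw [div_lt_iff₀ hε] at hL hn₀
        have h3 : 2 * R * (n / L) * A ≤ n * (ε / 3) := by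
          rw [show 2 * R * ((n : ℝ) / L) * A = n * (2 * R * A / L) by ring]
          refine mul_le_mul_of_nonneg_left ?_ (Nat.cast_nonneg n)
          rw [div_le_iff₀ hLpos]
          linarith
        have h4 : L * A ≤ n * (ε / 3) := by nlinarith
        linarith

end EdgeSets

/-! ### A central limit theorem in terms of characteristic functions -/

lemma norm_pow_sub_pow_le_of_norm_le_one {z w : ℂ} (hz : ‖z‖ ≤ 1) (hw : ‖w‖ ≤ 1) (N : ℕ) :
    ‖z ^ N - w ^ N‖ ≤ N * ‖z - w‖ := by
  induction N with
  | zero => simp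
  | succ N ih =>
    have h1 : z ^ (N + 1) - w ^ (N + 1) = z * (z ^ N - w ^ N) + (z - w) * w ^ N := by ring
    have h2 : ‖w ^ N‖ ≤ 1 := by rw [norm_pow]; exact pow_le_one₀ (norm_nonneg _) hw
    calc ‖z ^ (N + 1) - w ^ (N + 1)‖ ≤ ‖z‖ * ‖z ^ N - w ^ N‖ + ‖z - w‖ * ‖w ^ N‖ := by
          rw [h1]
          exact (norm_add_le _ _).trans (by rw [norm_mul, norm_mul])
      _ ≤ 1 * (N * ‖z - w‖) + ‖z - w‖ * 1 := by gcongr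
      _ = _ := by push_cast; ring

lemma isLittleO_charFun_of_centered {Ω : Type*} [MeasurableSpace Ω] {μ : Measure Ω}
    [IsProbabilityMeasure μ] {X : Ω → ℝ} (hX : MemLp X 2 μ) (h0 : ∫ ω, X ω ∂μ = 0) :
    (fun t : ℝ ↦ charFun (μ.map X) t - (1 - (∫ ω, X ω ^ 2 ∂μ : ℝ) * t ^ 2 / 2)) =o[𝓝 0]
      fun t ↦ t ^ 2 := by
  have hm := hX.aestronglyMeasurable.aemeasurable
  have hint : MemLp id 2 (μ.map X) := by
    rw [memLp_map_measure_iff (by fun_prop) hm]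
    exact hX
  have : IsProbabilityMeasure (μ.map X) := Measure.isProbabilityMeasure_map hm
  have h1 : ∀ t : ℝ, taylorWithinEval (charFun (μ.map X)) 2 Set.univ 0 t =
      1 - (∫ ω, X ω ^ 2 ∂μ : ℝ) * t ^ 2 / 2 := fun t ↦ by
    rw [taylorWithinEval_charFun_two_zero hm hint, h0]
    simp
  simp_rw [← h1]
  convert! taylor_isLittleO_univ ?_
  · simp
  · exact contDiff_charFun hint

/-- Compared with the Gaussian of the same variance, the characteristic function at `n^(-1/2) t`
differs by `o(1/n)`, and taking the power `n / L` of numbers in the unit disc multiplies the error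
by at most `n`. The Gaussian power is explicit, and the floor quotient satisfies `(n / L) / n → 1 /
L`. -/
lemma tendsto_charFun_pow_div {Ω : Type*} [MeasurableSpace Ω] {μ : Measure Ω}
    [IsProbabilityMeasure μ] {X : Ω → ℝ} (hX : MemLp X 2 μ) (h0 : ∫ ω, X ω ∂μ = 0) {L : ℕ}
    (hL : 0 < L) (t : ℝ) :
    Tendsto (fun n : ℕ ↦ charFun (μ.map X) ((n : ℝ) ^ (-(1 / 2) : ℝ) * t) ^ (n / L)) atTop
      (𝓝 (Complex.exp (-(((∫ ω, X ω ^ 2 ∂μ) / L : ℝ) * t ^ 2 / 2 : ℝ)))) := by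
  set v : ℝ := ∫ ω, X ω ^ 2 ∂μ with hv
  have hv0 : 0 ≤ v := integral_nonneg fun ω ↦ sq_nonneg _
  have hm := hX.aestronglyMeasurable.aemeasurable
  have : IsProbabilityMeasure (μ.map X) := Measure.isProbabilityMeasure_map hm
  have hL' : (0 : ℝ) < L := by exact_mod_cast hL
  set g : ℝ → ℂ := fun s ↦ Complex.exp (-(v * s ^ 2 / 2 : ℝ)) with hg
  have hgs : g = charFun (gaussianReal 0 v.toNNReal) := by
    ext s
    rw [charFun_gaussianReal]
    simp [hg, hv0]
  have h2 : (fun s : ℝ ↦ charFun (μ.map X) s - g s) =o[𝓝 0] fun s ↦ s ^ 2 := by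
    have h3 := isLittleO_charFun_of_centered (μ := gaussianReal 0 v.toNNReal) (X := id)
      (memLp_id_gaussianReal 2) (by simp)
    have h4 : ∫ x, (id x : ℝ) ^ 2 ∂(gaussianReal 0 v.toNNReal) = v := by
      have h5 := variance_id_gaussianReal (μ := 0) (v := v.toNNReal)
      rw [variance_eq_integral (by fun_prop)] at h5
      simpa [hv0] using h5
    rw [h4, Measure.map_id, ← hgs] at h3
    have h6 := (isLittleO_charFun_of_centered hX h0).sub h3
    refine h6.congr_left fun s ↦ ?_
    ring
  have hs : Tendsto (fun n : ℕ ↦ (n : ℝ) ^ (-(1 / 2) : ℝ) * t) atTop (𝓝 0) := by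
    rw [← zero_mul t]
    exact ((tendsto_rpow_neg_atTop (by norm_num : (0 : ℝ) < 1 / 2)).comp
      tendsto_natCast_atTop_atTop).mul_const t
  have hsq : ∀ n : ℕ, 0 < n → ((n : ℝ) ^ (-(1 / 2) : ℝ) * t) ^ 2 = t ^ 2 / n := fun n hn ↦ by
    have hn' : (0 : ℝ) < n := by exact_mod_cast hn
    rw [mul_pow, ← Real.rpow_natCast, ← Real.rpow_mul hn'.le]
    norm_num
    rw [Real.rpow_neg_one]
    ring
  have hdiff : Tendsto (fun n : ℕ ↦ charFun (μ.map X) ((n : ℝ) ^ (-(1 / 2) : ℝ) * t) ^ (n / L) -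
      g ((n : ℝ) ^ (-(1 / 2) : ℝ) * t) ^ (n / L)) atTop (𝓝 0) := by
    have h7 : Tendsto (fun n : ℕ ↦ (n : ℝ) * ‖charFun (μ.map X) ((n : ℝ) ^ (-(1 / 2) : ℝ) * t) -
        g ((n : ℝ) ^ (-(1 / 2) : ℝ) * t)‖) atTop (𝓝 0) := by
      have h8 := (h2.comp_tendsto hs).norm_left
      rw [Asymptotics.isLittleO_iff] at h8
      rw [Metric.tendsto_atTop']
      intro ε hε
      -- The summand `1` avoids a separate treatment of `t = 0`.
      have h9 := h8 (show (0 : ℝ) < ε / (t ^ 2 + 1) by positivity)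
      obtain ⟨n₀, hn₀⟩ := eventually_atTop.1 (h9.and (eventually_gt_atTop 0))
      refine ⟨n₀, fun n hn ↦ ?_⟩
      obtain ⟨h10, h11⟩ := hn₀ n hn.le
      have hn' : (0 : ℝ) < n := by exact_mod_cast h11
      simp only [Function.comp, norm_norm] at h10
      rw [hsq n h11, Real.norm_of_nonneg (by positivity)] at h10
      rw [dist_zero_right, norm_mul, norm_norm, Real.norm_of_nonneg hn'.le]
      calc _ ≤ (n : ℝ) * (ε / (t ^ 2 + 1) * (t ^ 2 / n)) := by gcongr
        _ = ε * (t ^ 2 / (t ^ 2 + 1)) := by field_simp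
        _ < ε * 1 := by
            gcongr
            rw [div_lt_one (by positivity)]
            linarith
        _ = ε := mul_one ε
    refine squeeze_zero_norm (fun n ↦ ?_) h7
    refine (norm_pow_sub_pow_le_of_norm_le_one (norm_charFun_le_one _) ?_ (n / L)).trans ?_
    · rw [hgs]
      exact norm_charFun_le_one _
    · gcongr
      exact Nat.div_le_self n L
  have hdiv : Tendsto (fun n : ℕ ↦ ((n / L : ℕ) : ℝ) / n) atTop (𝓝 (1 / L)) := by
    refine tendsto_of_tendsto_of_tendsto_of_le_of_le' (g := fun n : ℕ ↦ 1 / (L : ℝ) - 1 / n)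
      (h := fun _ ↦ 1 / (L : ℝ)) ?_ tendsto_const_nhds ?_ ?_
    · simpa using tendsto_const_nhds.sub (tendsto_const_div_atTop_nhds_zero_nat (1 : ℝ))
    · filter_upwards [eventually_gt_atTop 0] with n hn
      have hn' : (0 : ℝ) < n := by exact_mod_cast hn
      have h11 : n < (n / L + 1) * L := by
        have := Nat.lt_div_mul_add (a := n) hL
        linarith
      have h12 : (n : ℝ) < ((n / L : ℕ) + 1) * L := by exact_mod_cast h11
      rw [le_div_iff₀ hn', sub_mul, div_mul_cancel₀ _ hn'.ne', sub_le_iff_le_add, one_div,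
        inv_mul_le_iff₀ hL']
      linarith
    · filter_upwards [eventually_gt_atTop 0] with n hn
      have hn' : (0 : ℝ) < n := by exact_mod_cast hn
      rw [div_le_iff₀ hn', one_div, ← div_eq_inv_mul]
      exact Nat.cast_div_le
  have hmain : Tendsto (fun n : ℕ ↦ g ((n : ℝ) ^ (-(1 / 2) : ℝ) * t) ^ (n / L)) atTop
      (𝓝 (Complex.exp (-((v / L) * t ^ 2 / 2 : ℝ)))) := by
    have h13 : Tendsto (fun n : ℕ ↦ Complex.exp (-(v * t ^ 2 / 2 * (((n / L : ℕ) : ℝ) / n) : ℝ)))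
        atTop (𝓝 (Complex.exp (-((v / L) * t ^ 2 / 2 : ℝ)))) := by
      have h14 := hdiv.const_mul (v * t ^ 2 / 2)
      rw [show v * t ^ 2 / 2 * (1 / L) = v / L * t ^ 2 / 2 by ring] at h14
      have hc : Continuous fun x : ℝ ↦ Complex.exp (-(x : ℂ)) := by fun_prop
      exact (hc.tendsto _).comp h14
    refine h13.congr' ?_
    filter_upwards [eventually_gt_atTop 0] with n hn
    simp only [hg]
    rw [hsq n hn, ← Complex.exp_nat_mul]
    congr 1
    push_cast
    ring
  simpa using hdiff.add hmain

/-- If functions are approximated up to arbitrarily small errors by Gaussian characteristic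
functions with bounded variances, they converge to a Gaussian characteristic function. -/
lemma exists_tendsto_gaussian {φ : ℕ → ℝ → ℂ} {B : ℝ}
    (h : ∀ ε : ℝ, 0 < ε → ∃ s ∈ Set.Icc 0 B, ∀ t η : ℝ, 0 < η → ∀ᶠ n in atTop,
      ‖φ n t - Complex.exp (-(s * t ^ 2 / 2 : ℝ))‖ ≤ |t| * ε + η) :
    ∃ s : ℝ, 0 ≤ s ∧ ∀ t, Tendsto (fun n ↦ φ n t) atTop
      (𝓝 (Complex.exp (-(s * t ^ 2 / 2 : ℝ)))) := by
  choose! s hsB hs using h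
  have hpos : ∀ k : ℕ, (0 : ℝ) < 1 / (k + 1) := fun k ↦ by positivity
  -- A subsequence is taken only in the accuracy `1 / (k + 1)`; for each accuracy the estimate holds
  -- for all large `n`, so the full sequence `φ n t` converges.
  obtain ⟨a, haB, ψ, hψ, hlim⟩ := isCompact_Icc.tendsto_subseq
    (x := fun k : ℕ ↦ s (1 / (k + 1))) fun k ↦ hsB _ (hpos k)
  refine ⟨a, haB.1, fun t ↦ ?_⟩
  rw [Metric.tendsto_atTop']
  intro η hη
  have hc : Continuous fun x : ℝ ↦ Complex.exp (-(x * t ^ 2 / 2 : ℝ)) := by fun_prop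
  have h1 := (hc.tendsto a).comp hlim
  have h2 : Tendsto (fun k : ℕ ↦ |t| * (1 / ((ψ k : ℝ) + 1))) atTop (𝓝 0) := by
    have := (tendsto_one_div_add_atTop_nhds_zero_nat (𝕜 := ℝ)).comp hψ.tendsto_atTop
    simpa using this.const_mul |t|
  obtain ⟨k, hk1, hk2⟩ := ((Metric.tendsto_nhds.1 h1 (η / 4) (by positivity)).and
    (h2.eventually_lt_const (show (0 : ℝ) < η / 4 by positivity))).exists
  obtain ⟨n₀, hn₀⟩ := eventually_atTop.1 (hs _ (hpos (ψ k)) t (η / 4) (by positivity))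
  refine ⟨n₀, fun n hn ↦ ?_⟩
  have h3 := hn₀ n hn.le
  rw [← dist_eq_norm] at h3
  have h4 := dist_triangle (φ n t) (Complex.exp (-(s (1 / ((ψ k : ℝ) + 1)) * t ^ 2 / 2 : ℝ)))
    (Complex.exp (-(a * t ^ 2 / 2 : ℝ)))
  have h5 : dist (Complex.exp (-(s (1 / ((ψ k : ℝ) + 1)) * t ^ 2 / 2 : ℝ)))
    (Complex.exp (-(a * t ^ 2 / 2 : ℝ))) < η / 4 := hk1
  linarith

/-! ### Centered edge counts and the Gaussian limit. -/

section CentralLimit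

variable {γ γ' β lam lam' : ℝ}

lemma tendstoInDistribution_of_tendsto_integral_cexp {Ω : Type*} [MeasurableSpace Ω]
    {μ : Measure Ω} [IsProbabilityMeasure μ] {X : ℕ → Ω → ℝ} (hX : ∀ n, AEMeasurable (X n) μ)
    {ν : Measure ℝ} [IsProbabilityMeasure ν]
    (h : ∀ t : ℝ, Tendsto (fun n ↦ ∫ ω, Complex.exp (t * X n ω * Complex.I) ∂μ) atTop
      (𝓝 (charFun ν t))) :
    TendstoInDistribution X atTop (id : ℝ → ℝ) (fun _ ↦ μ) ν := by
  refine ⟨hX, aemeasurable_id, ?_⟩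
  refine ProbabilityMeasure.tendsto_iff_tendsto_charFun.2 fun t ↦ ?_
  have h1 : ∀ n, charFun (μ.map (X n)) t = ∫ ω, Complex.exp (t * X n ω * Complex.I) ∂μ := by
    intro n
    rw [charFun_apply_real, integral_map (hX n) (by fun_prop)]
  simpa [h1, Measure.map_id] using h t

lemma prod_le_varBound (ν ν' : Measure Strip) (θ : ℝ) (G : Set (Strip × Strip)) :
    (ν.prod ν') G ≤ varBound ν ν' θ G := le_add_self

lemma varBound_windowEdges_ne_top (hγ : 0 < γ) (hγ1 : γ < 1) (hγ' : 0 < γ') (hγ'3 : γ' < 1 / 3)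
    (hβ : 0 < β) {θ : ℝ} (hθ : θ = 0 ∨ 2 * γ < 1) (n : ℕ) :
    varBound (stripMeasure lam) (stripMeasure lam') θ (windowEdges γ γ' β n) ≠ ∞ := by
  refine ne_top_of_le_ne_top ?_ (varBound_windowEdges_le hγ hγ' hβ θ n)
  exact ENNReal.mul_ne_top (ENNReal.mul_ne_top ENNReal.ofReal_ne_top (ENNReal.natCast_ne_top n))
    (varRate_ne_top hγ1 hγ' (by linarith) (by linarith) (by simpa using hθ))

lemma prod_windowEdges_ne_top (hγ : 0 < γ) (hγ1 : γ < 1) (hγ' : 0 < γ') (hγ'3 : γ' < 1 / 3)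
    (hβ : 0 < β) (n : ℕ) :
    ((stripMeasure lam).prod (stripMeasure lam')) (windowEdges γ γ' β n) ≠ ∞ :=
  ne_top_of_le_ne_top
    (varBound_windowEdges_ne_top hγ hγ1 hγ' hγ'3 hβ (Or.inl rfl) n) (prod_le_varBound _ _ _ _)

lemma blockSet_zero_subset_windowEdges (L : ℕ) :
    blockSet (edgeSet γ γ' β) (0 : ℕ) L ⊆ windowEdges γ γ' β L := by
  rintro q ⟨h1, h2, -⟩
  exact ⟨h1, by simpa using h2.1, h2.2.le⟩

lemma prod_blockSet_add {ν ν' : Measure Strip} [SFinite ν] [SFinite ν'] (hν : ShiftInvariant ν)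
    (hν' : ShiftInvariant ν') {E : Set (Strip × Strip)} (hE : ∀ (a : ℝ) (p p' : Strip),
      (stripShift a p, stripShift a p') ∈ E ↔ (p, p') ∈ E) {a b c : ℝ}
    (hm : MeasurableSet (blockSet E (a + c) (b + c))) :
    (ν.prod ν') (blockSet E (a + c) (b + c)) = (ν.prod ν') (blockSet E a b) := by
  rw [← ((hν c).prod (hν' c)).measure_preimage hm.nullMeasurableSet]
  congr 1
  ext ⟨p, p'⟩
  simp only [blockSet, Set.mem_preimage, Prod.map_apply, Set.mem_ofPred_eq, hE]
  simp [stripShift]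

lemma edgeSet_stripShift (a : ℝ) (p p' : Strip) :
    (stripShift a p, stripShift a p') ∈ edgeSet γ γ' β ↔ (p, p') ∈ edgeSet γ γ' β := by
  simp [edgeSet, connF_stripShift]

lemma prod_blockSet_edgeSet (hγ : 0 < γ) (hγ' : 0 < γ') (j L : ℕ) :
    ((stripMeasure lam).prod (stripMeasure lam'))
      (blockSet (edgeSet γ γ' β) (j * L : ℕ) (j * L + L : ℕ)) =
    ((stripMeasure lam).prod (stripMeasure lam')) (blockSet (edgeSet γ γ' β) (0 : ℕ) L) := by
  have e1 : ((j * L : ℕ) : ℝ) = (0 : ℕ) + ((j * L : ℕ) : ℝ) := by simp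
  have e2 : ((j * L + L : ℕ) : ℝ) = (L : ℝ) + ((j * L : ℕ) : ℝ) := by push_cast; ring
  rw [e1, e2]
  exact prod_blockSet_add (shiftInvariant_stripMeasure _) (shiftInvariant_stripMeasure _)
    edgeSet_stripShift (measurableSet_blockSet hγ hγ' _ _)

variable {Ω : Type*} [MeasurableSpace Ω] {μ : Measure Ω} {P P' : Ω → Set Strip}

/-- The number of edges of the graph on `P` and `P'` that lie in `G`, centered by its mean. -/
noncomputable def centeredPairCount (lam lam' : ℝ) (P P' : Ω → Set Strip)
    (G : Set (Strip × Strip)) (ω : Ω) : ℝ :=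
  (pairCount (P ω) (P' ω) G).toReal - ((stripMeasure lam).prod (stripMeasure lam')).real G

lemma measurable_centeredPairCount (hP : IsPoissonProcess P (stripMeasure lam) μ)
    (hP' : IsPoissonProcess P' (stripMeasure lam') μ) {G : Set (Strip × Strip)}
    (hG : MeasurableSet G) : Measurable (centeredPairCount lam lam' P P' G) :=
  (measurable_pairCount hP hP' hG).ennreal_toReal.sub_const _

lemma memLp_two_of_lintegral_sq_ne_top {X : Ω → ℝ} (hX : AEMeasurable X μ)
    (h : ∫⁻ ω, ENNReal.ofReal (X ω ^ 2) ∂μ ≠ ∞) : MemLp X 2 μ := by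
  rw [memLp_two_iff_integrable_sq hX.aestronglyMeasurable]
  refine ⟨(hX.pow_const 2).aestronglyMeasurable, ?_⟩
  rw [hasFiniteIntegral_iff_ofReal (.of_forall fun ω ↦ sq_nonneg _)]
  exact lt_top_iff_ne_top.2 h

variable [IsProbabilityMeasure μ]

/-- The identity holds almost surely because `toReal` is additive on finite counts; integrating it
splits the mean in the same way. -/
lemma centeredPairCount_windowEdges (hP : IsPoissonProcess P (stripMeasure lam) μ)
    (hP' : IsPoissonProcess P' (stripMeasure lam') μ)
    (hind : Indep (processSigmaAlgebra P) (processSigmaAlgebra P') μ)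
    (hγ : 0 < γ) (hγ1 : γ < 1) (hγ' : 0 < γ') (hγ'3 : γ' < 1 / 3) (hβ : 0 < β) (L n : ℕ) :
    ∀ᵐ ω ∂μ, centeredPairCount lam lam' P P' (windowEdges γ γ' β n) ω =
      centeredPairCount lam lam' P P' (crossEdges γ γ' β L n) ω +
      ∑ j ∈ Finset.range (n / L), centeredPairCount lam lam' P P'
        (blockSet (edgeSet γ γ' β) (j * L : ℕ) (j * L + L : ℕ)) ω := by
  have hW := prod_windowEdges_ne_top (lam := lam) (lam' := lam') hγ hγ1 hγ' hγ'3 hβ n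
  have hWm := measurableSet_windowEdges (β := β) hγ hγ' n
  have hCm := measurableSet_crossEdges (β := β) hγ hγ' L n
  have hC : ((stripMeasure lam).prod (stripMeasure lam')) (crossEdges γ γ' β L n) ≠ ∞ :=
    ne_top_of_le_ne_top hW (measure_mono Set.sdiff_subset)
  have hBm := fun j : ℕ ↦ measurableSet_blockSet (β := β) hγ hγ' (j * L : ℕ) (j * L + L : ℕ)
  have hB : ∀ j ∈ Finset.range (n / L), ((stripMeasure lam).prod (stripMeasure lam'))
      (blockSet (edgeSet γ γ' β) (j * L : ℕ) (j * L + L : ℕ)) ≠ ∞ := fun j hj ↦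
    ne_top_of_le_ne_top hW (measure_mono (blockSet_subset_windowEdges hj))
  have key : ∀ᵐ ω ∂μ, (pairCount (P ω) (P' ω) (windowEdges γ γ' β n)).toReal =
      (pairCount (P ω) (P' ω) (crossEdges γ γ' β L n)).toReal +
      ∑ j ∈ Finset.range (n / L), (pairCount (P ω) (P' ω)
        (blockSet (edgeSet γ γ' β) (j * L : ℕ) (j * L + L : ℕ))).toReal := by
    filter_upwards [ae_pairCount_lt_top hP hP' hind hWm hW] with ω hω
    rw [pairCount_windowEdges hγ hγ' _ _ L n] at hω ⊢
    obtain ⟨h1, h2⟩ := ENNReal.add_lt_top.1 hω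
    rw [ENNReal.toReal_add h1.ne h2.ne, ENNReal.toReal_sum]
    exact fun j hj ↦ ((ENNReal.sum_lt_top.1 h2) j hj).ne
  have hmean := integral_congr_ae key
  rw [integral_add (integrable_pairCount hP hP' hind hCm hC)
    (integrable_finsetSum _ fun j hj ↦ integrable_pairCount hP hP' hind (hBm j) (hB j hj)),
    integral_finsetSum _ fun j hj ↦ integrable_pairCount hP hP' hind (hBm j) (hB j hj),
    integral_pairCount hP hP' hind hWm hW, integral_pairCount hP hP' hind hCm hC,
    Finset.sum_congr rfl fun j hj ↦ integral_pairCount hP hP' hind (hBm j) (hB j hj)] at hmean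
  filter_upwards [key] with ω hω
  simp only [centeredPairCount, Finset.sum_sub_distrib]
  rw [hω, hmean]
  ring

lemma integral_cexp_sum_centeredPairCount (hP : IsPoissonProcess P (stripMeasure lam) μ)
    (hP' : IsPoissonProcess P' (stripMeasure lam') μ)
    (hind : Indep (processSigmaAlgebra P) (processSigmaAlgebra P') μ)
    (hγ : 0 < γ) (hγ1 : γ < 1) (hγ' : 0 < γ') (hγ'3 : γ' < 1 / 3) (hβ : 0 < β) (L N : ℕ) (t : ℝ) :
    ∫ ω, Complex.exp (t * (∑ j ∈ Finset.range N, centeredPairCount lam lam' P P'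
        (blockSet (edgeSet γ γ' β) (j * L : ℕ) (j * L + L : ℕ)) ω : ℝ) * Complex.I) ∂μ =
      charFun (μ.map (centeredPairCount lam lam' P P'
        (blockSet (edgeSet γ γ' β) (0 : ℕ) L))) t ^ N := by
  have hB0 : ((stripMeasure lam).prod (stripMeasure lam'))
      (blockSet (edgeSet γ γ' β) (0 : ℕ) L) ≠ ∞ :=
    ne_top_of_le_ne_top (prod_windowEdges_ne_top hγ hγ1 hγ' hγ'3 hβ L)
      (measure_mono (blockSet_zero_subset_windowEdges L))
  have h := integral_cexp_sum_pairCount hP hP' hind (shiftInvariant_stripMeasure _)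
    (shiftInvariant_stripMeasure _) (edgeSet_stripShift (γ := γ) (γ' := γ') (β := β)) L
    (fun j ↦ measurableSet_blockSet hγ hγ' _ _) (fun j ↦ null_boundary_blockSet hγ hγ' hβ _ _)
    (fun j ↦ by rw [prod_blockSet_edgeSet hγ hγ']; exact hB0) t N
  set m : ℝ := ((stripMeasure lam).prod (stripMeasure lam')).real
    (blockSet (edgeSet γ γ' β) (0 : ℕ) L) with hm
  -- By shift invariance all blocks have the same mean, so centering contributes the `N`-th power of
  -- a single phase.
  have hmj : ∀ j : ℕ, ((stripMeasure lam).prod (stripMeasure lam')).real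
      (blockSet (edgeSet γ γ' β) (j * L : ℕ) (j * L + L : ℕ)) = m := fun j ↦ by
    rw [measureReal_def, prod_blockSet_edgeSet hγ hγ', hm, measureReal_def]
  have e1 : ∀ ω, Complex.exp (t * (∑ j ∈ Finset.range N, centeredPairCount lam lam' P P'
      (blockSet (edgeSet γ γ' β) (j * L : ℕ) (j * L + L : ℕ)) ω : ℝ) * Complex.I) =
      Complex.exp (t * (∑ j ∈ Finset.range N, (pairCount (P ω) (P' ω)
        (blockSet (edgeSet γ γ' β) (j * L : ℕ) (j * L + L : ℕ))).toReal : ℝ) * Complex.I) *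
        Complex.exp (-(t * m * Complex.I)) ^ N := by
    intro ω
    rw [← Complex.exp_nat_mul, ← Complex.exp_add]
    congr 1
    simp only [centeredPairCount, hmj, Finset.sum_sub_distrib, Finset.sum_const, Finset.card_range,
      nsmul_eq_mul]
    push_cast
    ring
  simp_rw [e1]
  rw [integral_mul_const, h, ← mul_pow, ← integral_mul_const, charFun_apply_real,
    integral_map (measurable_centeredPairCount hP hP'
      (measurableSet_blockSet hγ hγ' _ _)).aemeasurable (by fun_prop)]
  congr 1
  refine integral_congr_ae (.of_forall fun ω ↦ ?_)
  simp only [centeredPairCount]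
  rw [← Complex.exp_add, ← hm]
  congr 1
  push_cast
  ring

lemma integral_centeredPairCount (hP : IsPoissonProcess P (stripMeasure lam) μ)
    (hP' : IsPoissonProcess P' (stripMeasure lam') μ)
    (hind : Indep (processSigmaAlgebra P) (processSigmaAlgebra P') μ) {G : Set (Strip × Strip)}
    (hG : MeasurableSet G) (hGf : ((stripMeasure lam).prod (stripMeasure lam')) G ≠ ∞) :
    ∫ ω, centeredPairCount lam lam' P P' G ω ∂μ = 0 := by
  simp only [centeredPairCount]
  rw [integral_sub (integrable_pairCount hP hP' hind hG hGf) (integrable_const _),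
    integral_pairCount hP hP' hind hG hGf]
  simp

/-- Cross edges have variance at most `ε² n`, which costs `|t| ε` after normalization. The blocks
give a Gaussian limit whose variance is that of one block divided by `L`; since a block has variance
`O(L)`, these variances are bounded uniformly in `ε`. -/
lemma exists_tendsto_integral_cexp_windowEdges (hP : IsPoissonProcess P (stripMeasure lam) μ)
    (hP' : IsPoissonProcess P' (stripMeasure lam') μ)
    (hind : Indep (processSigmaAlgebra P) (processSigmaAlgebra P') μ)
    (hγ : 0 < γ) (hγ2 : γ < 1 / 2) (hγ' : 0 < γ') (hγ'3 : γ' < 1 / 3) (hβ : 0 < β) :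
    ∃ s : ℝ, 0 ≤ s ∧ ∀ t : ℝ, Tendsto (fun n : ℕ ↦ ∫ ω, Complex.exp (t * ((n : ℝ) ^ (-(1 / 2) : ℝ) *
      centeredPairCount lam lam' P P' (windowEdges γ γ' β n) ω : ℝ) * Complex.I) ∂μ) atTop
      (𝓝 (Complex.exp (-(s * t ^ 2 / 2 : ℝ)))) := by
  have hγ1 : γ < 1 := by linarith
  refine exists_tendsto_gaussian (B := (ENNReal.ofReal lam *
    varRate γ γ' β lam lam' 1 1 0).toReal) fun ε hε ↦ ?_
  have hrate : varRate γ γ' β lam lam' 1 1 0 ≠ ∞ :=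
    varRate_ne_top hγ1 hγ' (by linarith) (by linarith) (Or.inr (by linarith))
  obtain ⟨L, hL, hLn⟩ := exists_varBound_crossEdges_le (lam := lam) (lam' := lam') hγ hγ2 hγ' hγ'3
    hβ (pow_pos hε 2)
  set B := blockSet (edgeSet γ γ' β) (0 : ℕ) L with hBdef
  have hBm : MeasurableSet B := measurableSet_blockSet hγ hγ' _ _
  have hBf : ((stripMeasure lam).prod (stripMeasure lam')) B ≠ ∞ :=
    ne_top_of_le_ne_top (prod_windowEdges_ne_top hγ hγ1 hγ' hγ'3 hβ L)
      (measure_mono (blockSet_zero_subset_windowEdges L))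
  have hB2 : ∫⁻ ω, ENNReal.ofReal (centeredPairCount lam lam' P P' B ω ^ 2) ∂μ ≤
      ENNReal.ofReal lam * L * varRate γ γ' β lam lam' 1 1 0 :=
    (lintegral_sq_pairCount_le hP hP' hind hBm (null_boundary_blockSet hγ hγ' hβ _ _) hBf).trans
      ((varBound_mono _ (blockSet_zero_subset_windowEdges L)).trans
        (varBound_windowEdges_le hγ hγ' hβ 1 L))
  have hfin : ENNReal.ofReal lam * L * varRate γ γ' β lam lam' 1 1 0 ≠ ∞ :=
    ENNReal.mul_ne_top (ENNReal.mul_ne_top ENNReal.ofReal_ne_top (ENNReal.natCast_ne_top L)) hrate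
  have hXm := measurable_centeredPairCount hP hP' hBm
  have hX : MemLp (centeredPairCount lam lam' P P' B) 2 μ :=
    memLp_two_of_lintegral_sq_ne_top hXm.aemeasurable (ne_top_of_le_ne_top hfin hB2)
  have hX0 := integral_centeredPairCount hP hP' hind hBm hBf
  refine ⟨(∫ ω, centeredPairCount lam lam' P P' B ω ^ 2 ∂μ) / L, ⟨?_, ?_⟩, fun t η hη ↦ ?_⟩
  · exact div_nonneg (integral_nonneg fun ω ↦ sq_nonneg _) (Nat.cast_nonneg L)
  · rw [div_le_iff₀ (by exact_mod_cast hL), integral_eq_lintegral_of_nonneg_ae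
      (.of_forall fun ω ↦ sq_nonneg _) (hXm.pow_const 2).aestronglyMeasurable]
    refine (ENNReal.toReal_mono hfin hB2).trans (le_of_eq ?_)
    simp only [ENNReal.toReal_mul, ENNReal.toReal_natCast]
    ring
  have hlim := tendsto_charFun_pow_div hX hX0 hL t
  filter_upwards [hLn, Metric.tendsto_nhds.1 hlim η hη, eventually_gt_atTop 0] with n hn hn2 hn0
  have hn0' : (0 : ℝ) < n := by exact_mod_cast hn0
  rw [dist_eq_norm] at hn2
  set r : ℝ := (n : ℝ) ^ (-(1 / 2) : ℝ) with hr
  have hr0 : 0 < r := by positivity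
  have hCm := measurableSet_crossEdges (β := β) hγ hγ' L n
  have hWf := prod_windowEdges_ne_top (lam := lam) (lam' := lam') hγ hγ1 hγ' hγ'3 hβ n
  have hCf : ((stripMeasure lam).prod (stripMeasure lam')) (crossEdges γ γ' β L n) ≠ ∞ :=
    ne_top_of_le_ne_top hWf (measure_mono Set.sdiff_subset)
  have hcmp := norm_integral_cexp_sub_le (μ := μ)
    (X := centeredPairCount lam lam' P P' (windowEdges γ γ' β n))
    (Y := fun ω ↦ ∑ j ∈ Finset.range (n / L), centeredPairCount lam lam' P P'
        (blockSet (edgeSet γ γ' β) (j * L : ℕ) (j * L + L : ℕ)) ω)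
    (measurable_centeredPairCount hP hP' (measurableSet_windowEdges hγ hγ' n)).aemeasurable
    (Finset.measurable_fun_sum _ fun j _ ↦ measurable_centeredPairCount hP hP'
      (measurableSet_blockSet hγ hγ' _ _)).aemeasurable (r * t) (B := ENNReal.ofReal (ε ^ 2 * n))
    ENNReal.ofReal_ne_top (by
      refine le_trans (le_of_eq (lintegral_congr_ae ?_)) ((lintegral_sq_pairCount_le hP hP' hind hCm
        (null_boundary_crossEdges hγ hγ' hβ L n) hCf).trans hn)
      filter_upwards [centeredPairCount_windowEdges hP hP' hind hγ hγ1 hγ' hγ'3 hβ L n] with ω hω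
      rw [hω, add_sub_cancel_right, centeredPairCount])
  rw [integral_cexp_sum_centeredPairCount hP hP' hind hγ hγ1 hγ' hγ'3 hβ] at hcmp
  have hbound : |r * t| * √(ENNReal.ofReal (ε ^ 2 * n)).toReal = |t| * ε := by
    rw [ENNReal.toReal_ofReal (by positivity), Real.sqrt_mul (by positivity), Real.sqrt_sq hε.le,
      abs_mul, abs_of_pos hr0, hr, Real.rpow_neg hn0'.le, ← Real.sqrt_eq_rpow]
    field_simp
  rw [hbound] at hcmp
  have e : ∀ ω, Complex.exp (t * (r * centeredPairCount lam lam' P P'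
      (windowEdges γ γ' β n) ω : ℝ) * Complex.I) = Complex.exp ((r * t : ℝ) *
        centeredPairCount lam lam' P P' (windowEdges γ γ' β n) ω * Complex.I) := by
    intro ω
    congr 1
    push_cast
    ring
  simp_rw [e]
  refine (norm_sub_le_norm_sub_add_norm_sub _ _ _).trans (add_le_add hcmp hn2.le)

theorem exists_tendstoInDistribution_gaussianReal (hP : IsPoissonProcess P (stripMeasure lam) μ)
    (hP' : IsPoissonProcess P' (stripMeasure lam') μ)
    (hind : Indep (processSigmaAlgebra P) (processSigmaAlgebra P') μ)
    (hγ : 0 < γ) (hγ2 : γ < 1 / 2) (hγ' : 0 < γ') (hγ'3 : γ' < 1 / 3) (hβ : 0 < β) :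
    ∃ σ : ℝ≥0, TendstoInDistribution (fun (n : ℕ) ω ↦ (n : ℝ) ^ (-(1 / 2) : ℝ) *
      centeredPairCount lam lam' P P' (windowEdges γ γ' β n) ω) atTop (id : ℝ → ℝ) (fun _ ↦ μ)
      (gaussianReal 0 (σ ^ 2)) := by
  obtain ⟨s, hs, h⟩ := exists_tendsto_integral_cexp_windowEdges hP hP' hind hγ hγ2 hγ' hγ'3 hβ
  refine ⟨Real.toNNReal √s, tendstoInDistribution_of_tendsto_integral_cexp (fun n ↦
    ((measurable_centeredPairCount hP hP'
      (measurableSet_windowEdges hγ hγ' n)).const_mul _).aemeasurable) fun t ↦ ?_⟩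
  convert h t using 2
  rw [charFun_gaussianReal]
  congr 1
  have : ((Real.toNNReal √s ^ 2 : ℝ≥0) : ℝ) = s := by
    rw [NNReal.coe_pow, Real.coe_toNNReal _ (Real.sqrt_nonneg s), Real.sq_sqrt hs]
  rw [this]
  push_cast
  ring

end CentralLimit

section Stable

/-! ### The exponent of the stable law -/

lemma norm_compExp_le_sq (x : ℝ) : ‖compExp x‖ ≤ 2 * x ^ 2 := by
  rcases le_total |x| 1 with h | h
  · have h1 : ‖(x : ℂ) * Complex.I‖ = |x| := by simp
    have h2 := Complex.norm_exp_sub_one_sub_id_le (x := x * Complex.I) (by rwa [h1])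
    rw [h1, sq_abs] at h2
    unfold compExp
    nlinarith [sq_nonneg x]
  · have := norm_compExp_le x
    nlinarith [sq_abs x]

lemma compExp_re (x : ℝ) : (compExp x).re = Real.cos x - 1 := by
  simp [compExp, Complex.exp_ofReal_mul_I_re]

variable {γ : ℝ}

/-- Near `0` the linear bound gives `v^(-γ)`, integrable as `γ < 1`; near infinity the quadratic
bound gives `v^(-2γ)`, integrable as `γ > 1/2`. -/
lemma integrableOn_compExp_rpow (hγ : 1 / 2 < γ) (hγ1 : γ < 1) (a : ℝ) :
    IntegrableOn (fun v : ℝ ↦ compExp (a * v ^ (-γ))) (Set.Ioi 0) := by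
  have hm : Measurable fun v : ℝ ↦ compExp (a * v ^ (-γ)) :=
    continuous_compExp.measurable.comp (by fun_prop)
  rw [← Set.Ioc_union_Ioi_eq_Ioi zero_le_one]
  refine IntegrableOn.union ?_ ?_
  · have h := ((intervalIntegral.intervalIntegrable_rpow' (a := 0) (b := 1) (r := -γ)
      (by linarith)).1).const_mul (2 * |a|)
    refine h.mono' hm.aestronglyMeasurable ?_
    filter_upwards [ae_restrict_mem measurableSet_Ioc] with v hv
    refine (norm_compExp_le _).trans (le_of_eq ?_)
    rw [abs_mul, abs_of_nonneg (Real.rpow_nonneg hv.1.le _), mul_assoc]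
  · have h := (integrableOn_Ioi_rpow_of_lt (a := -γ * 2) (c := 1) (by linarith)
      one_pos).const_mul (2 * a ^ 2)
    refine h.mono' hm.aestronglyMeasurable ?_
    filter_upwards [ae_restrict_mem measurableSet_Ioi] with v hv
    refine (norm_compExp_le_sq _).trans (le_of_eq ?_)
    have hv0 : (0 : ℝ) ≤ v := zero_le_one.trans (le_of_lt hv)
    rw [mul_pow, Real.rpow_mul hv0, Real.rpow_two, mul_assoc]

/-- The logarithm of the characteristic function of the centered `1/γ`-stable law with jumps of
size `v ^ (-γ)`, where `v` ranges over a Poisson process of unit intensity on `(0, ∞)`. -/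
noncomputable def stableExponent (γ t : ℝ) : ℂ := ∫ v in Set.Ioi (0 : ℝ), compExp (t * v ^ (-γ))

/-- Rescaling `v` by `a ^ (-1/γ)` multiplies the jump size `v ^ (-γ)` by `a`. This self-similarity
is the source of stability. -/
lemma stableExponent_mul (hγ : 0 < γ) {a : ℝ} (ha : 0 < a) (t : ℝ) :
    stableExponent γ (a * t) = (a ^ (1 / γ) : ℝ) * stableExponent γ t := by
  have hb : 0 < a ^ (-(1 / γ)) := Real.rpow_pos_of_pos ha _
  have h := integral_comp_mul_left_Ioi (fun v : ℝ ↦ compExp (t * v ^ (-γ))) 0 hb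
  rw [mul_zero] at h
  have e : (a ^ (-(1 / γ)))⁻¹ = a ^ (1 / γ) := by rw [Real.rpow_neg ha.le, inv_inv]
  rw [e, Complex.real_smul] at h
  rw [stableExponent, stableExponent, ← h]
  refine setIntegral_congr_fun measurableSet_Ioi fun v hv ↦ ?_
  have hv0 : (0 : ℝ) ≤ v := le_of_lt hv
  have e2 : (a ^ (-(1 / γ)) * v) ^ (-γ) = a * v ^ (-γ) := by
    rw [Real.mul_rpow hb.le hv0, ← Real.rpow_mul ha.le]
    have : -(1 / γ) * -γ = 1 := by field_simp
    rw [this, Real.rpow_one]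
  simp only [e2]
  congr 1
  ring

lemma stableExponent_zero (γ : ℝ) : stableExponent γ 0 = 0 := by
  simp [stableExponent, compExp_zero]

/-- By scaling, the values at `1` and `-1` determine the exponent on the two half-lines; this yields
continuity at `0` without a domination argument. -/
lemma norm_stableExponent_le (hγ : 0 < γ) (t : ℝ) : ‖stableExponent γ t‖ ≤
    |t| ^ (1 / γ) * (‖stableExponent γ 1‖ + ‖stableExponent γ (-1)‖) := by
  have key : ∀ a s : ℝ, 0 < a → ‖stableExponent γ (a * s)‖ =
      a ^ (1 / γ) * ‖stableExponent γ s‖ := by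
    intro a s ha
    rw [stableExponent_mul hγ ha, norm_mul, Complex.norm_real, Real.norm_eq_abs,
      abs_of_pos (Real.rpow_pos_of_pos ha _)]
  rcases lt_trichotomy t 0 with ht | rfl | ht
  · have := key (-t) (-1) (by linarith)
    rw [show -t * -1 = t by ring] at this
    rw [this, abs_of_neg ht]
    have h0 : 0 ≤ (-t) ^ (1 / γ) := Real.rpow_nonneg (by linarith) _
    exact mul_le_mul_of_nonneg_left (by linarith [norm_nonneg (stableExponent γ 1)]) h0
  · rw [stableExponent_zero, norm_zero]
    positivity
  · have := key t 1 ht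
    rw [mul_one] at this
    rw [this, abs_of_pos ht]
    exact mul_le_mul_of_nonneg_left (by linarith [norm_nonneg (stableExponent γ (-1))])
      (Real.rpow_nonneg ht.le _)

lemma continuousAt_stableExponent_zero (hγ : 0 < γ) : ContinuousAt (stableExponent γ) 0 := by
  rw [ContinuousAt, stableExponent_zero]
  refine squeeze_zero_norm (norm_stableExponent_le hγ) ?_
  have h : Continuous fun t : ℝ ↦ |t| ^ (1 / γ) *
      (‖stableExponent γ 1‖ + ‖stableExponent γ (-1)‖) :=
    (continuous_abs.rpow_const fun _ ↦ Or.inr (by positivity)).mul_const _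
  have h2 := h.tendsto 0
  rwa [abs_zero, Real.zero_rpow (by positivity), zero_mul] at h2

/-- The real part integrates `cos - 1`, which is strictly negative for large `v`, where the argument
lies in `(0, π)`. This rules out a degenerate limit. -/
lemma stableExponent_re_neg (hγ : 1 / 2 < γ) (hγ1 : γ < 1) {c : ℝ} (hc : 0 < c) :
    (stableExponent γ c).re < 0 := by
  have hγ0 : 0 < γ := by linarith
  have hint := integrableOn_compExp_rpow hγ hγ1 c
  have h1 : (stableExponent γ c).re = ∫ v in Set.Ioi (0 : ℝ), (compExp (c * v ^ (-γ))).re :=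
    (Complex.reCLM.integral_comp_comm hint).symm
  have h2 : IntegrableOn (fun v : ℝ ↦ -(compExp (c * v ^ (-γ))).re) (Set.Ioi 0) :=
    (Complex.reCLM.integrable_comp hint).neg
  have h3 : 0 ≤ᵐ[volume.restrict (Set.Ioi (0 : ℝ))] fun v : ℝ ↦ -(compExp (c * v ^ (-γ))).re := by
    refine .of_forall fun v ↦ ?_
    simp only [compExp_re, Pi.zero_apply]
    linarith [Real.cos_le_one (c * v ^ (-γ))]
  have h4 := (setIntegral_pos_iff_support_of_nonneg_ae h3 h2).2 ?_
  · rw [integral_neg, ← h1] at h4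
    linarith
  have h5 : Tendsto (fun v : ℝ ↦ c * v ^ (-γ)) atTop (𝓝 0) := by
    simpa using (tendsto_rpow_neg_atTop hγ0).const_mul c
  obtain ⟨V, hV⟩ := eventually_atTop.1 (h5.eventually (gt_mem_nhds Real.pi_pos))
  have h6 : Set.Ioi (max V 0) ⊆
      (Function.support fun v : ℝ ↦ -(compExp (c * v ^ (-γ))).re) ∩ Set.Ioi 0 := by
    intro v hv
    have hv0 : 0 < v := (le_max_right V 0).trans_lt hv
    refine ⟨?_, hv0⟩
    have h7 := hV v ((le_max_left V 0).trans (le_of_lt hv))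
    have h8 := Real.cos_lt_cos_of_nonneg_of_le_pi le_rfl h7.le
      (mul_pos hc (Real.rpow_pos_of_pos hv0 _))
    rw [Real.cos_zero] at h8
    simp only [Function.mem_support, compExp_re]
    intro h9
    linarith
  refine lt_of_lt_of_le ?_ (measure_mono h6)
  simp

/-! ### Existence and stability of the limit law -/

/-- If the characteristic functions of a sequence of probability measures converge pointwise to a
function that is continuous at `0`, then this function is a characteristic function. -/
lemma exists_charFun_eq_of_tendsto {ρ : ℕ → ProbabilityMeasure ℝ} {f : ℝ → ℂ}
    (hf : ContinuousAt f 0)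
    (h : ∀ t, Tendsto (fun n ↦ charFun (ρ n : Measure ℝ) t) atTop (𝓝 (f t))) :
    ∃ ν : ProbabilityMeasure ℝ, ∀ t, charFun (ν : Measure ℝ) t = f t := by
  have htight := isTightMeasureSet_of_tendsto_charFun (μ := fun n ↦ (ρ n : Measure ℝ)) hf h
  have hcomp : IsCompact (closure (Set.range ρ)) := by
    refine isCompact_closure_of_isTightMeasureSet ?_
    convert htight using 1
    ext x
    simp
  -- An ultrafilter finer than `atTop` plays the role of a convergent subsequence from tightness.
  obtain ⟨ν, -, hν⟩ := hcomp.ultrafilter_le_nhds ((Ultrafilter.of (atTop : Filter ℕ)).map ρ)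
    (le_principal_iff.2 (mem_map.2 (univ_mem' fun n ↦ subset_closure ⟨n, rfl⟩)))
  have hν' : Tendsto ρ (Ultrafilter.of (atTop : Filter ℕ)) (𝓝 ν) := hν
  refine ⟨ν, fun t ↦ ?_⟩
  have h1 : Tendsto (fun n ↦ charFun (ρ n : Measure ℝ) t) (Ultrafilter.of (atTop : Filter ℕ))
      (𝓝 (charFun (ν : Measure ℝ) t)) := by
    rw [ProbabilityMeasure.tendsto_iff_forall_integral_rclike_tendsto ℂ] at hν'
    simp_rw [charFun_eq_integral_innerProbChar]
    exact hν' (BoundedContinuousFunction.innerProbChar t)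
  exact tendsto_nhds_unique h1 ((h t).mono_left (Ultrafilter.of_le _))

/-- A Dirac mass has a characteristic function of modulus `1`, which fails at `1`. Stability follows
from the scaling of the exponent; the shift is `d = 0` because the exponent is fully compensated. -/
lemma isStableLaw_of_charFun (hγ : 1 / 2 < γ) (hγ1 : γ < 1) {c l : ℝ} (hc : 0 < c) (hl : 0 < l)
    {ν : Measure ℝ} [IsProbabilityMeasure ν]
    (h : ∀ t, charFun ν t = Complex.exp (l * stableExponent γ (c * t))) :
    IsStableLaw (1 / γ) ν := by
  have hγ0 : 0 < γ := by linarith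
  refine ⟨inferInstance, fun x hx ↦ ?_, fun a b ha hb ↦ ⟨0, ?_⟩⟩
  · have h1 := congrArg norm (h 1)
    rw [hx, charFun_dirac, Complex.norm_exp_ofReal_mul_I, Complex.norm_exp, mul_one,
      Complex.re_ofReal_mul, eq_comm, Real.exp_eq_one_iff] at h1
    exact (mul_neg_of_pos_of_neg hl (stableExponent_re_neg hγ hγ1 hc)).ne h1
  · have e0 : (fun x : ℝ ↦ (a ^ (1 / γ) + b ^ (1 / γ)) ^ (1 / (1 / γ)) * x + 0) =
        fun x ↦ (a ^ (1 / γ) + b ^ (1 / γ)) ^ (1 / (1 / γ)) * x := by simp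
    rw [e0]
    have ha' : 0 < a ^ (1 / γ) := Real.rpow_pos_of_pos ha _
    have hb' : 0 < b ^ (1 / γ) := Real.rpow_pos_of_pos hb _
    set k := (a ^ (1 / γ) + b ^ (1 / γ)) ^ (1 / (1 / γ)) with hk
    have hk0 : 0 < k := Real.rpow_pos_of_pos (by linarith) _
    have hkγ : k ^ (1 / γ) = a ^ (1 / γ) + b ^ (1 / γ) := by
      rw [hk, ← Real.rpow_mul (by linarith)]
      have : 1 / (1 / γ) * (1 / γ) = 1 := by field_simp
      rw [this, Real.rpow_one]
    have hpm : ∀ r : ℝ, IsProbabilityMeasure (ν.map fun x ↦ r * x) := fun r ↦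
      Measure.isProbabilityMeasure_map (by fun_prop)
    refine Measure.ext_of_charFun (funext fun t ↦ ?_)
    rw [charFun_conv, charFun_map_mul, charFun_map_mul, charFun_map_mul, h, h, h, ← Complex.exp_add]
    have e1 : ∀ r : ℝ, c * (r * t) = r * (c * t) := fun r ↦ by ring
    rw [e1, e1, e1, stableExponent_mul hγ0 ha, stableExponent_mul hγ0 hb,
      stableExponent_mul hγ0 hk0, hkγ]
    congr 1
    push_cast
    ring

/-! ### Convergence to the stable law -/

variable {γ' β lam lam' : ℝ}

/-- The mean degree of a vertex with mark `u` is `degreeConst γ' β lam' * u ^ (-γ)`. -/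
noncomputable def degreeConst (γ' β lam' : ℝ) : ℝ := lam' * (2 * β * (markInt γ').toReal)

lemma degreeConst_pos (hγ'1 : γ' < 1) (hβ : 0 < β) (hlam' : 0 < lam') :
    0 < degreeConst γ' β lam' := by
  have := ENNReal.toReal_pos (markInt_pos γ').ne' (markInt_ne_top hγ'1)
  unfold degreeConst
  positivity

lemma stripMeasure_real_section_windowEdges (hγ : 0 < γ) (hγ' : 0 < γ') (hβ : 0 < β)
    (hlam' : 0 < lam') (n : ℕ) {p : Strip} (hp : 0 < (p.2 : ℝ)) :
    (stripMeasure lam').real (Prod.mk p ⁻¹' windowEdges γ γ' β n) =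
      (Set.Icc (0 : ℝ) n).indicator (fun _ ↦ degreeConst γ' β lam' * (p.2 : ℝ) ^ (-γ)) p.1 := by
  by_cases hx : p.1 ∈ Set.Icc (0 : ℝ) n
  · have e : Prod.mk p ⁻¹' windowEdges γ γ' β n = nbhd γ γ' β p := by
      ext p'
      exact ⟨fun h ↦ h.1, fun h ↦ ⟨h, hx⟩⟩
    rw [e, Set.indicator_of_mem hx, measureReal_def, Measure.smul_apply, volume_nbhd hγ hγ' hβ hp,
      smul_eq_mul, markPow, degreeConst]
    simp only [ENNReal.toReal_mul, ENNReal.toReal_ofReal hlam'.le,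
      ENNReal.toReal_ofReal (Real.rpow_nonneg hp.le (-γ)),
      ENNReal.toReal_ofReal (by positivity : 0 ≤ 2 * β)]
    ring
  · have e : Prod.mk p ⁻¹' windowEdges γ γ' β n = ∅ := by
      ext p'
      exact ⟨fun h ↦ hx h.2, fun h ↦ h.elim⟩
    rw [e, Set.indicator_of_notMem hx, measureReal_empty]

/-- The section measure is the mean degree `c u^(-γ)` over the window. Integrating out the location
gives a factor `n`, and the substitution `v = n u` absorbs both this factor and the normalization
`n^(-γ)`. -/
lemma integral_compExp_section_windowEdges (hγ : 0 < γ) (hγ' : 0 < γ') (hβ : 0 < β)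
    (hlam : 0 < lam) (hlam' : 0 < lam') (n : ℕ) (t : ℝ) :
    ∫ p, compExp (((n : ℝ) ^ (-γ) * t) *
        (stripMeasure lam').real (Prod.mk p ⁻¹' windowEdges γ γ' β n)) ∂(stripMeasure lam) =
      lam * ∫ v in (0 : ℝ)..n, compExp (degreeConst γ' β lam' * t * v ^ (-γ)) := by
  set f : ℝ → ℂ := fun v ↦ compExp (degreeConst γ' β lam' * t * v ^ (-γ)) with hf
  have h1 : (fun p : Strip ↦ compExp (((n : ℝ) ^ (-γ) * t) *
      (stripMeasure lam').real (Prod.mk p ⁻¹' windowEdges γ γ' β n))) =ᵐ[stripMeasure lam]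
      fun p ↦ (Set.Icc (0 : ℝ) n).indicator (fun _ ↦ (1 : ℂ)) p.1 * f (n * p.2) := by
    filter_upwards [ae_stripMeasure_mark_pos lam] with p hp
    rw [stripMeasure_real_section_windowEdges hγ hγ' hβ hlam' n hp]
    by_cases hx : p.1 ∈ Set.Icc (0 : ℝ) n
    · simp only [Set.indicator_of_mem hx, one_mul, hf]
      rw [Real.mul_rpow (Nat.cast_nonneg n) hp.le]
      congr 1
      ring
    · simp [Set.indicator_of_notMem hx, compExp_zero]
  have h2 : ∫ u : unitInterval, f (n * u) = ∫ u in (0 : ℝ)..1, f (n * u) := by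
    rw [unitInterval.volume_def, integral_subtype_comap measurableSet_Icc (fun u : ℝ ↦ f (n * u)),
      integral_Icc_eq_integral_Ioc, intervalIntegral.integral_of_le zero_le_one]
  have h3 := intervalIntegral.smul_integral_comp_mul_left (a := 0) (b := 1) f (n : ℝ)
  rw [integral_congr_ae h1, integral_smul_measure, Measure.volume_eq_prod,
    integral_prod_mul (fun x : ℝ ↦ (Set.Icc (0 : ℝ) n).indicator (fun _ ↦ (1 : ℂ)) x)
      (fun u : unitInterval ↦ f (n * u)), h2, integral_indicator_const _ measurableSet_Icc,
    Real.volume_real_Icc_of_le (Nat.cast_nonneg n), ENNReal.toReal_ofReal hlam.le, sub_zero]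
  rw [mul_zero, mul_one] at h3
  rw [← h3]
  simp only [Complex.real_smul]
  push_cast
  ring

variable {Ω : Type*} [MeasurableSpace Ω] {μ : Measure Ω} [IsProbabilityMeasure μ]
  {P P' : Ω → Set Strip}

/-- Replacing the count by its linear part in `P` costs `O(√n)` in `L²`, which is negligible at
scale `n^γ`. The choice `θ = 0` is essential, since mean degrees are not square integrable here. -/
lemma tendsto_integral_cexp_stable (hP : IsPoissonProcess P (stripMeasure lam) μ)
    (hP' : IsPoissonProcess P' (stripMeasure lam') μ)
    (hind : Indep (processSigmaAlgebra P) (processSigmaAlgebra P') μ)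
    (hγ : 1 / 2 < γ) (hγ1 : γ < 1) (hγ' : 0 < γ') (hγ'3 : γ' < 1 / 3) (hβ : 0 < β)
    (hlam : 0 < lam) (hlam' : 0 < lam') (t : ℝ) :
    Tendsto (fun n : ℕ ↦ ∫ ω, Complex.exp (t * ((n : ℝ) ^ (-γ) *
      centeredPairCount lam lam' P P' (windowEdges γ γ' β n) ω : ℝ) * Complex.I) ∂μ) atTop
      (𝓝 (Complex.exp (lam * stableExponent γ (degreeConst γ' β lam' * t)))) := by
  have hγ0 : 0 < γ := by linarith
  have hrate : varRate γ γ' β lam lam' 0 1 0 ≠ ∞ :=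
    varRate_ne_top hγ1 hγ' (by linarith) (by linarith) (Or.inl rfl)
  have h1 : Tendsto (fun n : ℕ ↦ Complex.exp (lam * ∫ v in (0 : ℝ)..n,
      compExp (degreeConst γ' β lam' * t * v ^ (-γ)))) atTop
      (𝓝 (Complex.exp (lam * stableExponent γ (degreeConst γ' β lam' * t)))) :=
    (Complex.continuous_exp.tendsto _).comp ((intervalIntegral_tendsto_integral_Ioi 0
      (integrableOn_compExp_rpow hγ hγ1 _) tendsto_natCast_atTop_atTop).const_mul _)
  set C : ℝ := (ENNReal.ofReal lam * varRate γ γ' β lam lam' 0 1 0).toReal with hC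
  have h2 : Tendsto (fun n : ℕ ↦ |t| * √C * (n : ℝ) ^ (-(γ - 1 / 2))) atTop (𝓝 0) := by
    have := ((tendsto_rpow_neg_atTop (by linarith : 0 < γ - 1 / 2)).comp
      tendsto_natCast_atTop_atTop).const_mul (|t| * √C)
    simpa using this
  refine tendsto_of_tendsto_of_dist h1 (squeeze_zero' (.of_forall fun n ↦ dist_nonneg) ?_ h2)
  filter_upwards [eventually_gt_atTop 0] with n hn
  have hn0 : (0 : ℝ) < n := by exact_mod_cast hn
  have hr0 : 0 < (n : ℝ) ^ (-γ) := Real.rpow_pos_of_pos hn0 _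
  have hV := varBound_windowEdges_ne_top (lam := lam) (lam' := lam') hγ0 hγ1 hγ' hγ'3 hβ
    (Or.inl rfl : (0 : ℝ) = 0 ∨ _) n
  have h3 := norm_charFun_pairCount_sub_le hP hP' hind (measurableSet_windowEdges hγ0 hγ' n)
    (null_boundary_windowEdges hγ0 hγ' hβ n) (prod_windowEdges_ne_top hγ0 hγ1 hγ' hγ'3 hβ n) hV
    ((n : ℝ) ^ (-γ) * t)
  rw [integral_compExp_section_windowEdges hγ0 hγ' hβ hlam hlam'] at h3
  have h4 : (varBound (stripMeasure lam) (stripMeasure lam') 0 (windowEdges γ γ' β n)).toReal ≤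
      C * n := by
    refine (ENNReal.toReal_mono (ENNReal.mul_ne_top (ENNReal.mul_ne_top ENNReal.ofReal_ne_top
      (ENNReal.natCast_ne_top n)) hrate) (varBound_windowEdges_le hγ0 hγ' hβ 0 n)).trans
      (le_of_eq ?_)
    simp only [hC, ENNReal.toReal_mul, ENNReal.toReal_natCast]
    ring
  rw [dist_comm, dist_eq_norm]
  have e : ∀ ω, Complex.exp (t * ((n : ℝ) ^ (-γ) * centeredPairCount lam lam' P P'
      (windowEdges γ γ' β n) ω : ℝ) * Complex.I) = Complex.exp (((n : ℝ) ^ (-γ) * t : ℝ) *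
        ((pairCount (P ω) (P' ω) (windowEdges γ γ' β n)).toReal -
          ((stripMeasure lam).prod (stripMeasure lam')).real (windowEdges γ γ' β n) : ℝ) *
            Complex.I) := by
    intro ω
    congr 1
    simp only [centeredPairCount]
    push_cast
    ring
  simp_rw [e]
  refine h3.trans ?_
  have h5 : √(C * n) = √C * (n : ℝ) ^ (1 / 2 : ℝ) := by
    rw [Real.sqrt_mul ENNReal.toReal_nonneg, Real.sqrt_eq_rpow n]
  have h6 : (n : ℝ) ^ (-(γ - 1 / 2)) = (n : ℝ) ^ (-γ) * (n : ℝ) ^ (1 / 2 : ℝ) := by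
    rw [← Real.rpow_add hn0]
    congr 1
    ring
  calc |(n : ℝ) ^ (-γ) * t| * √_ ≤ |(n : ℝ) ^ (-γ) * t| * √(C * n) := by gcongr
    _ = |t| * √C * (n : ℝ) ^ (-(γ - 1 / 2)) := by
      rw [h5, h6, abs_mul, abs_of_pos hr0]
      ring

theorem exists_tendstoInDistribution_stable (hP : IsPoissonProcess P (stripMeasure lam) μ)
    (hP' : IsPoissonProcess P' (stripMeasure lam') μ)
    (hind : Indep (processSigmaAlgebra P) (processSigmaAlgebra P') μ)
    (hγ : 1 / 2 < γ) (hγ1 : γ < 1) (hγ' : 0 < γ') (hγ'3 : γ' < 1 / 3) (hβ : 0 < β)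
    (hlam : 0 < lam) (hlam' : 0 < lam') :
    ∃ ν : ProbabilityMeasure ℝ, IsStableLaw (1 / γ) (ν : Measure ℝ) ∧
      TendstoInDistribution (fun (n : ℕ) ω ↦ (n : ℝ) ^ (-γ) *
        centeredPairCount lam lam' P P' (windowEdges γ γ' β n) ω) atTop (id : ℝ → ℝ) (fun _ ↦ μ)
        (ν : Measure ℝ) := by
  have hγ0 : 0 < γ := by linarith
  have hc := degreeConst_pos (γ' := γ') (by linarith) hβ hlam'
  have hlim := tendsto_integral_cexp_stable hP hP' hind hγ hγ1 hγ' hγ'3 hβ hlam hlam'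
  have hX : ∀ n : ℕ, AEMeasurable (fun ω ↦ (n : ℝ) ^ (-γ) *
      centeredPairCount lam lam' P P' (windowEdges γ γ' β n) ω) μ := fun n ↦
    ((measurable_centeredPairCount hP hP'
      (measurableSet_windowEdges hγ0 hγ' n)).const_mul _).aemeasurable
  let ρ : ℕ → ProbabilityMeasure ℝ := fun n ↦ ⟨μ.map fun ω ↦ (n : ℝ) ^ (-γ) *
    centeredPairCount lam lam' P P' (windowEdges γ γ' β n) ω,
      Measure.isProbabilityMeasure_map (hX n)⟩
  have hcont : ContinuousAt
      (fun t : ℝ ↦ Complex.exp (lam * stableExponent γ (degreeConst γ' β lam' * t))) 0 := by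
    have h1 : ContinuousAt (fun t : ℝ ↦ stableExponent γ (degreeConst γ' β lam' * t)) 0 :=
      ContinuousAt.comp (g := stableExponent γ)
        (by simpa using continuousAt_stableExponent_zero hγ0) (by fun_prop)
    fun_prop
  obtain ⟨ν, hν⟩ := exists_charFun_eq_of_tendsto (ρ := ρ) hcont fun t ↦ by
    refine (hlim t).congr fun n ↦ ?_
    simp only [ρ, ProbabilityMeasure.coe_mk]
    rw [charFun_apply_real, integral_map (hX n) (by fun_prop)]
  refine ⟨ν, isStableLaw_of_charFun hγ hγ1 hc hlam hν,
    tendstoInDistribution_of_tendsto_integral_cexp hX fun t ↦ ?_⟩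
  rw [hν t]
  exact hlim t

end Stable

/-! ### The two limit theorems for the edge count. -/

theorem theorem2p2 {Ω : Type*} [MeasurableSpace Ω] (μ : Measure Ω) [IsProbabilityMeasure μ]
    (γ γ' β lam lam' : ℝ) (hγ : 0 < γ) (hγ1 : γ < 1) (hγ' : 0 < γ') (hγ'3 : γ' < 1 / 3)
    (hβ : 0 < β) (hlam : 0 < lam) (hlam' : 0 < lam')
    (P P' : Ω → Set Strip)
    (hP : IsPoissonProcess P (ENNReal.ofReal lam • volume) μ)
    (hP' : IsPoissonProcess P' (ENNReal.ofReal lam' • volume) μ)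
    (hind : Indep (processSigmaAlgebra P) (processSigmaAlgebra P') μ)
    (S : ℕ → Ω → ℝ) (hS : ∀ n ω, S n ω = (edgeCount γ γ' β P P' n ω).toReal) :
    (∀ n, (∀ᵐ ω ∂μ, edgeCount γ γ' β P P' n ω < ∞) ∧ Integrable (S n) μ) ∧
    (γ < 1 / 2 → ∃ σ : ℝ≥0,
      TendstoInDistribution
        (fun (n : ℕ) ω ↦ (n : ℝ) ^ (-(1 / 2) : ℝ) * (S n ω - ∫ ω', S n ω' ∂μ))
        atTop (id : ℝ → ℝ) (fun _ ↦ μ) (gaussianReal 0 (σ ^ 2))) ∧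
    (1 / 2 < γ → ∃ ν : ProbabilityMeasure ℝ, IsStableLaw (1 / γ) (ν : Measure ℝ) ∧
      TendstoInDistribution
        (fun (n : ℕ) ω ↦ (n : ℝ) ^ (-γ) * (S n ω - ∫ ω', S n ω' ∂μ))
        atTop (id : ℝ → ℝ) (fun _ ↦ μ) (ν : Measure ℝ)) := by
  have hWm := fun n ↦ measurableSet_windowEdges (β := β) hγ hγ' n
  have hW := fun n ↦ prod_windowEdges_ne_top (lam := lam) (lam' := lam') hγ hγ1 hγ' hγ'3 hβ n
  have hS' : ∀ n, S n = fun ω ↦ (pairCount (P ω) (P' ω) (windowEdges γ γ' β n)).toReal := by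
    intro n
    ext ω
    rw [hS, edgeCount_eq_pairCount hP' hγ hγ']
  have hcenter : ∀ n ω, S n ω - ∫ ω', S n ω' ∂μ =
      centeredPairCount lam lam' P P' (windowEdges γ γ' β n) ω := by
    intro n ω
    simp only [hS', centeredPairCount]
    rw [integral_pairCount hP hP' hind (hWm n) (hW n)]
  refine ⟨fun n ↦ ⟨?_, ?_⟩, fun hγ2 ↦ ?_, fun hγ2 ↦ ?_⟩
  · filter_upwards [ae_pairCount_lt_top hP hP' hind (hWm n) (hW n)] with ω hω
    rwa [edgeCount_eq_pairCount hP' hγ hγ']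
  · rw [hS']
    exact integrable_pairCount hP hP' hind (hWm n) (hW n)
  · simp_rw [hcenter]
    exact exists_tendstoInDistribution_gaussianReal hP hP' hind hγ hγ2 hγ' hγ'3 hβ
  · simp_rw [hcenter]
    exact exists_tendstoInDistribution_stable hP hP' hind hγ2 hγ1 hγ' hγ'3 hβ hlam hlam'
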